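/- **Setting.** Let $d\ge 1$, let $\mathbb S^{d-1}$ and $\mathbb B^d$ be the Euclidean unit sphere and closed unit ball of $\mathbb R^d$. The link function $f:[-1,1]\to[-1,1]$ is known and satisfies $f(0)=0$, $f(1)=1$, and either (i) $f$ is nondecreasing on $[-1,1]$, or (ii) $f$ is even and nondecreasing on $[0,1]$. In the ridge bandit with unknown parameter $\theta^\star\in\mathbb S^{d-1}$ a (possibly randomized) learner chooses at each time $t=1,\dots,T$ an action $a_t\in\mathbb B^d$ based on the history $\mathcal H_{t-1}=\{(a_s,r_s)\}_{s<t}$ and observes $r_t=f(\langle\theta^\star,a_t\rangle)+z_t$ with i.i.d. $z_t\sim\mathcal N(0,1)$; at the end it outputs an estimator $\widehat\theta_T=\widehat\theta_T(\mathcal H_T)\in\mathbb S^{d-1}$. For $\varepsilon\in(0,1/2]$ the burn-in cost for achieving inner product $\varepsilon$ is $$T^\star_{\rm burn\text{-}in}(f,d,\varepsilon)=\min\Big\{T:\ \inf\ \sup_{\theta^\star\in\mathbb S^{d-1}}\mathbb E_{\theta^\star}\big[1-\langle\widehat\theta_T,\theta^\star\rangle\big]\le 1-\varepsilon\Big\}\in\{0,1,2,\dots\}\cup\{\infty\},$$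 where the infimum is over all learners with $T$ rounds, and where, if $f$ is even (so that $\theta^\star$ and $-\theta^\star$ cannot be distinguished), $\langle\widehat\theta_T,\theta^\star\rangle$ is replaced by $|\langle\widehat\theta_T,\theta^\star\rangle|$. Integrals take values in $[0,\infty]$, with integrand $+\infty$ where its denominator is $0$; $\mathrm d(x^2)=2x\,\mathrm dx$; max and min are read as supremum and infimum; and $f'(z)$ is read as $0$ at points where $f$ is not differentiable. **Theorem.** 1. (Upper bound.) There are absolute constants $c_1,C>0$ and $k\in\mathbb N$ such that for all $d$ and $f$ as above and all $\varepsilon\in[\sqrt{2c_1/d},\,1/2]$, $$T^\star_{\rm burn\text{-}in}(f,d,\varepsilon)\ \le\ C(1+\log d)^k\cdot d^2\int_{\sqrt{c_1/d}}^{\varepsilon}\frac{\mathrm d(x^2)}{\max_{\sqrt{c_1/d}\le y\le x}\ \min_{z\in[y/2,y]}[f'(z)]^2}.$$ 2. (Lower bound.) There are absolute constants $c_2,C>0$ and $k\in\mathbb N$ such that for all $d$ and $f$ as above with $f$ in addition even or odd, all integers $T\ge 2$ and all $\varepsilon\in[\sqrt{c_2\log(T)/d},\,1/2]$: if $T^\star_{\rm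 burn\text{-}in}(f,d,\varepsilon)\le T$, then $$C(1+\log d+\log T)^k\cdot T^\star_{\rm burn\text{-}in}(f,d,\varepsilon)\ \ge\ d\int_{\sqrt{c_2\log(T)/d}}^{\varepsilon}\frac{\mathrm d(x^2)}{f(x)^2}.$$ -/

import Mathlib

open MeasureTheory ProbabilityTheory Set
open scoped ENNReal

namespace RidgeBandit

/-- The parameter set: the unit sphere of `ℝ^d` with the Euclidean norm. -/
abbrev Sphere (d : ℕ) : Type := Metric.sphere (0 : EuclideanSpace ℝ (Fin d)) 1

/-- The action set: the closed unit ball of `ℝ^d` with the Euclidean norm. -/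
abbrev Ball (d : ℕ) : Type := Metric.closedBall (0 : EuclideanSpace ℝ (Fin d)) 1

/-- The observed history after `t` rounds: the `t` pairs (action, reward). -/
abbrev Hist (d t : ℕ) : Type := Fin t → Ball d × ℝ

/-- `f` is even on `[-1, 1]`. -/
def IsEven (f : ℝ → ℝ) : Prop := ∀ x ∈ Icc (-1 : ℝ) 1, f (-x) = f x

/-- `f` is odd on `[-1, 1]`. -/
def IsOdd (f : ℝ → ℝ) : Prop := ∀ x ∈ Icc (-1 : ℝ) 1, f (-x) = -f x

/-- The regularity conditions on the link function `f : [-1, 1] → [-1, 1]`.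
Only the values of `f` on `[-1, 1]` matter. -/
structure LinkFunction (f : ℝ → ℝ) : Prop where
  map_zero : f 0 = 0
  map_one : f 1 = 1
  abs_le_one : ∀ x ∈ Icc (-1 : ℝ) 1, |f x| ≤ 1
  monotone : MonotoneOn f (Icc (-1) 1) ∨ (IsEven f ∧ MonotoneOn f (Icc 0 1))

/-- A (possibly randomized) learner with `T` rounds: a source of internal randomness, for each round
an action that is a measurable function of the internal randomness and of the history of the
previous rounds (round `t` below is preceded by `t` rounds), and an estimator
that is a measurable function of the internal randomness and of the final history. -/
structure Learner (d T : ℕ) where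
  /-- the space of the internal randomness -/
  Seed : Type
  [seedSpace : MeasurableSpace Seed]
  /-- the law of the internal randomness -/
  law : Measure Seed
  [law_prob : IsProbabilityMeasure law]
  action : (t : ℕ) → Seed → Hist d t → Ball d
  measurable_action : ∀ t, Measurable (fun p : Seed × Hist d t => action t p.1 p.2)
  estimator : Seed → Hist d T → Sphere d
  measurable_estimator : Measurable (fun p : Seed × Hist d T => estimator p.1 p.2)

attribute [instance] Learner.seedSpace Learner.law_prob

/-- The history after `t` rounds of the ridge bandit with link function `f` and parameter `θ`, as a
function of the internal randomness `s` and of the noise sequence `z`: in each round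
the action `a` yields the reward `f ⟨θ, a⟩ + z t`. -/
noncomputable def Learner.history {d T : ℕ} (L : Learner d T) (f : ℝ → ℝ) (θ : Sphere d)
    (s : L.Seed) (z : ℕ → ℝ) : (t : ℕ) → Hist d t
  | 0 => Fin.elim0
  | t + 1 =>
    let h : Hist d t := L.history f θ s z t
    let a : Ball d := L.action t s h
    Fin.snoc h (a, f (inner ℝ θ.1 a.1) + z t)

/-- The joint law of the internal randomness and of the i.i.d. standard normal noise. -/
noncomputable def Learner.prob {d T : ℕ} (L : Learner d T) : Measure (L.Seed × (ℕ → ℝ)) :=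
  L.law.prod (Measure.infinitePi fun _ : ℕ => gaussianReal 0 1)

open Classical in
/-- The correlation of an estimate with the parameter, given their inner product `x`. If the
link function is even, then `θ` and `-θ` yield the same observations and the
correlation is taken up to sign. -/
noncomputable def correlation (f : ℝ → ℝ) (x : ℝ) : ℝ := if IsEven f then |x| else x

/-- The risk `E_θ [1 - ⟨θ̂_T, θ⟩]` of a learner (with `|⟨θ̂_T, θ⟩|` for even `f`). The
integrand is nonnegative. -/
noncomputable def Learner.risk {d T : ℕ} (L : Learner d T) (f : ℝ → ℝ) (θ : Sphere d) : ℝ≥0∞ :=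
  ∫⁻ p, ENNReal.ofReal
    (1 - correlation f (inner ℝ (L.estimator p.1 (L.history f θ p.1 p.2 T)).1 θ.1)) ∂L.prob

/-- The minimax risk after `T` rounds. -/
noncomputable def minimaxRisk (f : ℝ → ℝ) (d T : ℕ) : ℝ≥0∞ :=
  ⨅ L : Learner d T, ⨆ θ : Sphere d, L.risk f θ

/-- The sample complexity `T⋆(f, d, ε)` of estimating the parameter within accuracy `ε`; it is `⊤`
if no number of rounds suffices. -/
noncomputable def sampleComplexity (f : ℝ → ℝ) (d : ℕ) (ε : ℝ) : ℕ∞ :=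
  ⨅ (T : ℕ) (_ : minimaxRisk f d T ≤ ENNReal.ofReal ε), (T : ℕ∞)

/-- The minimax learning trajectory: the burn-in cost for achieving inner product `ε`. -/
noncomputable def burnInCost (f : ℝ → ℝ) (d : ℕ) (ε : ℝ) : ℕ∞ :=
  sampleComplexity f d (1 - ε)

/-- `max_{r ≤ y ≤ x} min_{z ∈ [y/2, y]} f'(z)²`. A point `z` at which `f` is not
differentiable contributes the value `0`. -/
noncomputable def bestSlopeSq (f : ℝ → ℝ) (r x : ℝ) : ℝ≥0∞ :=
  ⨆ y ∈ Icc r x, ⨅ z ∈ Icc (y / 2) y, ENNReal.ofReal (deriv f z ^ 2)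

/-- `∫_r^ε d(x²) / max_{r ≤ y ≤ x} min_{z ∈ [y/2, y]} f'(z)²`, where `d(x²) = 2x dx` and the
integrand is `∞` where the denominator vanishes. -/
noncomputable def upperIntegral (f : ℝ → ℝ) (r ε : ℝ) : ℝ≥0∞ :=
  ∫⁻ x in Ioc r ε, ENNReal.ofReal (2 * x) / bestSlopeSq f r x

/-- `∫_r^ε d(x²) / f(x)²`, where `d(x²) = 2x dx` and the integrand is `∞` where `f` vanishes. -/
noncomputable def lowerIntegral (f : ℝ → ℝ) (r ε : ℝ) : ℝ≥0∞ :=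
  ∫⁻ x in Ioc r ε, ENNReal.ofReal (2 * x) / ENNReal.ofReal (f x ^ 2)

end RidgeBandit

/-! Lower bound. Put the uniform prior on the vectors with coordinates `±1/√d`. Under pure noise the
actions do not depend on `θ`, so `√d ⟨θ, a⟩` is subgaussian over the prior. The true law is compared
with pure noise through the likelihood ratio, whose second moment is finite only in a useful way
while the past correlations stay below deterministic levels `x_i`; restricted to that event it is at
most `exp(S_t)` with `S_t = ∑_{i<t} f(x_i)²` (`Learner.lintegral_lowCorr_sq_le`). By Cauchy–Schwarz,
in the form of a weighted AM-GM inequality, the next correlation exceeds `e/√d` with probability of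
order `exp(S_t/2 - e²/8)` (`Learner.sum_lintegral_excess_le`). Hence `d x_t² = 256 log n + 8 S_t` is
a safe choice of levels. This reads `d (x_{t+1}² - x_t²) = 8 f(x_t)²`, a discretized differential
equation, and monotonicity of `f` turns it into `∫ d(x²)/f(x)² ≤ 8m/d` over the range of
correlations reached in `m` rounds (`lintegral_corrLevelSq_le`). A learner with risk at most `1 - ε`
must have reached `ε`. No logarithm is lost in front of the burn-in cost.

Upper bound. The correlation is raised by factors `√2`, in about `log d` stages. Given an action `a`
of correlation at least `X`, choose a scale `y ≤ X` with nearly the best slope `m` on `[y/2, y]`.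
Play `c a + u`, where `u` is a truncated Gaussian vector with coordinates of order `1/√d` and `c` is
drawn from a geometric grid, since the correlation of `a` is known only from below. By rotational
symmetry the mean of reward times `u` is a multiple `s` of `θ` (`integral_mul_inner_dirVec`), and `s
≳ m / (d log d)` because some grid point moves the correlation into the middle of `[y/2, y]`
(`le_gridSignal`). The sum `W` of reward times `u` over `n` rounds is `n s θ` plus noise of norm of
order `√n`, so its direction has correlation `≳ X` as soon as `n ≳ X²/s²`, that is, `d² X²/m²` up to
logarithms (`Realizable.stage`). This is the part of the integral over `[X/√2, X]`. Failure
probabilities add up over the stages, and they are kept below `1/6` by taking `δ` of order `1/log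
d`.

At the start a monotone `f` is explored from the origin. For even `f` the signal vanishes there, but
a random vector already has correlation of order `1/√d` up to sign. At the end the last vector, of
norm at most one, is rounded to the sphere by a random sign that preserves its mean. -/

namespace RidgeBandit

/-! ### Preliminaries for both bounds: the link function off `[-1, 1]`, fresh noise in each round.
-/

section

/-! ### The link function, extended to the real line -/

/-- The link function precomposed with the projection onto `[-1, 1]`. -/
noncomputable def clipLink (f : ℝ → ℝ) (x : ℝ) : ℝ := f (max (-1) (min 1 x))

lemma clip_mem_Icc (x : ℝ) : max (-1) (min 1 x) ∈ Icc (-1 : ℝ) 1 :=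
  ⟨le_max_left _ _, max_le (by norm_num) (min_le_left _ _)⟩

lemma clipLink_eq (f : ℝ → ℝ) {x : ℝ} (hx : x ∈ Icc (-1 : ℝ) 1) : clipLink f x = f x := by
  rw [clipLink, min_eq_right hx.2, max_eq_right hx.1]

lemma clipLink_zero {f : ℝ → ℝ} (hf : LinkFunction f) : clipLink f 0 = 0 := by
  rw [clipLink_eq f (by norm_num), hf.map_zero]

lemma abs_clipLink_le_one {f : ℝ → ℝ} (hf : LinkFunction f) (x : ℝ) : |clipLink f x| ≤ 1 :=
  hf.abs_le_one _ (clip_mem_Icc x)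

lemma monotone_clip : Monotone fun x : ℝ => max (-1) (min 1 x) := fun _ _ h =>
  max_le_max le_rfl (min_le_min le_rfl h)

lemma clip_neg (x : ℝ) : max (-1) (min 1 (-x)) = -max (-1) (min 1 x) := by
  rw [← min_neg_neg, ← max_neg_neg, max_min_distrib_left]
  simp

lemma clipLink_neg_of_isEven {f : ℝ → ℝ} (he : IsEven f) (x : ℝ) :
    clipLink f (-x) = clipLink f x := by
  rw [clipLink, clip_neg, he _ (clip_mem_Icc x), clipLink]

lemma clipLink_neg_of_isOdd {f : ℝ → ℝ} (ho : IsOdd f) (x : ℝ) :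
    clipLink f (-x) = -clipLink f x := by
  rw [clipLink, clip_neg, ho _ (clip_mem_Icc x), clipLink]

lemma clipLink_mono {f : ℝ → ℝ} (hm : MonotoneOn f (Icc (-1) 1)) : Monotone (clipLink f) :=
  fun _ _ h => hm (clip_mem_Icc _) (clip_mem_Icc _) (monotone_clip h)

lemma clipLink_monotoneOn {f : ℝ → ℝ} (hf : LinkFunction f) : MonotoneOn (clipLink f) (Ici 0) := by
  intro x hx y hy h
  have h0 : ∀ z : ℝ, 0 ≤ z → max (-1) (min 1 z) ∈ Icc (0 : ℝ) 1 := fun z hz =>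
    ⟨le_max_of_le_right (le_min zero_le_one hz), (clip_mem_Icc z).2⟩
  rcases hf.monotone with hm | ⟨-, hm⟩
  · exact clipLink_mono hm h
  · exact hm (h0 x hx) (h0 y hy) (monotone_clip h)

lemma clipLink_abs_of_isEven {f : ℝ → ℝ} (he : IsEven f) (x : ℝ) :
    clipLink f |x| = clipLink f x := by
  rcases abs_choice x with h | h <;> rw [h]
  exact clipLink_neg_of_isEven he x

/-- The raw `f` is arbitrary outside `[-1, 1]` and may fail to be measurable there, which is the
reason for clipping. In the even case measurability comes from the monotone branch composed with the
absolute value. -/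
lemma measurable_clipLink {f : ℝ → ℝ} (hf : LinkFunction f) : Measurable (clipLink f) := by
  rcases hf.monotone with hm | ⟨he, -⟩
  · exact (clipLink_mono hm).measurable
  · have h1 : Monotone fun x : ℝ => clipLink f (max x 0) := fun x y h =>
      clipLink_monotoneOn hf (mem_Ici.2 (le_max_right _ _)) (mem_Ici.2 (le_max_right _ _))
        (max_le_max h le_rfl)
    have h2 : clipLink f = (fun x : ℝ => clipLink f (max x 0)) ∘ fun x => |x| := by
      ext x
      simp [clipLink_abs_of_isEven he]
    rw [h2]
    exact h1.measurable.comp measurable_norm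

lemma clipLink_nonneg {f : ℝ → ℝ} (hf : LinkFunction f) {x : ℝ} (hx : 0 ≤ x) :
    0 ≤ clipLink f x := by
  rw [← clipLink_zero hf]
  exact clipLink_monotoneOn hf (mem_Ici.2 le_rfl) hx hx

lemma abs_clipLink_le {f : ℝ → ℝ} (hf : LinkFunction f) (h : IsEven f ∨ IsOdd f) {x y : ℝ}
    (hxy : |x| ≤ y) : |clipLink f x| ≤ clipLink f y := by
  have h1 : |clipLink f x| = |clipLink f (|x|)| := by
    rcases abs_choice x with hx | hx
    · rw [hx]
    · rcases h with h | h
      · rw [hx, clipLink_neg_of_isEven h]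
      · rw [hx, clipLink_neg_of_isOdd h, abs_neg]
  rw [h1, abs_of_nonneg (clipLink_nonneg hf (abs_nonneg x))]
  exact clipLink_monotoneOn hf (abs_nonneg x) ((abs_nonneg x).trans hxy) hxy

/-- The two alternatives for `f` exclude each other because `f(0) < f(1)`; hence `correlation` is
the signed inner product throughout the monotone case. -/
lemma not_isEven_of_monotoneOn {f : ℝ → ℝ} (hf : LinkFunction f)
    (hm : MonotoneOn f (Icc (-1) 1)) : ¬ IsEven f := by
  intro he
  have h1 := he 1 (by norm_num)
  have h2 := hm (a := -1) (b := 0) (by norm_num) (by norm_num) (by norm_num)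
  rw [h1, hf.map_one, hf.map_zero] at h2
  norm_num at h2

/-! ### The history of a learner -/

lemma abs_inner_le_one {d : ℕ} (θ : Sphere d) (a : Ball d) : |inner ℝ θ.1 a.1| ≤ 1 := by
  have h1 : ‖θ.1‖ = 1 := norm_eq_of_mem_sphere θ
  have h2 : ‖a.1‖ ≤ 1 := mem_closedBall_zero_iff.1 a.2
  calc |inner ℝ θ.1 a.1| ≤ ‖θ.1‖ * ‖a.1‖ := abs_real_inner_le_norm _ _
    _ ≤ 1 := by rw [h1, one_mul]; exact h2

lemma inner_mem_Icc {d : ℕ} (θ : Sphere d) (a : Ball d) :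
    inner ℝ θ.1 a.1 ∈ Icc (-1 : ℝ) 1 := abs_le.1 (abs_inner_le_one θ a)

variable {d T : ℕ}

instance (L : Learner d T) : IsProbabilityMeasure L.prob := by
  unfold Learner.prob; infer_instance

/-- Inner products of actions with the parameter never leave `[-1, 1]`, so all arguments may use the
measurable, bounded `clipLink f`. -/
lemma Learner.history_clipLink (L : Learner d T) (f : ℝ → ℝ) (θ : Sphere d) (s : L.Seed)
    (z : ℕ → ℝ) (t : ℕ) : L.history (clipLink f) θ s z t = L.history f θ s z t := by
  induction t with
  | zero => rfl
  | succ t ih => simp only [Learner.history, ih, clipLink_eq f (inner_mem_Icc _ _)]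

lemma Learner.history_congr_noise (L : Learner d T) (f : ℝ → ℝ) (θ : Sphere d) (s : L.Seed)
    {z z' : ℕ → ℝ} {t : ℕ} (h : ∀ i < t, z i = z' i) :
    L.history f θ s z t = L.history f θ s z' t := by
  induction t with
  | zero => rfl
  | succ t ih =>
    simp only [Learner.history, ih fun i hi => h i (hi.trans t.lt_succ_self), h t t.lt_succ_self]

lemma measurable_snoc {α : Type*} [MeasurableSpace α] {t : ℕ} :
    Measurable fun p : (Fin t → α) × α => (Fin.snoc p.1 p.2 : Fin (t + 1) → α) := by
  refine measurable_pi_lambda _ fun i => ?_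
  refine Fin.lastCases ?_ (fun j => ?_) i
  · simpa using measurable_snd
  · simpa using (by fun_prop : Measurable fun p : (Fin t → α) × α => p.1 j)

lemma Learner.measurable_history (L : Learner d T) {f : ℝ → ℝ} (hf : Measurable f) (θ : Sphere d)
    (t : ℕ) : Measurable fun p : L.Seed × (ℕ → ℝ) => L.history f θ p.1 p.2 t := by
  induction t with
  | zero => exact measurable_const
  | succ t ih =>
    have ha : Measurable fun p : L.Seed × (ℕ → ℝ) =>
        L.action t p.1 (L.history f θ p.1 p.2 t) :=
      (L.measurable_action t).comp (measurable_fst.prodMk ih)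
    have hr : Measurable fun p : L.Seed × (ℕ → ℝ) =>
        f (inner ℝ θ.1 (L.action t p.1 (L.history f θ p.1 p.2 t)).1) + p.2 t :=
      (hf.comp (measurable_const.inner ha.subtype_val)).add
        ((measurable_pi_apply t).comp measurable_snd)
    exact measurable_snoc.comp (ih.prodMk (ha.prodMk hr))

/-- A coordinate of an infinite product may be resampled. -/
lemma measurePreserving_update_infinitePi {X : Type*} [MeasurableSpace X] (γ : Measure X)
    [IsProbabilityMeasure γ] (t : ℕ) :
    MeasurePreserving (fun p : (ℕ → X) × X => Function.update p.1 t p.2)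
      ((Measure.infinitePi fun _ : ℕ => γ).prod γ) (Measure.infinitePi fun _ : ℕ => γ) := by
  have hm : Measurable (fun p : (ℕ → X) × X => Function.update p.1 t p.2) := by
    refine measurable_pi_lambda _ fun i => ?_
    by_cases h : i = t
    · subst h; simpa using measurable_snd
    · simpa [Function.update_of_ne h] using
        (by fun_prop : Measurable fun p : (ℕ → X) × X => p.1 i)
  refine ⟨hm, ?_⟩
  refine Measure.eq_infinitePi _ fun s u hu => ?_
  rw [Measure.map_apply hm (MeasurableSet.pi s.countable_toSet fun i _ => hu i)]
  have hset : (fun p : (ℕ → X) × X => Function.update p.1 t p.2) ⁻¹' (Set.pi s u)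
      = (Set.pi (s.erase t : Finset ℕ) u) ×ˢ (if t ∈ s then u t else univ) := by
    ext p
    simp only [mem_preimage, Set.mem_pi, mem_prod, Finset.coe_erase, mem_sdiff, Finset.mem_coe,
      mem_singleton_iff]
    constructor
    · intro h
      refine ⟨fun i hi => by simpa [Function.update_of_ne hi.2] using h i hi.1, ?_⟩
      split_ifs with ht
      · simpa using h t ht
      · trivial
    · rintro ⟨h1, h2⟩ i hi
      by_cases hit : i = t
      · subst hit; simpa [hi] using h2
      · simpa [Function.update_of_ne hit] using h1 i ⟨hi, hit⟩
  rw [hset, Measure.prod_prod, Measure.infinitePi_pi _ (fun i _ => hu i)]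
  split_ifs with ht
  · rw [mul_comm, Finset.mul_prod_erase s (fun i => γ (u i)) ht]
  · rw [measure_univ, mul_one, Finset.erase_eq_of_notMem ht]

/-- The reward of the next round has fresh noise. -/
lemma Learner.lintegral_history_succ (L : Learner d T) {f : ℝ → ℝ} (hf : Measurable f)
    (θ : Sphere d) (t : ℕ) {Φ : L.Seed × Hist d (t + 1) → ℝ≥0∞} (hΦ : Measurable Φ) :
    ∫⁻ p, Φ (p.1, L.history f θ p.1 p.2 (t + 1)) ∂L.prob =
      ∫⁻ p, ∫⁻ y, Φ (p.1, Fin.snoc (L.history f θ p.1 p.2 t)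
        (L.action t p.1 (L.history f θ p.1 p.2 t),
          f (inner ℝ θ.1 (L.action t p.1 (L.history f θ p.1 p.2 t)).1) + y))
          ∂(gaussianReal 0 1) ∂L.prob := by
  have hΨ : Measurable fun p : L.Seed × (ℕ → ℝ) =>
      Φ (p.1, L.history f θ p.1 p.2 (t + 1)) :=
    hΦ.comp (measurable_fst.prodMk (L.measurable_history hf θ (t + 1)))
  have ha : Measurable fun p : L.Seed × (ℕ → ℝ) =>
      L.action t p.1 (L.history f θ p.1 p.2 t) :=
    (L.measurable_action t).comp (measurable_fst.prodMk (L.measurable_history hf θ t))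
  have hΨ' : Measurable fun q : (L.Seed × (ℕ → ℝ)) × ℝ =>
      Φ (q.1.1, Fin.snoc (L.history f θ q.1.1 q.1.2 t)
        (L.action t q.1.1 (L.history f θ q.1.1 q.1.2 t),
          f (inner ℝ θ.1 (L.action t q.1.1 (L.history f θ q.1.1 q.1.2 t)).1) + q.2)) := by
    refine hΦ.comp ((measurable_fst.comp measurable_fst).prodMk (measurable_snoc.comp
      (((L.measurable_history hf θ t).comp measurable_fst).prodMk
        ((ha.comp measurable_fst).prodMk (Measurable.add (hf.comp ?_) measurable_snd)))))
    exact measurable_const.inner (ha.comp measurable_fst).subtype_val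
  rw [Learner.prob, lintegral_prod _ hΨ.aemeasurable,
    lintegral_prod _ hΨ'.lintegral_prod_right'.aemeasurable]
  refine lintegral_congr fun s => ?_
  have hs : Measurable fun z : ℕ → ℝ => Φ (s, L.history f θ s z (t + 1)) :=
    hΨ.comp measurable_prodMk_left
  -- Resampling the noise coordinate `t` preserves the law, and the history of the first `t` rounds
  -- does not see this coordinate.
  rw [← (measurePreserving_update_infinitePi (gaussianReal 0 1) t).lintegral_comp hs,
    lintegral_prod (fun q : (ℕ → ℝ) × ℝ =>
      Φ (s, L.history f θ s (Function.update q.1 t q.2) (t + 1)))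
      (hs.comp (measurePreserving_update_infinitePi (gaussianReal 0 1) t).measurable).aemeasurable]
  refine lintegral_congr fun z => lintegral_congr fun y => ?_
  have h : L.history f θ s (Function.update z t y) t = L.history f θ s z t :=
    L.history_congr_noise f θ s fun i hi => Function.update_of_ne hi.ne _ _
  simp only [Learner.history, h, Function.update_self]

end

/-! ### Lower bound: likelihood ratios against pure noise, truncated to low correlations. -/

section

variable {d T : ℕ}

/-! ### Likelihood ratios -/

/-- Translating the standard normal law amounts to an exponential tilt. -/
lemma lintegral_gaussianReal_translate (m : ℝ) {G : ℝ → ℝ≥0∞} (hG : Measurable G) :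
    ∫⁻ y, G (m + y) ∂(gaussianReal 0 1) =
      ∫⁻ y, G y * ENNReal.ofReal (Real.exp (m * y - m ^ 2 / 2)) ∂(gaussianReal 0 1) := by
  have h1 : ∫⁻ y, G (m + y) ∂(gaussianReal 0 1) = ∫⁻ y, G y ∂(gaussianReal m 1) := by
    have h := gaussianReal_map_const_add (μ := 0) (v := 1) m
    rw [zero_add] at h
    rw [← h, lintegral_map hG (by fun_prop)]
  rw [h1, gaussianReal_of_var_ne_zero _ one_ne_zero, gaussianReal_of_var_ne_zero _ one_ne_zero,
    lintegral_withDensity_eq_lintegral_mul _ (measurable_gaussianPDF _ _) hG,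
    lintegral_withDensity_eq_lintegral_mul _ (measurable_gaussianPDF _ _) (by fun_prop)]
  refine lintegral_congr fun y => ?_
  simp only [Pi.mul_apply, gaussianPDF]
  rw [mul_comm (G y), ← mul_assoc, ← ENNReal.ofReal_mul (gaussianPDFReal_nonneg _ _ _)]
  congr 2
  simp only [gaussianPDFReal, NNReal.coe_one, mul_one]
  rw [mul_assoc, ← Real.exp_add]
  congr 2
  ring

lemma lintegral_exp_gaussianReal (m : ℝ) :
    ∫⁻ y, ENNReal.ofReal (Real.exp (m * y - m ^ 2 / 2)) ∂(gaussianReal 0 1) = 1 := by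
  have h := lintegral_gaussianReal_translate m (G := fun _ => 1) measurable_const
  simpa using h.symm

/-- The log-likelihood ratio of a history between the parameter `θ` and pure noise. -/
noncomputable def logLik (F : ℝ → ℝ) (θ : Sphere d) {t : ℕ} (h : Hist d t) : ℝ :=
  ∑ i, (F (inner ℝ θ.1 (h i).1.1) * (h i).2 - F (inner ℝ θ.1 (h i).1.1) ^ 2 / 2)

lemma logLik_snoc (F : ℝ → ℝ) (θ : Sphere d) {t : ℕ} (h : Hist d t) (p : Ball d × ℝ) :
    logLik F θ (Fin.snoc h p : Hist d (t + 1)) =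
      logLik F θ h + (F (inner ℝ θ.1 p.1.1) * p.2 - F (inner ℝ θ.1 p.1.1) ^ 2 / 2) := by
  simp only [logLik, Fin.sum_univ_castSucc, Fin.snoc_castSucc, Fin.snoc_last]

lemma measurable_logLik {F : ℝ → ℝ} (hF : Measurable F) (θ : Sphere d) (t : ℕ) :
    Measurable fun h : Hist d t => logLik F θ h := by
  unfold logLik
  have h1 : ∀ i, Measurable fun h : Hist d t => F (inner ℝ θ.1 (h i).1.1) := fun i =>
    hF.comp (measurable_const.inner (by fun_prop))
  exact Finset.measurable_fun_sum _ fun i _ => ((h1 i).mul (by fun_prop)).sub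
    (((h1 i).pow_const 2).div_const 2)

/-- The history when the rewards are pure noise. -/
noncomputable abbrev Learner.noiseHistory (L : Learner d T) (θ : Sphere d) (s : L.Seed)
    (z : ℕ → ℝ) (t : ℕ) : Hist d t := L.history (fun _ => 0) θ s z t

/-- This is why pure noise is the reference law: decisions made under it can be held fixed while `θ`
is averaged over the prior. -/
lemma Learner.noiseHistory_eq (L : Learner d T) (θ θ' : Sphere d) (s : L.Seed)
    (z : ℕ → ℝ) (t : ℕ) : L.noiseHistory θ s z t = L.noiseHistory θ' s z t := by
  induction t with
  | zero => rfl
  | succ t ih => simp only [Learner.noiseHistory, Learner.history] at ih ⊢; rw [ih]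

/-- Change of measure to pure noise. -/
lemma Learner.lintegral_history_eq (L : Learner d T) {F : ℝ → ℝ} (hF : Measurable F)
    (θ : Sphere d) (t : ℕ) {Φ : L.Seed × Hist d t → ℝ≥0∞} (hΦ : Measurable Φ) :
    ∫⁻ p, Φ (p.1, L.history F θ p.1 p.2 t) ∂L.prob =
      ∫⁻ p, Φ (p.1, L.noiseHistory θ p.1 p.2 t) *
        ENNReal.ofReal (Real.exp (logLik F θ (L.noiseHistory θ p.1 p.2 t))) ∂L.prob := by
  induction t with
  | zero => simp [logLik, Learner.history]
  | succ t ih =>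
    have ha : Measurable fun q : L.Seed × Hist d t => L.action t q.1 q.2 := L.measurable_action t
    have hi : Measurable fun q : L.Seed × Hist d t => F (inner ℝ θ.1 (L.action t q.1 q.2).1) :=
      hF.comp (measurable_const.inner ha.subtype_val)
    have hs : Measurable fun q : (L.Seed × Hist d t) × ℝ =>
        (q.1.1, (Fin.snoc q.1.2 (L.action t q.1.1 q.1.2,
          F (inner ℝ θ.1 (L.action t q.1.1 q.1.2).1) + q.2) : Hist d (t + 1))) := by
      refine (measurable_fst.comp measurable_fst).prodMk (measurable_snoc.comp
        ((measurable_snd.comp measurable_fst).prodMk ((ha.comp measurable_fst).prodMk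
          ((hi.comp measurable_fst).add measurable_snd))))
    have hs0 : Measurable fun q : (L.Seed × Hist d t) × ℝ =>
        (q.1.1, (Fin.snoc q.1.2 (L.action t q.1.1 q.1.2, q.2) : Hist d (t + 1))) := by
      refine (measurable_fst.comp measurable_fst).prodMk (measurable_snoc.comp
        ((measurable_snd.comp measurable_fst).prodMk ((ha.comp measurable_fst).prodMk
          measurable_snd)))
    rw [L.lintegral_history_succ hF θ t hΦ,
      L.lintegral_history_succ (f := fun _ => 0) measurable_const θ t
        (Φ := fun q => Φ q * ENNReal.ofReal (Real.exp (logLik F θ q.2)))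
        (hΦ.mul ((measurable_logLik hF θ _).comp measurable_snd).exp.ennreal_ofReal),
      ih (Φ := fun q => ∫⁻ y, Φ (q.1, Fin.snoc q.2 (L.action t q.1 q.2,
          F (inner ℝ θ.1 (L.action t q.1 q.2).1) + y)) ∂(gaussianReal 0 1))
        (hΦ.comp hs).lintegral_prod_right']
    refine lintegral_congr fun p => ?_
    simp only [zero_add]
    set h := L.noiseHistory θ p.1 p.2 t
    have hm : Measurable fun y : ℝ => Φ (p.1, Fin.snoc h (L.action t p.1 h, y)) :=
      (hΦ.comp hs0).comp (measurable_prodMk_left (x := (p.1, h)))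
    rw [lintegral_gaussianReal_translate _ hm, ← lintegral_mul_const _ (by fun_prop)]
    refine lintegral_congr fun y => ?_
    rw [logLik_snoc, mul_assoc, ← ENNReal.ofReal_mul (Real.exp_nonneg _), ← Real.exp_add,
      add_comm (logLik F θ h)]

/-! ### The event that no action has been too informative -/

open Classical in
/-- The indicator that the `i`-th action has correlation at most `b i` with `θ`, for all `i`. -/
noncomputable def lowCorr (b : ℕ → ℝ) (θ : Sphere d) {t : ℕ} (h : Hist d t) : ℝ≥0∞ :=
  if ∀ i : Fin t, |inner ℝ θ.1 (h i).1.1| ≤ b i then 1 else 0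

open Classical in
lemma lowCorr_snoc (b : ℕ → ℝ) (θ : Sphere d) {t : ℕ} (h : Hist d t) (p : Ball d × ℝ) :
    lowCorr b θ (Fin.snoc h p : Hist d (t + 1)) =
      lowCorr b θ h * if |inner ℝ θ.1 p.1.1| ≤ b t then 1 else 0 := by
  simp only [lowCorr, Fin.forall_fin_succ']
  simp only [Fin.snoc_castSucc, Fin.snoc_last, Fin.val_castSucc, Fin.val_last]
  split_ifs <;> simp_all

lemma lowCorr_le_one (b : ℕ → ℝ) (θ : Sphere d) {t : ℕ} (h : Hist d t) :
    lowCorr b θ h ≤ 1 := by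
  unfold lowCorr; split_ifs <;> simp

lemma lowCorr_eq_one {b : ℕ → ℝ} (hb : ∀ i, 1 ≤ b i) (θ : Sphere d) {t : ℕ} (h : Hist d t) :
    lowCorr b θ h = 1 :=
  if_pos fun i => (abs_inner_le_one θ (h i).1).trans (hb i)

lemma measurable_lowCorr (b : ℕ → ℝ) (θ : Sphere d) (t : ℕ) :
    Measurable fun h : Hist d t => lowCorr b θ h := by
  unfold lowCorr
  refine Measurable.ite ?_ measurable_const measurable_const
  rw [show {h : Hist d t | ∀ i : Fin t, |inner ℝ θ.1 (h i).1.1| ≤ b i} =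
    ⋂ i : Fin t, {h : Hist d t | |inner ℝ θ.1 (h i).1.1| ≤ b i} by ext; simp]
  refine MeasurableSet.iInter fun i => measurableSet_le ?_ measurable_const
  exact (measurable_const.inner (by fun_prop)).abs

/-- The truncated second moment of the likelihood ratio. -/
lemma Learner.lintegral_lowCorr_sq_le (L : Learner d T) {F : ℝ → ℝ} (hF : Measurable F)
    (θ : Sphere d) {b g : ℕ → ℝ} (hg : ∀ t x, |x| ≤ b t → |F x| ≤ g t) (t : ℕ) :
    ∫⁻ p, lowCorr b θ (L.noiseHistory θ p.1 p.2 t) *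
        ENNReal.ofReal (Real.exp (2 * logLik F θ (L.noiseHistory θ p.1 p.2 t))) ∂L.prob ≤
      ENNReal.ofReal (Real.exp (∑ i ∈ Finset.range t, g i ^ 2)) := by
  induction t with
  | zero => simp [logLik, Learner.history, lowCorr]
  | succ t ih =>
    rw [L.lintegral_history_succ (f := fun _ => 0) measurable_const θ t
      (Φ := fun q => lowCorr b θ q.2 * ENNReal.ofReal (Real.exp (2 * logLik F θ q.2)))
      (((measurable_lowCorr b θ _).comp measurable_snd).mul
        (((measurable_logLik hF θ _).comp measurable_snd).const_mul 2).exp.ennreal_ofReal)]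
    rw [Finset.sum_range_succ, Real.exp_add, ENNReal.ofReal_mul (Real.exp_nonneg _)]
    refine le_trans ?_ (mul_le_mul_left ih _)
    rw [← lintegral_mul_const _ ?_]
    · refine lintegral_mono fun p => ?_
      simp only [zero_add, lowCorr_snoc, logLik_snoc, Learner.noiseHistory]
      set h := L.history (fun _ => 0) θ p.1 p.2 t
      obtain ⟨x, hx'⟩ : ∃ x : ℝ, x = inner ℝ θ.1 (L.action t p.1 h).1 := ⟨_, rfl⟩
      simp only [← hx']
      by_cases hx : |x| ≤ b t
      · have hsq : F x ^ 2 ≤ g t ^ 2 := sq_le_sq' (abs_le.1 (hg t x hx)).1 (abs_le.1 (hg t x hx)).2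
        -- Completing the square: doubling the exponent gives a normalized tilt by `2 F x` times
        -- `exp(F x ^ 2)`, and the latter factor is all that a round contributes.
        have : ∀ y : ℝ, Real.exp (2 * (logLik F θ h + (F x * y - F x ^ 2 / 2))) =
            Real.exp (2 * logLik F θ h) * Real.exp (F x ^ 2) *
              Real.exp (2 * F x * y - (2 * F x) ^ 2 / 2) := fun y => by
          rw [← Real.exp_add, ← Real.exp_add]; congr 1; ring
        simp only [hx, if_true, mul_one, this]
        rw [lintegral_const_mul _ (by fun_prop), mul_assoc]
        gcongr
        simp only [ENNReal.ofReal_mul (mul_nonneg (Real.exp_nonneg (2 * logLik F θ h))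
          (Real.exp_nonneg (F x ^ 2)))]
        rw [lintegral_const_mul _ (by fun_prop), lintegral_exp_gaussianReal, mul_one,
          ENNReal.ofReal_mul (Real.exp_nonneg _)]
        gcongr
      · simp [hx]
    · have h0 := L.measurable_history (f := fun _ => 0) measurable_const θ t
      exact ((measurable_lowCorr b θ _).comp h0).mul
        (((measurable_logLik hF θ _).comp h0).const_mul 2).exp.ennreal_ofReal

/-- A history in which some action is too informative has a first such action. -/
lemma Learner.one_le_lowCorr_add_sum (L : Learner d T) (F : ℝ → ℝ) (b : ℕ → ℝ) (θ : Sphere d)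
    (s : L.Seed) (z : ℕ → ℝ) {ψ : ℕ → ℝ → ℝ≥0∞} (hψ : ∀ t x, b t < |x| → 1 ≤ ψ t x) (n : ℕ) :
    1 ≤ lowCorr b θ (L.history F θ s z n) + ∑ t ∈ Finset.range n,
      lowCorr b θ (L.history F θ s z t) *
        ψ t (inner ℝ θ.1 (L.action t s (L.history F θ s z t)).1) := by
  induction n with
  | zero => simp [lowCorr]
  | succ n ih =>
    refine ih.trans ?_
    rw [Finset.sum_range_succ, add_comm (Finset.sum _ _), ← add_assoc]
    gcongr
    simp only [Learner.history, lowCorr_snoc]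
    split_ifs with h
    · simp
    · rw [mul_zero, zero_add]
      exact le_mul_of_one_le_right' (hψ n _ (not_le.1 h))

end

/-! ### Lower bound: the prior on sign vectors and the tail of the next correlation. -/

section

variable {d T : ℕ}

/-! ### The uniform prior on the sign vectors -/

/-- The sign of a Boolean. -/
noncomputable def boolSign (b : Bool) : ℝ := if b then 1 else -1

/-- The normalized sign vectors. -/
noncomputable def signVec (hd : 0 < d) (σ : Fin d → Bool) : Sphere d :=
  ⟨(Real.sqrt d)⁻¹ • WithLp.toLp 2 fun i => boolSign (σ i), by
    have h : ∀ b, boolSign b ^ 2 = 1 := fun b => by cases b <;> simp [boolSign]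
    have hd' : (0 : ℝ) < d := by exact_mod_cast hd
    rw [mem_sphere_zero_iff_norm, norm_smul, EuclideanSpace.norm_eq]
    simp only [Real.norm_eq_abs, sq_abs, h]
    simp only [Finset.sum_const, Finset.card_univ, Fintype.card_fin, nsmul_eq_mul, mul_one,
      abs_inv, abs_of_nonneg (Real.sqrt_nonneg _)]
    exact inv_mul_cancel₀ (Real.sqrt_pos.2 hd').ne'⟩

lemma sqrt_mul_inner_signVec (hd : 0 < d) (σ : Fin d → Bool) (a : EuclideanSpace ℝ (Fin d)) :
    Real.sqrt d * inner ℝ (signVec hd σ).1 a = ∑ i, boolSign (σ i) * a i := by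
  have hd' : (0 : ℝ) < d := by exact_mod_cast hd
  simp only [signVec, real_inner_smul_left]
  rw [← mul_assoc, mul_inv_cancel₀ (Real.sqrt_pos.2 hd').ne', one_mul, PiLp.inner_apply]
  simp [mul_comm]

/-- The signs are independent, so the exponential moment factors into `cosh (l * a i) ≤ exp ((l * a
i) ^ 2 / 2)`, and `‖a‖ ≤ 1`. -/
lemma sum_exp_signVec_le (hd : 0 < d) (a : Ball d) (l : ℝ) :
    ∑ σ : Fin d → Bool, Real.exp (l * (Real.sqrt d * inner ℝ (signVec hd σ).1 a.1)) ≤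
      2 ^ d * Real.exp (l ^ 2 / 2) := by
  have h1 : ∑ σ : Fin d → Bool, Real.exp (l * (Real.sqrt d * inner ℝ (signVec hd σ).1 a.1)) =
      ∏ i : Fin d, (2 * Real.cosh (l * a.1 i)) := by
    have h2 : ∀ i : Fin d, 2 * Real.cosh (l * a.1 i) =
        ∑ b : Bool, Real.exp (l * (boolSign b * a.1 i)) := fun i => by
      simp [boolSign, Real.cosh_eq]
      ring
    simp_rw [h2]
    rw [Finset.prod_univ_sum, Fintype.piFinset_univ]
    refine Finset.sum_congr rfl fun σ _ => ?_
    rw [← Real.exp_sum, sqrt_mul_inner_signVec, Finset.mul_sum]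
  rw [h1, Finset.prod_mul_distrib]
  simp only [Finset.prod_const, Finset.card_univ, Fintype.card_fin]
  refine mul_le_mul_of_nonneg_left ?_ (by positivity)
  calc ∏ i : Fin d, Real.cosh (l * a.1 i)
      ≤ ∏ i : Fin d, Real.exp ((l * a.1 i) ^ 2 / 2) :=
        Finset.prod_le_prod (fun i _ => (Real.cosh_pos _).le) fun i _ =>
          Real.cosh_le_exp_half_sq _
    _ = Real.exp (l ^ 2 / 2 * ‖a.1‖ ^ 2) := by
        rw [← Real.exp_sum, EuclideanSpace.norm_sq_eq, Finset.mul_sum]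
        congr 1
        refine Finset.sum_congr rfl fun i _ => ?_
        rw [Real.norm_eq_abs, sq_abs]
        ring
    _ ≤ Real.exp (l ^ 2 / 2) := by
        refine Real.exp_le_exp.2 (mul_le_of_le_one_right (by positivity) ?_)
        exact pow_le_one₀ (norm_nonneg _) (mem_closedBall_zero_iff.1 a.2)

open Classical in
/-- `|y|` where it exceeds `e`. -/
noncomputable def excess (e y : ℝ) : ℝ := if e < |y| then |y| else 0

lemma excess_nonneg (e y : ℝ) : 0 ≤ excess e y := by
  unfold excess; split_ifs <;> positivity

lemma abs_le_add_excess {e : ℝ} (he : 0 ≤ e) (y : ℝ) : |y| ≤ e + excess e y := by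
  unfold excess; split_ifs <;> linarith

lemma measurable_excess (e : ℝ) : Measurable (excess e) :=
  Measurable.ite (measurableSet_lt measurable_const measurable_norm) measurable_norm
    measurable_const

/-- Chernoff bound with exponent `e`: where `|y| > e`, one has `y² ≤ 2 exp |y|`, and trading `exp
|y|` for `exp (e |y|)` gains the factor `exp (-(e - 1) e)`. -/
lemma excess_sq_le {e : ℝ} (he : 1 ≤ e) (y : ℝ) :
    excess e y ^ 2 ≤ 2 * Real.exp (-((e - 1) * e)) * (Real.exp (e * y) + Real.exp (-e * y)) := by
  unfold excess
  split_ifs with h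
  · have h1 : |y| ^ 2 ≤ 2 * Real.exp |y| := by
      have := Real.quadratic_le_exp_of_nonneg (abs_nonneg y)
      nlinarith [abs_nonneg y]
    have h2 : Real.exp |y| ≤ Real.exp (-((e - 1) * e)) * Real.exp (e * |y|) := by
      rw [← Real.exp_add]
      refine Real.exp_le_exp.2 ?_
      nlinarith
    have h3 : Real.exp (e * |y|) ≤ Real.exp (e * y) + Real.exp (-e * y) := by
      rcases abs_choice y with hy | hy <;> rw [hy]
      · linarith [Real.exp_pos (-e * y)]
      · rw [mul_neg, ← neg_mul]; linarith [Real.exp_pos (e * y)]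
    calc |y| ^ 2 ≤ 2 * Real.exp |y| := h1
      _ ≤ 2 * (Real.exp (-((e - 1) * e)) * Real.exp (e * |y|)) := by gcongr
      _ ≤ 2 * (Real.exp (-((e - 1) * e)) * (Real.exp (e * y) + Real.exp (-e * y))) := by gcongr
      _ = _ := by ring
  · have : 0 ≤ Real.exp (-((e - 1) * e)) * (Real.exp (e * y) + Real.exp (-e * y)) := by positivity
    nlinarith

lemma sum_excess_sq_le (hd : 0 < d) (a : Ball d) {e : ℝ} (he : 1 ≤ e) :
    ∑ σ : Fin d → Bool, excess e (Real.sqrt d * inner ℝ (signVec hd σ).1 a.1) ^ 2 ≤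
      2 ^ d * (11 * Real.exp (-(e ^ 2 / 4))) := by
  calc ∑ σ : Fin d → Bool, excess e (Real.sqrt d * inner ℝ (signVec hd σ).1 a.1) ^ 2
      ≤ ∑ σ : Fin d → Bool, 2 * Real.exp (-((e - 1) * e)) *
          (Real.exp (e * (Real.sqrt d * inner ℝ (signVec hd σ).1 a.1)) +
            Real.exp (-e * (Real.sqrt d * inner ℝ (signVec hd σ).1 a.1))) :=
        Finset.sum_le_sum fun σ _ => excess_sq_le he _
    _ ≤ 2 * Real.exp (-((e - 1) * e)) *
          (2 ^ d * Real.exp (e ^ 2 / 2) + 2 ^ d * Real.exp ((-e) ^ 2 / 2)) := by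
        rw [← Finset.mul_sum, Finset.sum_add_distrib]
        gcongr <;> exact sum_exp_signVec_le hd a _
    _ = 2 ^ d * (4 * Real.exp (-((e - 1) * e) + e ^ 2 / 2)) := by
        rw [Real.exp_add, neg_sq]; ring
    _ ≤ 2 ^ d * (4 * (Real.exp 1 * Real.exp (-(e ^ 2 / 4)))) := by
        rw [← Real.exp_add]
        gcongr 2 ^ d * (4 * Real.exp ?_)
        -- The exponent is `e - e²/2`, and `e ≤ 1 + e²/4`; this costs the factor `exp 1`, whence the
        -- constant `11 ≥ 4 exp 1`.
        nlinarith [sq_nonneg (e - 2)]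
    _ ≤ 2 ^ d * (11 * Real.exp (-(e ^ 2 / 4))) := by
        have := Real.exp_one_lt_d9
        have h2 := Real.exp_pos (-(e ^ 2 / 4))
        gcongr ?_ * ?_
        nlinarith

/-! ### Averages over the prior -/

/-- As long as the earlier actions have low correlation with the parameter, the next decision
rarely has a high one. -/
lemma Learner.sum_lintegral_excess_le (L : Learner d T) (hd : 0 < d) {F : ℝ → ℝ}
    (hF : Measurable F) {b g : ℕ → ℝ} (hg : ∀ t x, |x| ≤ b t → |F x| ≤ g t) (t : ℕ)
    {a : L.Seed × Hist d t → Ball d} (ha : Measurable a) {e : ℝ} (he : 1 ≤ e) :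
    ∑ σ : Fin d → Bool, ∫⁻ p, lowCorr b (signVec hd σ) (L.history F (signVec hd σ) p.1 p.2 t) *
        ENNReal.ofReal (excess e (Real.sqrt d * inner ℝ (signVec hd σ).1
          (a (p.1, L.history F (signVec hd σ) p.1 p.2 t)).1)) ∂L.prob ≤
      2 ^ d * ENNReal.ofReal
        (6 * Real.exp ((∑ i ∈ Finset.range t, g i ^ 2) / 2 - e ^ 2 / 8)) := by
  set S := ∑ i ∈ Finset.range t, g i ^ 2
  let θ₀ : Sphere d := signVec hd fun _ => true
  let h₀ : L.Seed × (ℕ → ℝ) → Hist d t := fun p => L.noiseHistory θ₀ p.1 p.2 t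
  have hh₀ : Measurable h₀ := L.measurable_history measurable_const θ₀ t
  let x : (Fin d → Bool) → L.Seed × (ℕ → ℝ) → ℝ := fun σ p =>
    excess e (Real.sqrt d * inner ℝ (signVec hd σ).1 (a (p.1, h₀ p)).1)
  have hxm : ∀ σ, Measurable (x σ) := fun σ => (measurable_excess e).comp
    ((measurable_const.inner (ha.comp (measurable_fst.prodMk hh₀)).subtype_val).const_mul _)
  -- The weight in `x w ≤ (l/2) w² + x²/(2l)` that balances the second moment `exp S` of the
  -- likelihood ratio against the tail `exp (-e²/4)`: both terms become multiples of `exp (S/2 -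
  -- e²/8)`, with total constant `(1 + 11)/2 = 6`.
  set l := Real.exp (-(S / 2) - e ^ 2 / 8) with hl
  have hl0 : 0 < l := Real.exp_pos _
  let A : (Fin d → Bool) → L.Seed × (ℕ → ℝ) → ℝ≥0∞ := fun σ p =>
    lowCorr b (signVec hd σ) (h₀ p) *
      ENNReal.ofReal (Real.exp (2 * logLik F (signVec hd σ) (h₀ p)))
  have hAm : ∀ σ, Measurable (A σ) := fun σ => ((measurable_lowCorr b _ _).comp hh₀).mul
    (((measurable_logLik hF _ _).comp hh₀).const_mul 2).exp.ennreal_ofReal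
  have key : ∀ σ, ∫⁻ p, lowCorr b (signVec hd σ) (L.history F (signVec hd σ) p.1 p.2 t) *
        ENNReal.ofReal (excess e (Real.sqrt d * inner ℝ (signVec hd σ).1
          (a (p.1, L.history F (signVec hd σ) p.1 p.2 t)).1)) ∂L.prob ≤
      ENNReal.ofReal (l / 2) * ∫⁻ p, A σ p ∂L.prob +
        ENNReal.ofReal ((2 * l)⁻¹) * ∫⁻ p, ENNReal.ofReal (x σ p ^ 2) ∂L.prob := by
    intro σ
    rw [L.lintegral_history_eq hF (signVec hd σ) t (Φ := fun q => lowCorr b (signVec hd σ) q.2 *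
        ENNReal.ofReal (excess e (Real.sqrt d * inner ℝ (signVec hd σ).1 (a q).1)))
      (((measurable_lowCorr b _ _).comp measurable_snd).mul ((measurable_excess e).comp
        ((measurable_const.inner ha.subtype_val).const_mul _)).ennreal_ofReal),
      ← lintegral_const_mul _ (hAm σ), ← lintegral_const_mul _ ((hxm σ).pow_const 2).ennreal_ofReal,
      ← lintegral_add_left ((hAm σ).const_mul _)]
    refine lintegral_mono fun p => ?_
    simp only [L.noiseHistory_eq (signVec hd σ) θ₀]
    change lowCorr b (signVec hd σ) (h₀ p) * ENNReal.ofReal (x σ p) *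
      ENNReal.ofReal (Real.exp (logLik F (signVec hd σ) (h₀ p))) ≤ _
    have h1 : lowCorr b (signVec hd σ) (h₀ p) * ENNReal.ofReal (x σ p) *
        ENNReal.ofReal (Real.exp (logLik F (signVec hd σ) (h₀ p))) ≤
        lowCorr b (signVec hd σ) (h₀ p) * (ENNReal.ofReal (l / 2) *
          ENNReal.ofReal (Real.exp (2 * logLik F (signVec hd σ) (h₀ p))) +
          ENNReal.ofReal ((2 * l)⁻¹) * ENNReal.ofReal (x σ p ^ 2)) := by
      rw [mul_assoc]
      gcongr
      rw [← ENNReal.ofReal_mul (excess_nonneg _ _), ← ENNReal.ofReal_mul (by positivity),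
        ← ENNReal.ofReal_mul (by positivity), ← ENNReal.ofReal_add (by positivity) (by positivity)]
      refine ENNReal.ofReal_le_ofReal ?_
      set w := logLik F (signVec hd σ) (h₀ p)
      have h3 : Real.exp (2 * w) = Real.exp w ^ 2 := by rw [← Real.exp_nat_mul]; norm_num
      rw [h3, ← sub_nonneg]
      have h4 : l / 2 * Real.exp w ^ 2 + (2 * l)⁻¹ * x σ p ^ 2 - x σ p * Real.exp w =
          (2 * l)⁻¹ * (l * Real.exp w - x σ p) ^ 2 := by
        field_simp
        ring
      rw [h4]
      positivity
    refine h1.trans ?_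
    rw [mul_add]
    exact add_le_add (le_of_eq (mul_left_comm _ _ _))
      (mul_le_of_le_one_left' (lowCorr_le_one _ _ _))
  refine (Finset.sum_le_sum fun σ _ => key σ).trans ?_
  rw [Finset.sum_add_distrib, ← Finset.mul_sum, ← Finset.mul_sum]
  -- Under pure noise the decision is the same for every `σ`, so the sum over the prior can be taken
  -- first, for a fixed decision.
  have hB : ∑ σ : Fin d → Bool, ∫⁻ p, ENNReal.ofReal (x σ p ^ 2) ∂L.prob ≤
      2 ^ d * ENNReal.ofReal (11 * Real.exp (-(e ^ 2 / 4))) := by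
    rw [← lintegral_finsetSum _ fun σ _ => ((hxm σ).pow_const 2).ennreal_ofReal]
    calc ∫⁻ p, ∑ σ : Fin d → Bool, ENNReal.ofReal (x σ p ^ 2) ∂L.prob
        ≤ ∫⁻ _, 2 ^ d * ENNReal.ofReal (11 * Real.exp (-(e ^ 2 / 4))) ∂L.prob := by
          refine lintegral_mono fun p => ?_
          rw [← ENNReal.ofReal_sum_of_nonneg fun _ _ => sq_nonneg _]
          refine (ENNReal.ofReal_le_ofReal (sum_excess_sq_le hd _ he)).trans_eq ?_
          rw [ENNReal.ofReal_mul (by positivity), ENNReal.ofReal_pow (by norm_num),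
            ENNReal.ofReal_ofNat]
      _ = _ := by rw [lintegral_const, measure_univ, mul_one]
  have hA : ∑ σ : Fin d → Bool, ∫⁻ p, A σ p ∂L.prob ≤ 2 ^ d * ENNReal.ofReal (Real.exp S) := by
    calc ∑ σ : Fin d → Bool, ∫⁻ p, A σ p ∂L.prob
        ≤ ∑ σ : Fin d → Bool, ENNReal.ofReal (Real.exp S) := by
          refine Finset.sum_le_sum fun σ _ => ?_
          refine le_trans (le_of_eq ?_) (L.lintegral_lowCorr_sq_le hF (signVec hd σ) hg t)
          refine lintegral_congr fun p => ?_
          rw [L.noiseHistory_eq (signVec hd σ) θ₀]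
      _ = _ := by simp
  refine (add_le_add (mul_le_mul_right hA _) (mul_le_mul_right hB _)).trans (le_of_eq ?_)
  rw [mul_left_comm, mul_left_comm (ENNReal.ofReal (2 * l)⁻¹), ← mul_add,
    ← ENNReal.ofReal_mul (by positivity), ← ENNReal.ofReal_mul (by positivity),
    ← ENNReal.ofReal_add (by positivity) (by positivity)]
  congr 2
  have h1 : l * Real.exp S = Real.exp (S / 2 - e ^ 2 / 8) := by
    rw [hl, ← Real.exp_add]; congr 1; ring
  have h2 : l⁻¹ * Real.exp (-(e ^ 2 / 4)) = Real.exp (S / 2 - e ^ 2 / 8) := by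
    rw [hl, ← Real.exp_neg, ← Real.exp_add]; congr 1; ring
  rw [mul_inv]
  linear_combination (1 / 2) * h1 + (11 / 2) * h2

end

/-! ### Lower bound: the recursion for the reachable correlations and the integral. -/

section

variable {d T : ℕ}

/-- The squares of the correlations, scaled by the dimension, that can be reached in each round. -/
noncomputable def corrLevelSq (F : ℝ → ℝ) (d : ℕ) (A : ℝ) : ℕ → ℝ
  | 0 => 256 * A
  | t + 1 => corrLevelSq F d A t + 8 * F (Real.sqrt (corrLevelSq F d A t / d)) ^ 2

/-- The summed form shows the level as `256 A + 8 S_t`, which makes the exponent `S_t/2 - e_t²/8` at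
most `-32 A`. -/
lemma corrLevelSq_eq (F : ℝ → ℝ) (d : ℕ) (A : ℝ) (t : ℕ) :
    corrLevelSq F d A t =
      256 * A + 8 * ∑ i ∈ Finset.range t, F (Real.sqrt (corrLevelSq F d A i / d)) ^ 2 := by
  induction t with
  | zero => simp [corrLevelSq]
  | succ t ih => rw [Finset.sum_range_succ, mul_add, ← add_assoc, ← ih, corrLevelSq]

lemma le_corrLevelSq (F : ℝ → ℝ) (d : ℕ) (A : ℝ) (t : ℕ) : 256 * A ≤ corrLevelSq F d A t := by
  rw [corrLevelSq_eq]
  have : 0 ≤ ∑ i ∈ Finset.range t, F (Real.sqrt (corrLevelSq F d A i / d)) ^ 2 :=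
    Finset.sum_nonneg fun i _ => sq_nonneg _
  linarith

/-- The inclusion of the sphere in the ball. -/
def sphereToBall (x : Sphere d) : Ball d := ⟨x.1, Metric.sphere_subset_closedBall x.2⟩

lemma measurable_sphereToBall : Measurable (sphereToBall (d := d)) :=
  measurable_subtype_coe.subtype_mk

/-- The mean absolute correlation of an estimator with the parameter under the prior. -/
lemma Learner.sum_lintegral_abs_inner_le (L : Learner d T) (hd : 0 < d) {F : ℝ → ℝ}
    (hF : Measurable F) (hF1 : ∀ x, |F x| ≤ 1) {b g e : ℕ → ℝ}
    (hg : ∀ t x, |x| ≤ b t → |F x| ≤ g t) (hb : ∀ t, b t = e t / Real.sqrt d) (he : ∀ t, 1 ≤ e t)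
    {e₁ e₂ : ℝ} (he₁ : 1 ≤ e₁) (he₂ : 1 ≤ e₂) :
    ∑ σ : Fin d → Bool, ∫⁻ p, ENNReal.ofReal |Real.sqrt d * inner ℝ (signVec hd σ).1
        (L.estimator p.1 (L.history F (signVec hd σ) p.1 p.2 T)).1| ∂L.prob ≤
      2 ^ d * ENNReal.ofReal (e₁ +
        6 * Real.exp ((∑ i ∈ Finset.range T, g i ^ 2) / 2 - e₁ ^ 2 / 8) +
        (∑ t ∈ Finset.range T,
          e₂ * (6 * Real.exp ((∑ i ∈ Finset.range t, g i ^ 2) / 2 - e t ^ 2 / 8))) +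
        6 * Real.exp ((T : ℝ) / 2 - e₂ ^ 2 / 8)) := by
  have hd' : (0 : ℝ) < Real.sqrt d := Real.sqrt_pos.2 (by exact_mod_cast hd)
  let θ : (Fin d → Bool) → Sphere d := signVec hd
  let H : (σ : Fin d → Bool) → (t : ℕ) → L.Seed × (ℕ → ℝ) → Hist d t :=
    fun σ t p => L.history F (θ σ) p.1 p.2 t
  have hH : ∀ σ t, Measurable (H σ t) := fun σ t => L.measurable_history hF (θ σ) t
  let x : (Fin d → Bool) → L.Seed × (ℕ → ℝ) → ℝ := fun σ p =>
    Real.sqrt d * inner ℝ (θ σ).1 (L.estimator p.1 (H σ T p)).1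
  let y : (Fin d → Bool) → ℕ → L.Seed × (ℕ → ℝ) → ℝ := fun σ t p =>
    Real.sqrt d * inner ℝ (θ σ).1 (L.action t p.1 (H σ t p)).1
  have hx : ∀ σ, Measurable (x σ) := fun σ => (measurable_const.inner
    (L.measurable_estimator.comp (measurable_fst.prodMk (hH σ T))).subtype_val).const_mul _
  have hy : ∀ σ t, Measurable (y σ t) := fun σ t => (measurable_const.inner
    ((L.measurable_action t).comp (measurable_fst.prodMk (hH σ t))).subtype_val).const_mul _
  let f₁ : (Fin d → Bool) → L.Seed × (ℕ → ℝ) → ℝ≥0∞ := fun σ p =>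
    lowCorr b (θ σ) (H σ T p) * ENNReal.ofReal (excess e₁ (x σ p))
  let f₂ : (Fin d → Bool) → ℕ → L.Seed × (ℕ → ℝ) → ℝ≥0∞ := fun σ t p =>
    lowCorr b (θ σ) (H σ t p) * ENNReal.ofReal (excess (e t) (y σ t p))
  let f₃ : (Fin d → Bool) → L.Seed × (ℕ → ℝ) → ℝ≥0∞ := fun σ p =>
    lowCorr (fun _ => 1) (θ σ) (H σ T p) * ENNReal.ofReal (excess e₂ (x σ p))
  have hf₁ : ∀ σ, Measurable (f₁ σ) := fun σ => ((measurable_lowCorr _ _ _).comp (hH σ T)).mul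
    ((measurable_excess _).comp (hx σ)).ennreal_ofReal
  have hf₂ : ∀ σ t, Measurable (f₂ σ t) := fun σ t =>
    ((measurable_lowCorr _ _ _).comp (hH σ t)).mul
      ((measurable_excess _).comp (hy σ t)).ennreal_ofReal
  have hf₃ : ∀ σ, Measurable (f₃ σ) := fun σ =>
    ((measurable_lowCorr (fun _ => 1) (θ σ) T).comp (hH σ T)).mul
    ((measurable_excess _).comp (hx σ)).ennreal_ofReal
  -- If all actions had low correlation, the threshold `e₁` applies. Otherwise the larger threshold
  -- `e₂` is used, and the constant part `e₂` is charged to the first action that broke the level.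
  -- Bounding `|x|` by `√d` instead would make the failure terms depend on `d`; with `e₂` of order
  -- `√T` they depend on `T` alone.
  have key : ∀ σ p, ENNReal.ofReal |x σ p| ≤ ENNReal.ofReal e₁ + f₁ σ p +
      (∑ t ∈ Finset.range T, ENNReal.ofReal e₂ * f₂ σ t p) + f₃ σ p := by
    intro σ p
    have h1 : ∀ e, 1 ≤ e → ENNReal.ofReal |x σ p| ≤
        ENNReal.ofReal e + ENNReal.ofReal (excess e (x σ p)) := fun e he => by
      rw [← ENNReal.ofReal_add (by linarith) (excess_nonneg _ _)]
      exact ENNReal.ofReal_le_ofReal (abs_le_add_excess (by linarith) _)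
    have h2 := L.one_le_lowCorr_add_sum F b (θ σ) p.1 p.2
      (ψ := fun t x => ENNReal.ofReal (excess (e t) (Real.sqrt d * x))) (fun t x hx => by
        rw [ENNReal.one_le_ofReal]
        have h3 : e t < |Real.sqrt d * x| := by
          rw [hb, div_lt_iff₀ hd'] at hx
          rw [abs_mul, abs_of_pos hd', mul_comm]
          exact hx
        rw [excess, if_pos h3]
        exact (he t).trans h3.le) T
    by_cases hI : lowCorr b (θ σ) (H σ T p) = 1
    · calc _ ≤ _ := h1 e₁ he₁
        _ = ENNReal.ofReal e₁ + f₁ σ p := by simp only [f₁, hI, one_mul]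
        _ ≤ _ := by rw [add_assoc]; exact le_self_add
    · have hI0 : lowCorr b (θ σ) (H σ T p) = 0 := by
        unfold lowCorr at hI ⊢
        split_ifs at hI ⊢ <;> simp_all
      have h3 : 1 ≤ ∑ t ∈ Finset.range T, f₂ σ t p := by
        have := h2
        change 1 ≤ lowCorr b (θ σ) (H σ T p) + ∑ t ∈ Finset.range T, f₂ σ t p at this
        rwa [hI0, zero_add] at this
      have h4 : f₃ σ p = ENNReal.ofReal (excess e₂ (x σ p)) := by
        simp only [f₃]
        rw [lowCorr_eq_one fun _ => le_rfl, one_mul]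
      calc _ ≤ _ := h1 e₂ he₂
        _ ≤ ENNReal.ofReal e₂ * (∑ t ∈ Finset.range T, f₂ σ t p) + f₃ σ p := by
          rw [h4]
          gcongr
          exact le_mul_of_one_le_right' h3
        _ ≤ _ := by
          rw [Finset.mul_sum, add_assoc]
          exact le_add_self
  have h₁ := L.sum_lintegral_excess_le hd hF hg T (a := fun q => sphereToBall (L.estimator q.1 q.2))
    (measurable_sphereToBall.comp L.measurable_estimator) he₁
  have h₂ : ∀ t, _ := fun t =>
    L.sum_lintegral_excess_le hd hF hg t (a := fun q => L.action t q.1 q.2)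
      (L.measurable_action t) (he t)
  -- Here the truncation is void (`b = 1`), and `|F| ≤ 1` alone bounds the second moment by `exp T`;
  -- this is affordable because `e₂²` will exceed `4 T`.
  have h₃ := L.sum_lintegral_excess_le hd hF (b := fun _ => 1) (g := fun _ => 1)
    (fun _ x _ => hF1 x) T 
    (a := fun q => sphereToBall (L.estimator q.1 q.2))
    (measurable_sphereToBall.comp L.measurable_estimator) he₂
  simp only [one_pow, Finset.sum_const, Finset.card_range, nsmul_eq_mul, mul_one] at h₃
  calc ∑ σ : Fin d → Bool, ∫⁻ p, ENNReal.ofReal |x σ p| ∂L.prob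
      ≤ ∑ σ : Fin d → Bool, ∫⁻ p, (ENNReal.ofReal e₁ + f₁ σ p +
          (∑ t ∈ Finset.range T, ENNReal.ofReal e₂ * f₂ σ t p) + f₃ σ p) ∂L.prob :=
        Finset.sum_le_sum fun σ _ => lintegral_mono (key σ)
    _ = ∑ σ : Fin d → Bool, (ENNReal.ofReal e₁ + ∫⁻ p, f₁ σ p ∂L.prob +
          (∑ t ∈ Finset.range T, ENNReal.ofReal e₂ * ∫⁻ p, f₂ σ t p ∂L.prob) +
          ∫⁻ p, f₃ σ p ∂L.prob) := by
        refine Finset.sum_congr rfl fun σ _ => ?_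
        have hs : Measurable fun p => ∑ t ∈ Finset.range T, ENNReal.ofReal e₂ * f₂ σ t p :=
          Finset.measurable_fun_sum _ fun t _ => (hf₂ σ t).const_mul _
        rw [lintegral_add_right _ (hf₃ σ), lintegral_add_right _ hs,
          lintegral_add_right _ (hf₁ σ), lintegral_const, measure_univ, mul_one,
          lintegral_finsetSum _ fun t _ => (hf₂ σ t).const_mul _]
        simp_rw [lintegral_const_mul _ (hf₂ σ _)]
    _ = 2 ^ d * ENNReal.ofReal e₁ + ∑ σ : Fin d → Bool, ∫⁻ p, f₁ σ p ∂L.prob +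
          (∑ t ∈ Finset.range T,
            ENNReal.ofReal e₂ * ∑ σ : Fin d → Bool, ∫⁻ p, f₂ σ t p ∂L.prob) +
          ∑ σ : Fin d → Bool, ∫⁻ p, f₃ σ p ∂L.prob := by
        simp only [Finset.sum_add_distrib]
        rw [Finset.sum_comm]
        simp only [Finset.mul_sum, Finset.sum_const, Finset.card_univ, Fintype.card_pi,
          Fintype.card_bool, Finset.prod_const, Fintype.card_fin, nsmul_eq_mul, Nat.cast_pow,
          Nat.cast_ofNat]
    _ ≤ 2 ^ d * ENNReal.ofReal e₁ +
          2 ^ d * ENNReal.ofReal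
            (6 * Real.exp ((∑ i ∈ Finset.range T, g i ^ 2) / 2 - e₁ ^ 2 / 8)) +
          (∑ t ∈ Finset.range T, ENNReal.ofReal e₂ * (2 ^ d * ENNReal.ofReal
            (6 * Real.exp ((∑ i ∈ Finset.range t, g i ^ 2) / 2 - e t ^ 2 / 8)))) +
          2 ^ d * ENNReal.ofReal (6 * Real.exp ((T : ℝ) / 2 - e₂ ^ 2 / 8)) := by
        refine add_le_add (add_le_add (add_le_add le_rfl h₁) ?_) h₃
        exact Finset.sum_le_sum fun t _ => mul_le_mul_right (h₂ t) _
    _ = _ := by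
        have hpos : 0 ≤ e₂ := by linarith
        simp only [mul_left_comm _ ((2 : ℝ≥0∞) ^ d), ← ENNReal.ofReal_mul hpos]
        rw [← Finset.mul_sum, ← ENNReal.ofReal_sum_of_nonneg fun t _ => by positivity,
          ← mul_add, ← mul_add, ← mul_add,
          ← ENNReal.ofReal_add (by positivity) (by positivity),
          ← ENNReal.ofReal_add (by positivity) (Finset.sum_nonneg fun t _ => by positivity),
          ← ENNReal.ofReal_add (add_nonneg (by positivity)
            (Finset.sum_nonneg fun t _ => by positivity)) (by positivity)]

lemma exp_neg_mul_log_le {n : ℝ} (hn : 2 ≤ n) (k : ℕ) :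
    Real.exp (-(k * Real.log n)) = (1 / n) ^ k := by
  rw [Real.exp_neg, Real.exp_nat_mul, Real.exp_log (by linarith), one_div, inv_pow]

/-- The errors in the bound on the mean correlation add up to at most one. -/
lemma corr_bound_numeric {n : ℕ} {m : ℕ} (hn : 2 ≤ n) (hm : m ≤ n) {S : ℕ → ℝ}
    (hS : ∀ t, 0 ≤ S t) :
    Real.sqrt (64 * Real.log n + 4 * S m) +
        6 * Real.exp (S m / 2 - Real.sqrt (64 * Real.log n + 4 * S m) ^ 2 / 8) +
        (∑ t ∈ Finset.range m, Real.sqrt (4 * n + 32) *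
          (6 * Real.exp (S t / 2 - Real.sqrt (256 * Real.log n + 8 * S t) ^ 2 / 8))) +
        6 * Real.exp ((m : ℝ) / 2 - Real.sqrt (4 * n + 32) ^ 2 / 8) ≤
      Real.sqrt (256 * Real.log n + 8 * S m) := by
  have hn' : (2 : ℝ) ≤ n := by exact_mod_cast hn
  have hm' : (m : ℝ) ≤ n := by exact_mod_cast hm
  have hA : 1 / 2 ≤ Real.log n := by
    have h1 := Real.log_two_gt_d9
    have h2 := Real.log_le_log (by norm_num) hn'
    linarith
  set A := Real.log n with hAdef
  have hsq : ∀ x : ℝ, 0 ≤ x → Real.sqrt x ^ 2 = x := fun x hx => Real.sq_sqrt hx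
  rw [hsq _ (by have := hS m; positivity), hsq _ (by positivity)]
  have hi : (0 : ℝ) ≤ 1 / n := by positivity
  have hi2 : (1 : ℝ) / n ≤ 1 / 2 := one_div_le_one_div_of_le (by norm_num) hn'
  -- The thresholds are chosen so that `S` cancels: the exponents are `-8 A` here, at most `-32 A`
  -- for each of the `m ≤ n` actions in `e2`, and at most `-4` in `e3`. With `exp (-A) = 1/n ≤ 1/2`
  -- the three errors add up to less than one.
  have e1 : 6 * Real.exp (S m / 2 - (64 * A + 4 * S m) / 8) ≤ 6 / 256 := by
    have : S m / 2 - (64 * A + 4 * S m) / 8 = -((8 : ℕ) * A) := by push_cast; ring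
    rw [this, exp_neg_mul_log_le hn']
    have := pow_le_pow_left₀ hi hi2 8
    norm_num at this ⊢
    linarith
  have e2 : (∑ t ∈ Finset.range m, Real.sqrt (4 * n + 32) *
      (6 * Real.exp (S t / 2 - Real.sqrt (256 * A + 8 * S t) ^ 2 / 8))) ≤ 36 / 2 ^ 30 := by
    have h1 : Real.sqrt (4 * n + 32) ≤ 6 * n := Real.sqrt_le_iff.2 ⟨by linarith, by nlinarith⟩
    have h2 : ∀ t ∈ Finset.range m, Real.sqrt (4 * n + 32) *
        (6 * Real.exp (S t / 2 - Real.sqrt (256 * A + 8 * S t) ^ 2 / 8)) ≤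
        (6 * n) * (6 * (1 / n) ^ 32) := fun t _ => by
      rw [hsq _ (by have := hS t; positivity), ← exp_neg_mul_log_le hn' 32]
      refine mul_le_mul h1 ?_ (by positivity) (by positivity)
      gcongr
      have := hS t
      push_cast
      linarith
    refine (Finset.sum_le_sum h2).trans ?_
    rw [Finset.sum_const, Finset.card_range, nsmul_eq_mul]
    calc (m : ℝ) * ((6 * n) * (6 * (1 / (n : ℝ)) ^ 32))
        ≤ n * ((6 * n) * (6 * (1 / (n : ℝ)) ^ 32)) := by
          gcongr
      _ = 36 * (1 / (n : ℝ)) ^ 30 := by field_simp; norm_num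
      _ ≤ 36 * (1 / 2) ^ 30 := by gcongr
      _ = 36 / 2 ^ 30 := by norm_num
  have e3 : 6 * Real.exp ((m : ℝ) / 2 - (4 * n + 32) / 8) ≤ 1 / 2 := by
    have h1 : Real.exp ((m : ℝ) / 2 - (4 * n + 32) / 8) ≤ Real.exp (-4) :=
      Real.exp_le_exp.2 (by linarith)
    have h2 : Real.exp (-4) ≤ 1 / 16 := by
      rw [Real.exp_neg, inv_eq_one_div]
      refine one_div_le_one_div_of_le (by norm_num) ?_
      have h3 : Real.exp 4 = Real.exp 1 ^ 4 := by rw [← Real.exp_nat_mul]; norm_num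
      have h4 : (2 : ℝ) ≤ Real.exp 1 := by linarith [Real.exp_one_gt_d9]
      have := pow_le_pow_left₀ (by norm_num) h4 4
      rw [h3]
      linarith
    linarith
  -- `(x + 1)² ≤ 2x² + 2`: doubling `64 A + 4 S` leaves `128 A ≥ 2` to spare for the errors.
  have e4 : Real.sqrt (64 * A + 4 * S m) + 1 ≤ Real.sqrt (256 * A + 8 * S m) := by
    refine Real.le_sqrt_of_sq_le ?_
    have h5 := hS m
    have h4 := hsq (64 * A + 4 * S m) (by positivity)
    nlinarith [sq_nonneg (Real.sqrt (64 * A + 4 * S m) - 1)]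
  linarith

lemma correlation_le_abs (f : ℝ → ℝ) (x : ℝ) : correlation f x ≤ |x| := by
  unfold correlation; split_ifs
  exacts [le_rfl, le_abs_self x]

/-- No learner with at most `n` rounds has small risk everywhere. -/
lemma Learner.one_le_iSup_risk_add (L : Learner d T) (hd : 0 < d) {f : ℝ → ℝ}
    (hf : LinkFunction f) (hs : IsEven f ∨ IsOdd f) {n : ℕ} (hn : 2 ≤ n) (hT : T ≤ n) :
    1 ≤ (⨆ θ : Sphere d, L.risk f θ) + ENNReal.ofReal
      (Real.sqrt (corrLevelSq (clipLink f) d (Real.log n) T / d)) := by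
  have hd0 : (0 : ℝ) < d := by exact_mod_cast hd
  have hd' : (0 : ℝ) < Real.sqrt d := Real.sqrt_pos.2 hd0
  have hn' : (2 : ℝ) ≤ n := by exact_mod_cast hn
  set Q := corrLevelSq (clipLink f) d (Real.log n) with hQ
  have hlog : 1 / 2 ≤ Real.log n := by
    have h1 := Real.log_two_gt_d9
    have h2 := Real.log_le_log (by norm_num) hn'
    linarith
  have hbound := L.sum_lintegral_abs_inner_le hd (measurable_clipLink hf) (abs_clipLink_le_one hf)
    (b := fun t => Real.sqrt (Q t / d)) (g := fun t => clipLink f (Real.sqrt (Q t / d)))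
    (e := fun t => Real.sqrt (Q t)) (fun t x hx => abs_clipLink_le hf hs hx)
    (fun t => Real.sqrt_div' _ hd0.le)
    (fun t => Real.one_le_sqrt.2 (by
      have := le_corrLevelSq (clipLink f) d (Real.log n) t
      linarith))
    (e₁ := Real.sqrt (64 * Real.log n +
      4 * ∑ i ∈ Finset.range T, clipLink f (Real.sqrt (Q i / d)) ^ 2))
    (e₂ := Real.sqrt (4 * n + 32))
    (Real.one_le_sqrt.2 (by
      have : 0 ≤ ∑ i ∈ Finset.range T, clipLink f (Real.sqrt (Q i / d)) ^ 2 :=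
        Finset.sum_nonneg fun i _ => sq_nonneg _
      linarith))
    (Real.one_le_sqrt.2 (by linarith))
  have hnum := corr_bound_numeric hn hT
    (S := fun t => ∑ i ∈ Finset.range t, clipLink f (Real.sqrt (Q i / d)) ^ 2)
    (fun t => Finset.sum_nonneg fun i _ => sq_nonneg _)
  simp only [hQ, ← corrLevelSq_eq] at hnum hbound
  have hbound' := hbound.trans (mul_le_mul_right (ENNReal.ofReal_le_ofReal hnum) _)
  simp only [Learner.history_clipLink, ← hQ] at hbound'
  have hmeas : ∀ σ, Measurable fun p : L.Seed × (ℕ → ℝ) => inner ℝ (signVec hd σ).1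
      (L.estimator p.1 (L.history f (signVec hd σ) p.1 p.2 T)).1 := fun σ => by
    have h := L.measurable_history (measurable_clipLink hf) (signVec hd σ) T
    simp only [Learner.history_clipLink] at h
    exact measurable_const.inner
      (L.measurable_estimator.comp (measurable_fst.prodMk h)).subtype_val
  have hsum : (2 : ℝ≥0∞) ^ d ≤ 2 ^ d * (⨆ θ : Sphere d, L.risk f θ) + 2 ^ d *
      ENNReal.ofReal (Real.sqrt (Q T / d)) := by
    -- Pointwise, `1 - correlation f x + |x| ≥ 1`; small mean absolute correlation therefore forces
    -- large risk.
    have h1 : ∀ σ : Fin d → Bool, 1 ≤ L.risk f (signVec hd σ) +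
        ENNReal.ofReal (Real.sqrt d)⁻¹ * ∫⁻ p, ENNReal.ofReal |Real.sqrt d *
          inner ℝ (signVec hd σ).1
            (L.estimator p.1 (L.history f (signVec hd σ) p.1 p.2 T)).1| ∂L.prob := by
      intro σ
      rw [← lintegral_const_mul _ ((hmeas σ).const_mul _).abs.ennreal_ofReal, Learner.risk,
        ← lintegral_add_right _ (((hmeas σ).const_mul _).abs.ennreal_ofReal.const_mul _)]
      calc (1 : ℝ≥0∞) = ∫⁻ _, 1 ∂L.prob := by simp
        _ ≤ _ := by
          refine lintegral_mono fun p => ?_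
          rw [real_inner_comm, ← ENNReal.ofReal_mul (by positivity), abs_mul, abs_of_pos hd',
            inv_mul_cancel_left₀ hd'.ne', ← ENNReal.ofReal_one]
          refine (ENNReal.ofReal_le_ofReal ?_).trans ENNReal.ofReal_add_le
          have := correlation_le_abs f (inner ℝ (signVec hd σ).1
            (L.estimator p.1 (L.history f (signVec hd σ) p.1 p.2 T)).1)
          linarith
    calc (2 : ℝ≥0∞) ^ d = ∑ σ : Fin d → Bool, 1 := by simp
      _ ≤ ∑ σ : Fin d → Bool, ((⨆ θ : Sphere d, L.risk f θ) +
        ENNReal.ofReal (Real.sqrt d)⁻¹ * ∫⁻ p, ENNReal.ofReal |Real.sqrt d *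
          inner ℝ (signVec hd σ).1
            (L.estimator p.1 (L.history f (signVec hd σ) p.1 p.2 T)).1| ∂L.prob) :=
          Finset.sum_le_sum fun σ _ => (h1 σ).trans
            (add_le_add (le_iSup (fun θ => L.risk f θ) (signVec hd σ)) le_rfl)
      _ ≤ 2 ^ d * (⨆ θ : Sphere d, L.risk f θ) + ENNReal.ofReal (Real.sqrt d)⁻¹ *
            (2 ^ d * ENNReal.ofReal (Real.sqrt (Q T))) := by
          rw [Finset.sum_add_distrib, ← Finset.mul_sum]
          refine add_le_add (le_of_eq (by simp)) (mul_le_mul_right hbound' _)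
      _ = _ := by
          rw [mul_left_comm, ← ENNReal.ofReal_mul (by positivity), Real.sqrt_div' _ hd0.le,
            div_eq_inv_mul]
  rw [← mul_add] at hsum
  have h2 : (2 : ℝ≥0∞) ^ d ≠ 0 := by positivity
  have h3 : (2 : ℝ≥0∞) ^ d ≠ ⊤ := ENNReal.pow_ne_top (by norm_num)
  have h4 : (2 : ℝ≥0∞) ^ d * 1 ≤ 2 ^ d * ((⨆ θ : Sphere d, L.risk f θ) +
      ENNReal.ofReal (Real.sqrt (Q T / d))) := by rwa [mul_one]
  exact (ENNReal.mul_le_mul_iff_right h2 h3).1 h4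

lemma lintegral_two_mul {a b : ℝ} (ha : 0 ≤ a) (hab : a ≤ b) :
    ∫⁻ x in Ioc a b, ENNReal.ofReal (2 * x) = ENNReal.ofReal (b ^ 2 - a ^ 2) := by
  rw [← ofReal_integral_eq_lintegral_ofReal]
  · rw [← intervalIntegral.integral_of_le hab, intervalIntegral.integral_const_mul, integral_id]
    congr 1
    ring
  · exact Continuous.integrableOn_Ioc (by fun_prop)
  · refine (ae_restrict_iff' measurableSet_Ioc).2 (ae_of_all _ fun x hx => ?_)
    have : 0 ≤ x := ha.trans hx.1.le
    simpa using this

lemma le_sqrt_corrLevelSq (hd : 0 < d) {f : ℝ → ℝ}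
    (hf : LinkFunction f) (hs : IsEven f ∨ IsOdd f) {n : ℕ} (hn : 2 ≤ n) (hT : T ≤ n) {ε : ℝ}
    (hε : ε ≤ 1) (h : minimaxRisk f d T ≤ ENNReal.ofReal (1 - ε)) :
    ε ≤ Real.sqrt (corrLevelSq (clipLink f) d (Real.log n) T / d) := by
  have h1 : 1 ≤ minimaxRisk f d T + ENNReal.ofReal
      (Real.sqrt (corrLevelSq (clipLink f) d (Real.log n) T / d)) := by
    rw [minimaxRisk, ENNReal.iInf_add]
    exact le_iInf fun L => L.one_le_iSup_risk_add hd hf hs hn hT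
  have h2 := h1.trans (add_le_add h le_rfl)
  rw [← ENNReal.ofReal_add (by linarith) (Real.sqrt_nonneg _), ENNReal.one_le_ofReal] at h2
  linarith

/-- The integral over one step of the recursion. -/
lemma lintegral_corrLevelSq_step_le (hd : 0 < d) {f : ℝ → ℝ} (hf : LinkFunction f) {A : ℝ}
    (hA : 0 ≤ A) (t : ℕ) :
    ∫⁻ x in Ioc (Real.sqrt (corrLevelSq (clipLink f) d A t / d))
        (Real.sqrt (corrLevelSq (clipLink f) d A (t + 1) / d)),
      ENNReal.ofReal (2 * x) / ENNReal.ofReal (clipLink f x ^ 2) ≤ ENNReal.ofReal (8 / d) := by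
  have hd0 : (0 : ℝ) < d := by exact_mod_cast hd
  set Q := corrLevelSq (clipLink f) d A
  have hQ0 : 0 ≤ Q t := le_trans (by positivity) (le_corrLevelSq _ _ _ t)
  set a := Real.sqrt (Q t / d) with ha
  have hstep : Q (t + 1) = Q t + 8 * clipLink f a ^ 2 := rfl
  have ha0 : 0 ≤ a := Real.sqrt_nonneg _
  have hasq : a ^ 2 = Q t / d := Real.sq_sqrt (by positivity)
  -- If `f` vanishes at the current level, the recursion stalls and the interval is empty, so the
  -- infinite integrand does no harm.
  by_cases h0 : clipLink f a = 0
  · rw [hstep, h0]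
    simp [ha]
  · set b := Real.sqrt (Q (t + 1) / d) with hb
    have hbsq : b ^ 2 = Q (t + 1) / d := Real.sq_sqrt (by
      rw [hstep]; positivity)
    have hab : a ≤ b := Real.sqrt_le_sqrt (by
      gcongr; rw [hstep]; linarith [sq_nonneg (clipLink f a)])
    have hpos : 0 < clipLink f a ^ 2 := by positivity
    calc ∫⁻ x in Ioc a b, ENNReal.ofReal (2 * x) / ENNReal.ofReal (clipLink f x ^ 2)
        ≤ ∫⁻ x in Ioc a b, ENNReal.ofReal (2 * x) / ENNReal.ofReal (clipLink f a ^ 2) := by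
          refine setLIntegral_mono' measurableSet_Ioc fun x hx => ?_
          refine ENNReal.div_le_div_left (ENNReal.ofReal_le_ofReal ?_) _
          exact pow_le_pow_left₀ (clipLink_nonneg hf ha0)
            (clipLink_monotoneOn hf ha0 (ha0.trans hx.1.le) hx.1.le) 2
      _ = (∫⁻ x in Ioc a b, ENNReal.ofReal (2 * x)) / ENNReal.ofReal (clipLink f a ^ 2) := by
          simp only [div_eq_mul_inv]
          rw [lintegral_mul_const _ (by fun_prop)]
      _ = ENNReal.ofReal (b ^ 2 - a ^ 2) / ENNReal.ofReal (clipLink f a ^ 2) := by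
        rw [lintegral_two_mul ha0 hab]
      _ ≤ ENNReal.ofReal (8 / d) := by
          rw [← ENNReal.ofReal_div_of_pos hpos, hasq, hbsq, hstep]
          refine ENNReal.ofReal_le_ofReal (le_of_eq ?_)
          field_simp
          ring

/-- The lower bound integral up to the correlation that is reached in `m` rounds. -/
lemma lintegral_corrLevelSq_le (hd : 0 < d) {f : ℝ → ℝ} (hf : LinkFunction f) {A : ℝ}
    (hA : 0 ≤ A) (m : ℕ) :
    ∫⁻ x in Ioc (Real.sqrt (corrLevelSq (clipLink f) d A 0 / d))
        (Real.sqrt (corrLevelSq (clipLink f) d A m / d)),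
      ENNReal.ofReal (2 * x) / ENNReal.ofReal (clipLink f x ^ 2) ≤
        m * ENNReal.ofReal (8 / d) := by
  induction m with
  | zero => simp
  | succ m ih =>
    refine (lintegral_mono_set Ioc_subset_Ioc_union_Ioc).trans ((lintegral_union_le _ _ _).trans
      ((add_le_add ih (lintegral_corrLevelSq_step_le hd hf hA m)).trans_eq ?_))
    push_cast
    rw [add_mul, one_mul]

/-- A finite burn-in cost is attained, so the recursion can be run for exactly that many rounds. -/
lemma exists_burnInCost_eq {f : ℝ → ℝ} {ε : ℝ} {n : ℕ} (h : burnInCost f d ε ≤ n) :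
    ∃ m : ℕ, m ≤ n ∧ burnInCost f d ε = m ∧ minimaxRisk f d m ≤ ENNReal.ofReal (1 - ε) := by
  classical
  have hex : ∃ m, minimaxRisk f d m ≤ ENNReal.ofReal (1 - ε) := by
    by_contra hne
    push Not at hne
    have : burnInCost f d ε = ⊤ := by
      simp only [burnInCost, sampleComplexity, iInf_eq_top]
      exact fun m hm => absurd hm (not_le.2 (hne m))
    rw [this] at h
    exact absurd h (by simp)
  have heq : burnInCost f d ε = (Nat.find hex : ℕ) := by
    refine le_antisymm (iInf₂_le (Nat.find hex) (Nat.find_spec hex)) (le_iInf₂ fun m hm => ?_)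
    exact_mod_cast Nat.find_min' hex hm
  refine ⟨Nat.find hex, ?_, heq, Nat.find_spec hex⟩
  rw [heq] at h
  exact_mod_cast h

/-- The lower bound on the burn-in cost. -/
lemma mul_lowerIntegral_le (hd : 0 < d) {f : ℝ → ℝ} (hf : LinkFunction f)
    (hs : IsEven f ∨ IsOdd f) {n : ℕ} (hn : 2 ≤ n) {ε : ℝ} (hε : ε ≤ 1 / 2)
    (h : burnInCost f d ε ≤ n) :
    (d : ℝ≥0∞) * lowerIntegral f (Real.sqrt (256 * Real.log n / d)) ε ≤
      8 * (burnInCost f d ε : ℝ≥0∞) := by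
  obtain ⟨m, hmn, hm, hrisk⟩ := exists_burnInCost_eq h
  have hd0 : (0 : ℝ) < d := by exact_mod_cast hd
  have hA : 0 ≤ Real.log n := Real.log_natCast_nonneg n
  have hle := le_sqrt_corrLevelSq hd hf hs hn hmn (by linarith) hrisk
  have h1 : lowerIntegral f (Real.sqrt (256 * Real.log n / d)) ε ≤ m * ENNReal.ofReal (8 / d) := by
    -- The lower endpoint of the integral is the initial level, by definition `256 log n`; this
    -- fixes `c₂ = 256`.
    refine le_trans ?_ (lintegral_corrLevelSq_le hd hf hA m)
    refine le_trans (le_of_eq ?_) (lintegral_mono_set (Ioc_subset_Ioc_right hle))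
    refine setLIntegral_congr_fun measurableSet_Ioc fun x hx => ?_
    have h0 : 0 ≤ x := (Real.sqrt_nonneg _).trans hx.1.le
    rw [clipLink_eq f ⟨by linarith, by linarith [hx.2]⟩]
  rw [hm]
  calc (d : ℝ≥0∞) * lowerIntegral f (Real.sqrt (256 * Real.log n / d)) ε
      ≤ d * (m * ENNReal.ofReal (8 / d)) := by gcongr
    _ = 8 * m := by
        rw [ENNReal.ofReal_div_of_pos hd0, ENNReal.ofReal_natCast, ENNReal.ofReal_ofNat,
          mul_left_comm, ENNReal.mul_div_cancel (by exact_mod_cast hd.ne') (by simp), mul_comm]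
    _ = _ := by simp

end

/-! ### Upper bound: building learners by composing statistics, randomness and rounds. -/

section

variable {d T : ℕ} {F : ℝ → ℝ} {X Y Ω : Type} [MeasurableSpace X] [MeasurableSpace Y]
  [MeasurableSpace Ω]

/-! ### Statistics of a learner -/

/-- `m θ` is the law under the parameter `θ` of some statistic of the internal randomness and the
history of a learner with `T` rounds. -/
def Realizable (F : ℝ → ℝ) (d T : ℕ) (m : Sphere d → Measure X) : Prop :=
  ∃ (L : Learner d T) (out : L.Seed × Hist d T → X), Measurable out ∧
    ∀ θ, m θ = L.prob.map fun p => out (p.1, L.history F θ p.1 p.2 T)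

lemma Realizable.isProbabilityMeasure {m : Sphere d → Measure X} (h : Realizable F d T m)
    (hF : Measurable F) (θ : Sphere d) : IsProbabilityMeasure (m θ) := by
  obtain ⟨L, out, ho, hm⟩ := h
  rw [hm]
  exact Measure.isProbabilityMeasure_map
    (ho.comp (measurable_fst.prodMk (L.measurable_history hF θ T))).aemeasurable

/-- Without any round, every law that does not depend on the parameter can be realized. -/
lemma Realizable.const (hd : 0 < d) (μ : Measure X) [IsProbabilityMeasure μ] :
    Realizable F d 0 fun _ => μ := by
  refine ⟨{ Seed := X, law := μ, action := fun _ _ _ => ⟨0, by simp⟩,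
            measurable_action := fun _ => measurable_const,
            estimator := fun _ _ => signVec hd fun _ => true,
            measurable_estimator := measurable_const }, fun p => p.1, measurable_fst, fun θ => ?_⟩
  refine Eq.symm ?_
  change (μ.prod (Measure.infinitePi fun _ : ℕ => gaussianReal 0 1)).map Prod.fst = μ
  rw [Measure.map_fst_prod, measure_univ, one_smul]

/-- A statistic may be processed with additional randomness. -/
lemma Realizable.randomize {m : Sphere d → Measure X} (h : Realizable F d T m) (hF : Measurable F)
    (ν : Measure Ω) [IsProbabilityMeasure ν] {U : X × Ω → Y} (hU : Measurable U) :
    Realizable F d T fun θ => ((m θ).prod ν).map U := by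
  have hprob := h.isProbabilityMeasure hF
  obtain ⟨L, out, ho, hm⟩ := h
  let L' : Learner d T :=
    { Seed := L.Seed × Ω
      law := L.law.prod ν
      action := fun t s h => L.action t s.1 h
      measurable_action := fun t => (L.measurable_action t).comp
        ((measurable_fst.comp measurable_fst).prodMk measurable_snd)
      estimator := fun s h => L.estimator s.1 h
      measurable_estimator := L.measurable_estimator.comp
        ((measurable_fst.comp measurable_fst).prodMk measurable_snd) }
  have hist : ∀ θ (s : L.Seed) (ω : Ω) z t, L'.history F θ (s, ω) z t = L.history F θ s z t := by
    intro θ s ω z t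
    induction t with
    | zero => rfl
    | succ t ih => simp only [Learner.history, ih, L']
  refine ⟨L', fun p => U (out (p.1.1, p.2), p.1.2), hU.comp ((ho.comp
    ((measurable_fst.comp measurable_fst).prodMk measurable_snd)).prodMk
      (measurable_snd.comp measurable_fst)), fun θ => ?_⟩
  have hp := hprob θ
  have h1 : Measurable fun p : L.Seed × (ℕ → ℝ) => out (p.1, L.history F θ p.1 p.2 T) :=
    ho.comp (measurable_fst.prodMk (L.measurable_history hF θ T))
  have h2 : Measurable fun p : (L.Seed × Ω) × (ℕ → ℝ) =>
      U (out (p.1.1, L'.history F θ p.1 p.2 T), p.1.2) := by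
    have : ∀ p : (L.Seed × Ω) × (ℕ → ℝ), L'.history F θ p.1 p.2 T = L.history F θ p.1.1 p.2 T :=
      fun p => hist θ p.1.1 p.1.2 p.2 T
    simp only [this]
    exact hU.comp ((h1.comp ((measurable_fst.comp measurable_fst).prodMk measurable_snd)).prodMk
      (measurable_snd.comp measurable_fst))
  refine Measure.ext_of_lintegral _ fun Φ hΦ => ?_
  have hΦU : Measurable fun q : X × Ω => Φ (U q) := hΦ.comp hU
  rw [lintegral_map hΦ hU, lintegral_map hΦ h2, lintegral_prod _ hΦU.aemeasurable, hm θ,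
    lintegral_map hΦU.lintegral_prod_right' h1]
  change ∫⁻ p, _ ∂(L.law.prod _) = ∫⁻ p, _ ∂((L.law.prod ν).prod _)
  have h3 : Measurable fun q : (L.Seed × (ℕ → ℝ)) × Ω =>
      Φ (U (out (q.1.1, L.history F θ q.1.1 q.1.2 T), q.2)) :=
    (hΦ.comp hU).comp ((h1.comp measurable_fst).prodMk measurable_snd)
  have h4 : Measurable fun p : (L.Seed × Ω) × (ℕ → ℝ) =>
      Φ (U (out (p.1.1, L'.history F θ p.1 p.2 T), p.1.2)) := hΦ.comp h2
  rw [lintegral_prod _ (h3.lintegral_prod_right').aemeasurable,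
    lintegral_prod _ h4.aemeasurable, lintegral_prod _ h4.lintegral_prod_right'.aemeasurable]
  refine lintegral_congr fun s => ?_
  rw [lintegral_lintegral_swap]
  · simp only [hist]
  · exact (h3.comp ((measurable_const.prodMk measurable_fst).prodMk measurable_snd)).aemeasurable

/-- One more round, whose action is a function of the statistic. -/
lemma Realizable.round {m : Sphere d → Measure X} (h : Realizable F d T m) (hF : Measurable F)
    {A : X → Ball d} (hA : Measurable A) {U : X × ℝ → Y} (hU : Measurable U) :
    Realizable F d (T + 1) fun θ =>
      ((m θ).prod (gaussianReal 0 1)).map fun q => U (q.1, F (inner ℝ θ.1 (A q.1).1) + q.2) := by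
  obtain ⟨L, out, ho, hm⟩ := h
  classical
  -- Rounds are counted from zero, so the new round has index `T`; only its action is replaced, and
  -- the first `T` rounds run unchanged.
  let act : (t : ℕ) → L.Seed → Hist d t → Ball d := fun t s h =>
    if e : t = T then A (out (s, fun i => h (Fin.cast e.symm i))) else L.action t s h
  have hactT : ∀ s h, act T s h = A (out (s, h)) := fun s h => by simp [act]
  have hactne : ∀ t, t ≠ T → act t = L.action t := fun t ht => by
    funext s h; simp [act, ht]
  let L' : Learner d (T + 1) :=
    { Seed := L.Seed
      law := L.law
      action := act
      measurable_action := fun t => by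
        by_cases ht : t = T
        · subst ht
          simp only [hactT]
          exact hA.comp ho
        · rw [hactne t ht]
          exact L.measurable_action t
      estimator := fun s h => L.estimator s (Fin.init h)
      measurable_estimator := L.measurable_estimator.comp (measurable_fst.prodMk
        (measurable_pi_lambda _ fun i => (measurable_pi_apply _).comp measurable_snd)) }
  have hist : ∀ θ s z t, t ≤ T → L'.history F θ s z t = L.history F θ s z t := by
    intro θ s z t ht
    induction t with
    | zero => rfl
    | succ t ih =>
      have h1 := ih (by omega)
      simp only [Learner.history, h1]
      have h2 : L'.action t = L.action t := hactne t (by omega)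
      rw [h2]
  have hout : Measurable fun p : L.Seed × Hist d (T + 1) =>
      U (out (p.1, Fin.init p.2), (p.2 (Fin.last T)).2) :=
    hU.comp ((ho.comp (measurable_fst.prodMk (measurable_pi_lambda _ fun i =>
      (measurable_pi_apply _).comp measurable_snd))).prodMk
        (measurable_snd.comp ((measurable_pi_apply _).comp measurable_snd)))
  refine ⟨L', fun p => U (out (p.1, Fin.init p.2), (p.2 (Fin.last T)).2), hout, fun θ => ?_⟩
  have h1 : Measurable fun p : L.Seed × (ℕ → ℝ) => out (p.1, L.history F θ p.1 p.2 T) :=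
    ho.comp (measurable_fst.prodMk (L.measurable_history hF θ T))
  have h2 : Measurable fun q : X × ℝ => U (q.1, F (inner ℝ θ.1 (A q.1).1) + q.2) :=
    hU.comp (measurable_fst.prodMk ((hF.comp (measurable_const.inner
      (hA.comp measurable_fst).subtype_val)).add measurable_snd))
  refine Measure.ext_of_lintegral _ fun Φ hΦ => ?_
  have hΦ2 : Measurable fun q : X × ℝ => Φ (U (q.1, F (inner ℝ θ.1 (A q.1).1) + q.2)) :=
    hΦ.comp h2
  have h4 : Measurable fun p : L'.Seed × (ℕ → ℝ) =>
      U (out (p.1, Fin.init (L'.history F θ p.1 p.2 (T + 1))),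
        (L'.history F θ p.1 p.2 (T + 1) (Fin.last T)).2) :=
    hout.comp (measurable_fst.prodMk (L'.measurable_history hF θ (T + 1)))
  rw [lintegral_map hΦ h2, lintegral_map hΦ h4,
    L'.lintegral_history_succ hF θ T (Φ := fun p =>
      Φ (U (out (p.1, Fin.init p.2), (p.2 (Fin.last T)).2))) (hΦ.comp hout),
    lintegral_prod _ hΦ2.aemeasurable, hm θ, lintegral_map hΦ2.lintegral_prod_right' h1]
  change ∫⁻ p, _ ∂L.prob = ∫⁻ p, _ ∂L.prob
  refine lintegral_congr fun p => lintegral_congr fun y => ?_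
  have h3 : L'.action T = act T := rfl
  simp only [Fin.init_snoc, Fin.snoc_last, hist θ p.1 p.2 T le_rfl, h3, hactT]

/-- A statistic with values in the sphere serves as the estimator. -/
lemma Realizable.minimaxRisk_le {f : ℝ → ℝ} (hf : LinkFunction f)
    {m : Sphere d → Measure (Sphere d)} (h : Realizable (clipLink f) d T m) {R : ℝ≥0∞}
    (hR : ∀ θ, ∫⁻ x, ENNReal.ofReal (1 - correlation f (inner ℝ x.1 θ.1)) ∂(m θ) ≤ R) :
    minimaxRisk f d T ≤ R := by
  obtain ⟨L, out, ho, hm⟩ := h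
  let L' : Learner d T :=
    { Seed := L.Seed
      law := L.law
      action := L.action
      measurable_action := L.measurable_action
      estimator := fun s h => out (s, h)
      measurable_estimator := ho }
  have hist : ∀ θ s z t, L'.history f θ s z t = L.history (clipLink f) θ s z t := by
    intro θ s z t
    rw [Learner.history_clipLink]
    induction t with
    | zero => rfl
    | succ t ih => simp only [Learner.history, ih, L']
  refine (iInf_le _ L').trans (iSup_le fun θ => le_trans (le_of_eq ?_) (hR θ))
  have hc : Measurable (correlation f) := by
    unfold correlation
    split_ifs
    exacts [measurable_norm, measurable_id]
  rw [hm θ, lintegral_map]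
  · simp only [Learner.risk, hist]
    rfl
  · exact (measurable_const.sub (hc.comp (measurable_subtype_coe.inner
      measurable_const))).ennreal_ofReal
  · exact ho.comp (measurable_fst.prodMk
      (L.measurable_history (measurable_clipLink hf) θ T))

end

/-! ### Upper bound: the sum of reward times direction and its fluctuations. -/

section

variable {d T : ℕ} {F : ℝ → ℝ} {Ω : Type} [MeasurableSpace Ω]

/-! ### Accumulating rewards times directions -/

lemma integrable_sq_gaussianReal : Integrable (fun y : ℝ => y ^ 2) (gaussianReal 0 1) :=
  (memLp_id_gaussianReal (μ := 0) (v := 1) 2).integrable_sq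

lemma integral_sq_gaussianReal : ∫ y, y ^ 2 ∂(gaussianReal 0 1) = 1 := by
  have h := variance_id_gaussianReal (μ := 0) (v := 1)
  rw [variance_of_integral_eq_zero aemeasurable_id (by simp)] at h
  simpa using h

/-- The expectation of a nonnegative quadratic polynomial of a standard normal variable. -/
lemma lintegral_quadratic_gaussianReal {a b c : ℝ} (h : ∀ y, 0 ≤ a + b * y + c * y ^ 2) :
    ∫⁻ y, ENNReal.ofReal (a + b * y + c * y ^ 2) ∂(gaussianReal 0 1) = ENNReal.ofReal (a + c) := by
  have h1 : Integrable (fun y : ℝ => y) (gaussianReal 0 1) :=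
    (memLp_id_gaussianReal (μ := 0) (v := 1) 1).integrable le_rfl
  have h2 := integrable_sq_gaussianReal
  have h3 : Integrable (fun y : ℝ => a + b * y) (gaussianReal 0 1) :=
    (integrable_const a).add (h1.const_mul b)
  have h4 : Integrable (fun y : ℝ => a + b * y + c * y ^ 2) (gaussianReal 0 1) :=
    h3.add (h2.const_mul c)
  rw [← ofReal_integral_eq_lintegral_ofReal h4 (ae_of_all _ h)]
  congr 1
  rw [integral_add h3 (h2.const_mul c), integral_add (integrable_const a) (h1.const_mul b),
    integral_const_mul, integral_const_mul, integral_sq_gaussianReal, integral_id_gaussianReal]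
  simp

/-- Adding a noisy reward times a direction, minus its mean, increases the second moment by at most
twice the second moment of the direction. -/
lemma lintegral_norm_sq_add_le {H : Type*} [NormedAddCommGroup H] [InnerProductSpace ℝ H]
    [MeasurableSpace H] [BorelSpace H] [SecondCountableTopology H] (ν : Measure Ω)
    [IsProbabilityMeasure ν] {h : Ω → ℝ} {v : Ω → H} (hh : Measurable h) (hv : Measurable v)
    (hh1 : ∀ ω, |h ω| ≤ 1) (hv1 : ∀ ω, ‖v ω‖ ≤ 1) {c : H}
    (hc : ∀ D : H, ∫ ω, h ω * inner ℝ D (v ω) ∂ν = inner ℝ D c) (D : H) :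
    ∫⁻ ω, ∫⁻ y, ENNReal.ofReal (‖D + (h ω + y) • v ω - c‖ ^ 2) ∂(gaussianReal 0 1) ∂ν ≤
      ENNReal.ofReal (‖D‖ ^ 2 + 2 * ∫ ω, ‖v ω‖ ^ 2 ∂ν) := by
  have hi1 : Integrable (fun ω => h ω * inner ℝ (D - c) (v ω)) ν := by
    refine Integrable.of_bound (hh.mul (measurable_const.inner hv)).aestronglyMeasurable ‖D - c‖
      (ae_of_all _ fun ω => ?_)
    rw [norm_mul, Real.norm_eq_abs]
    calc |h ω| * ‖inner ℝ (D - c) (v ω)‖ ≤ 1 * (‖D - c‖ * 1) := by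
          refine mul_le_mul (hh1 ω) ((norm_inner_le_norm _ _).trans ?_) (norm_nonneg _) zero_le_one
          exact mul_le_mul_of_nonneg_left (hv1 ω) (norm_nonneg _)
      _ = ‖D - c‖ := by ring
  have hi2 : Integrable (fun ω => ‖v ω‖ ^ 2) ν := by
    refine Integrable.of_bound (hv.norm.pow_const 2).aestronglyMeasurable 1
      (ae_of_all _ fun ω => ?_)
    rw [Real.norm_eq_abs, abs_of_nonneg (by positivity)]
    exact pow_le_one₀ (norm_nonneg _) (hv1 ω)
  have hexp : ∀ ω y, ‖D + (h ω + y) • v ω - c‖ ^ 2 =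
      (‖D - c‖ ^ 2 + 2 * (h ω * inner ℝ (D - c) (v ω)) + h ω ^ 2 * ‖v ω‖ ^ 2) +
        (2 * (inner ℝ (D - c) (v ω) + h ω * ‖v ω‖ ^ 2)) * y + ‖v ω‖ ^ 2 * y ^ 2 := fun ω y => by
    have h1 : D + (h ω + y) • v ω - c = (D - c) + (h ω + y) • v ω := by abel
    rw [h1, norm_add_sq_real, real_inner_smul_right, norm_smul, mul_pow, Real.norm_eq_abs, sq_abs]
    ring
  calc ∫⁻ ω, ∫⁻ y, ENNReal.ofReal (‖D + (h ω + y) • v ω - c‖ ^ 2) ∂(gaussianReal 0 1) ∂ν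
      = ∫⁻ ω, ENNReal.ofReal ((‖D - c‖ ^ 2 + 2 * (h ω * inner ℝ (D - c) (v ω)) +
          h ω ^ 2 * ‖v ω‖ ^ 2) + ‖v ω‖ ^ 2) ∂ν := by
        refine lintegral_congr fun ω => ?_
        simp_rw [hexp]
        exact lintegral_quadratic_gaussianReal fun y => by rw [← hexp]; positivity
    _ ≤ ∫⁻ ω, ENNReal.ofReal (‖D - c‖ ^ 2 + 2 * (h ω * inner ℝ (D - c) (v ω)) +
          2 * ‖v ω‖ ^ 2) ∂ν := by
        refine lintegral_mono fun ω => ENNReal.ofReal_le_ofReal ?_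
        have h1 : h ω ^ 2 ≤ 1 := by
          rw [← sq_abs]; exact pow_le_one₀ (abs_nonneg _) (hh1 ω)
        nlinarith [sq_nonneg ‖v ω‖]
    _ = ENNReal.ofReal (∫ ω, (‖D - c‖ ^ 2 + 2 * (h ω * inner ℝ (D - c) (v ω)) +
          2 * ‖v ω‖ ^ 2) ∂ν) := by
        refine (ofReal_integral_eq_lintegral_ofReal
          (((integrable_const _).add (hi1.const_mul 2)).add (hi2.const_mul 2))
          (ae_of_all _ fun ω => ?_)).symm
        have h1 : 0 ≤ ‖(D - c) + h ω • v ω‖ ^ 2 := by positivity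
        rw [norm_add_sq_real, real_inner_smul_right, norm_smul, mul_pow, Real.norm_eq_abs,
          sq_abs] at h1
        have h2 : h ω ^ 2 ≤ 1 := by
          rw [← sq_abs]; exact pow_le_one₀ (abs_nonneg _) (hh1 ω)
        change 0 ≤ ‖D - c‖ ^ 2 + 2 * (h ω * inner ℝ (D - c) (v ω)) + 2 * ‖v ω‖ ^ 2
        nlinarith [sq_nonneg ‖v ω‖]
    _ ≤ _ := by
        refine ENNReal.ofReal_le_ofReal ?_
        have hi3 : Integrable (fun ω => ‖D - c‖ ^ 2 + 2 * (h ω * inner ℝ (D - c) (v ω))) ν :=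
          (integrable_const _).add (hi1.const_mul 2)
        rw [integral_add hi3 (hi2.const_mul 2),
          integral_add (integrable_const _) (hi1.const_mul 2), integral_const_mul,
          integral_const_mul, hc]
        simp only [integral_const, probReal_univ, one_smul]
        -- Since `c` is the mean increment, the cross term makes the deviation `D` contribute at
        -- most its own square: the deviations form a martingale.
        have h1 : ‖D - c‖ ^ 2 + 2 * inner ℝ (D - c) c = ‖D‖ ^ 2 - ‖c‖ ^ 2 := by
          rw [norm_sub_sq_real, inner_sub_left, real_inner_self_eq_norm_sq]
          ring
        nlinarith [sq_nonneg ‖c‖]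

/-- The mean of the reward times the component of the direction along the parameter. -/
noncomputable def signal (F : ℝ → ℝ) (ν : Measure Ω) (act : Ball d × Ω → Ball d)
    (u : Ω → EuclideanSpace ℝ (Fin d)) (θ : Sphere d) (a : Ball d) : ℝ :=
  ∫ ω, F (inner ℝ θ.1 (act (a, ω)).1) * inner ℝ θ.1 (u ω) ∂ν

lemma measurable_signal (hF : Measurable F) (ν : Measure Ω) [IsProbabilityMeasure ν]
    {act : Ball d × Ω → Ball d} (hact : Measurable act) {u : Ω → EuclideanSpace ℝ (Fin d)}
    (hu : Measurable u) (θ : Sphere d) : Measurable (signal F ν act u θ) := by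
  have h : Measurable fun q : Ball d × Ω =>
      F (inner ℝ θ.1 (act q).1) * inner ℝ θ.1 (u q.2) :=
    (hF.comp (measurable_const.inner hact.subtype_val)).mul
      (measurable_const.inner (hu.comp measurable_snd))
  exact (h.stronglyMeasurable.integral_prod_right).measurable

section step

variable (ν : Measure Ω) [IsProbabilityMeasure ν] {act : Ball d × Ω → Ball d}
  {u : Ω → EuclideanSpace ℝ (Fin d)}

/-- The base action `a` is the same in all rounds of a stage, so the mean increment is the same
multiple of `θ` each time and the squared deviations from it add up. -/
lemma lintegral_norm_sq_step_le (hF : Measurable F) (hF1 : ∀ x, |F x| ≤ 1)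
    (hact : Measurable act) (hu : Measurable u) (hu1 : ∀ ω, ‖u ω‖ ≤ 1) (θ : Sphere d) (a : Ball d)
    (hdir : ∀ D : EuclideanSpace ℝ (Fin d),
      ∫ ω, F (inner ℝ θ.1 (act (a, ω)).1) * inner ℝ D (u ω) ∂ν =
        signal F ν act u θ a * inner ℝ D θ.1) (n : ℕ) (W : EuclideanSpace ℝ (Fin d)) :
    ∫⁻ ω, ∫⁻ y, ENNReal.ofReal (‖W + (F (inner ℝ θ.1 (act (a, ω)).1) + y) • u ω -
        ((n + 1 : ℕ) * signal F ν act u θ a) • θ.1‖ ^ 2) ∂(gaussianReal 0 1) ∂ν ≤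
      ENNReal.ofReal (‖W - (n * signal F ν act u θ a) • θ.1‖ ^ 2) +
        ENNReal.ofReal (2 * ∫ ω, ‖u ω‖ ^ 2 ∂ν) := by
  have hha : Measurable fun ω => F (inner ℝ θ.1 (act (a, ω)).1) :=
    hF.comp (measurable_const.inner (hact.comp measurable_prodMk_left).subtype_val)
  have h0 : 0 ≤ ∫ ω, ‖u ω‖ ^ 2 ∂ν := integral_nonneg fun ω => sq_nonneg _
  rw [← ENNReal.ofReal_add (sq_nonneg _) (mul_nonneg zero_le_two h0)]
  have h := lintegral_norm_sq_add_le ν hha hu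
    (fun ω => hF1 _) hu1 (c := signal F ν act u θ a • θ.1) (fun D => by
      rw [hdir, real_inner_smul_right]) (W - (n * signal F ν act u θ a) • θ.1)
  refine le_trans (le_of_eq ?_) h
  refine lintegral_congr fun ω => lintegral_congr fun y => ?_
  have h1 : W + (F (inner ℝ θ.1 (act (a, ω)).1) + y) • u ω -
        ((n + 1 : ℕ) * signal F ν act u θ a) • θ.1 = W - (n * signal F ν act u θ a) • θ.1 +
        (F (inner ℝ θ.1 (act (a, ω)).1) + y) • u ω - signal F ν act u θ a • θ.1 := by
    push_cast
    module
  rw [h1]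

/-- The same martingale argument, applied in `ℝ` to the component along `θ`. It is kept apart
because for a Gaussian direction this component carries only a fraction `1/d` of the variance, and
this is what makes correlations of order `1/√d` detectable. -/
lemma lintegral_sq_step_le (hF : Measurable F) (hF1 : ∀ x, |F x| ≤ 1)
    (hact : Measurable act) (hu : Measurable u) (hu1 : ∀ ω, ‖u ω‖ ≤ 1) (θ : Sphere d) (a : Ball d)
    (n : ℕ) (W : EuclideanSpace ℝ (Fin d)) :
    ∫⁻ ω, ∫⁻ y, ENNReal.ofReal ((inner ℝ θ.1 (W + (F (inner ℝ θ.1 (act (a, ω)).1) + y) • u ω) -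
        (n + 1 : ℕ) * signal F ν act u θ a) ^ 2) ∂(gaussianReal 0 1) ∂ν ≤
      ENNReal.ofReal ((inner ℝ θ.1 W - n * signal F ν act u θ a) ^ 2) +
        ENNReal.ofReal (2 * ∫ ω, inner ℝ θ.1 (u ω) ^ 2 ∂ν) := by
  have hθ : ‖θ.1‖ = 1 := norm_eq_of_mem_sphere θ
  have hha : Measurable fun ω => F (inner ℝ θ.1 (act (a, ω)).1) :=
    hF.comp (measurable_const.inner (hact.comp measurable_prodMk_left).subtype_val)
  have huθ : Measurable fun ω => inner ℝ θ.1 (u ω) := measurable_const.inner hu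
  have h0 : 0 ≤ ∫ ω, inner ℝ θ.1 (u ω) ^ 2 ∂ν := integral_nonneg fun ω => sq_nonneg _
  rw [← ENNReal.ofReal_add (sq_nonneg _) (mul_nonneg zero_le_two h0)]
  have h := lintegral_norm_sq_add_le ν hha huθ
    (fun ω => hF1 _) (fun ω => (norm_inner_le_norm _ _).trans (by
      rw [hθ, one_mul]; exact hu1 ω)) (c := signal F ν act u θ a) (fun D => by
      simp only [signal, RCLike.inner_apply, conj_trivial]
      rw [← integral_mul_const]
      exact integral_congr_ae (ae_of_all _ fun ω => by ring))
    (inner ℝ θ.1 W - n * signal F ν act u θ a)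
  simp only [Real.norm_eq_abs, sq_abs] at h
  refine le_trans (le_of_eq ?_) h
  refine lintegral_congr fun ω => lintegral_congr fun y => ?_
  congr 2
  push_cast
  rw [inner_add_right, real_inner_smul_right, smul_eq_mul]
  ring

end step

/-- The sum over `n` rounds of the rewards times the directions is the multiple `n s` of the
parameter, up to a small error. -/
lemma Realizable.accumulate {m : Sphere d → Measure (Ball d)} (hm : Realizable F d T m)
    (hF : Measurable F) (hF1 : ∀ x, |F x| ≤ 1) (ν : Measure Ω) [IsProbabilityMeasure ν]
    {act : Ball d × Ω → Ball d} (hact : Measurable act) {u : Ω → EuclideanSpace ℝ (Fin d)}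
    (hu : Measurable u) (hu1 : ∀ ω, ‖u ω‖ ≤ 1)
    (hdir : ∀ (θ : Sphere d) a (D : EuclideanSpace ℝ (Fin d)),
      ∫ ω, F (inner ℝ θ.1 (act (a, ω)).1) * inner ℝ D (u ω) ∂ν =
        signal F ν act u θ a * inner ℝ D θ.1) (n : ℕ) :
    ∃ m' : Sphere d → Measure (Ball d × EuclideanSpace ℝ (Fin d)), Realizable F d (T + n) m' ∧
      ∀ θ, (∀ Φ : Ball d → ℝ≥0∞, Measurable Φ → ∫⁻ q, Φ q.1 ∂(m' θ) = ∫⁻ a, Φ a ∂(m θ)) ∧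
        ∫⁻ q, ENNReal.ofReal (‖q.2 - (n * signal F ν act u θ q.1) • θ.1‖ ^ 2) ∂(m' θ) ≤
          n * ENNReal.ofReal (2 * ∫ ω, ‖u ω‖ ^ 2 ∂ν) ∧
        ∫⁻ q, ENNReal.ofReal ((inner ℝ θ.1 q.2 - n * signal F ν act u θ q.1) ^ 2) ∂(m' θ) ≤
          n * ENNReal.ofReal (2 * ∫ ω, inner ℝ θ.1 (u ω) ^ 2 ∂ν) := by
  have hm₂ : ∀ (θ : Sphere d) (k : ℕ), Measurable fun q : Ball d × EuclideanSpace ℝ (Fin d) =>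
      ENNReal.ofReal (‖q.2 - (k * signal F ν act u θ q.1) • θ.1‖ ^ 2) := fun θ k => by
    have := measurable_signal hF ν hact hu θ
    exact ((measurable_snd.sub (((this.comp measurable_fst).const_mul _).smul_const
          θ.1)).norm.pow_const 2).ennreal_ofReal
  have hm₃ : ∀ (θ : Sphere d) (k : ℕ), Measurable fun q : Ball d × EuclideanSpace ℝ (Fin d) =>
      ENNReal.ofReal ((inner ℝ θ.1 q.2 - k * signal F ν act u θ q.1) ^ 2) := fun θ k => by
    have := measurable_signal hF ν hact hu θ
    exact (((measurable_const.inner measurable_snd).sub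
      ((this.comp measurable_fst).const_mul _)).pow_const 2).ennreal_ofReal
  induction n with
  | zero =>
    have h0 : Measurable fun q : Ball d × Unit => (q.1, (0 : EuclideanSpace ℝ (Fin d))) := by
      fun_prop
    have hp := hm.isProbabilityMeasure hF
    refine ⟨_, hm.randomize hF (Measure.dirac ()) h0, fun θ => ?_⟩
    have hpθ := hp θ
    have key : ∀ Φ : Ball d × EuclideanSpace ℝ (Fin d) → ℝ≥0∞, Measurable Φ →
        ∫⁻ q, Φ q ∂(((m θ).prod (Measure.dirac ())).map
          fun q : Ball d × Unit => (q.1, (0 : EuclideanSpace ℝ (Fin d)))) =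
        ∫⁻ a, Φ (a, 0) ∂(m θ) := fun Φ hΦ => by
      have h1 : Measurable fun q : Ball d × Unit => Φ (q.1, 0) := hΦ.comp h0
      rw [lintegral_map hΦ h0, lintegral_prod _ h1.aemeasurable]
      simp
    refine ⟨fun Φ hΦ => key _ (hΦ.comp measurable_fst), ?_, ?_⟩
    · rw [key _ (hm₂ θ 0)]
      simp
    · rw [key _ (hm₃ θ 0)]
      simp
  | succ n ih =>
    obtain ⟨m₁, hm₁, hprop⟩ := ih
    have hU : Measurable fun q : ((Ball d × EuclideanSpace ℝ (Fin d)) × Ω) × ℝ =>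
        (q.1.1.1, q.1.1.2 + q.2 • u q.1.2) :=
      (measurable_fst.comp (measurable_fst.comp measurable_fst)).prodMk
        ((measurable_snd.comp (measurable_fst.comp measurable_fst)).add
          (measurable_snd.smul (hu.comp (measurable_snd.comp measurable_fst))))
    have hA : Measurable fun q : (Ball d × EuclideanSpace ℝ (Fin d)) × Ω =>
        act (q.1.1, q.2) :=
      hact.comp ((measurable_fst.comp measurable_fst).prodMk measurable_snd)
    have hr := (hm₁.randomize hF ν measurable_id).round hF hA hU
    have hp := hm₁.isProbabilityMeasure hF
    refine ⟨_, hr, fun θ => ?_⟩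
    have hpθ := hp θ
    simp only [Measure.map_id]
    have hU' : Measurable fun q : ((Ball d × EuclideanSpace ℝ (Fin d)) × Ω) × ℝ =>
        (q.1.1.1, q.1.1.2 + (F (inner ℝ θ.1 (act (q.1.1.1, q.1.2)).1) + q.2) • u q.1.2) :=
      hU.comp (measurable_fst.prodMk ((hF.comp (measurable_const.inner
        (hA.comp measurable_fst).subtype_val)).add measurable_snd))
    have key : ∀ Φ : Ball d × EuclideanSpace ℝ (Fin d) → ℝ≥0∞, Measurable Φ →
        ∫⁻ q, Φ q ∂((((m₁ θ).prod ν).prod (gaussianReal 0 1)).map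
          fun q : ((Ball d × EuclideanSpace ℝ (Fin d)) × Ω) × ℝ =>
            (q.1.1.1, q.1.1.2 + (F (inner ℝ θ.1 (act (q.1.1.1, q.1.2)).1) + q.2) • u q.1.2)) =
        ∫⁻ p, ∫⁻ ω, ∫⁻ y, Φ (p.1, p.2 + (F (inner ℝ θ.1 (act (p.1, ω)).1) + y) • u ω)
          ∂(gaussianReal 0 1) ∂ν ∂(m₁ θ) := fun Φ hΦ => by
      have h1 : Measurable fun q : ((Ball d × EuclideanSpace ℝ (Fin d)) × Ω) × ℝ =>
        Φ (q.1.1.1, q.1.1.2 + (F (inner ℝ θ.1 (act (q.1.1.1, q.1.2)).1) + q.2) • u q.1.2) :=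
        hΦ.comp hU'
      rw [lintegral_map hΦ hU', lintegral_prod _ h1.aemeasurable,
        lintegral_prod _ h1.lintegral_prod_right'.aemeasurable]
    obtain ⟨h₁, h₂, h₃⟩ := hprop θ
    refine ⟨fun Φ hΦ => ?_, ?_, ?_⟩
    · have hΦ' : Measurable fun q : Ball d × EuclideanSpace ℝ (Fin d) => Φ q.1 :=
        hΦ.comp measurable_fst
      rw [key _ hΦ', ← h₁ Φ hΦ]
      simp
    · rw [key _ (hm₂ θ (n + 1))]
      calc _ ≤ ∫⁻ p, (ENNReal.ofReal (‖p.2 - (n * signal F ν act u θ p.1) • θ.1‖ ^ 2) +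
              ENNReal.ofReal (2 * ∫ ω, ‖u ω‖ ^ 2 ∂ν)) ∂(m₁ θ) :=
            lintegral_mono fun p => lintegral_norm_sq_step_le ν hF hF1 hact hu hu1 θ p.1
              (hdir θ p.1) n p.2
        _ ≤ _ := by
            rw [lintegral_add_right _ measurable_const, lintegral_const, measure_univ, mul_one]
            push_cast
            rw [add_mul, one_mul]
            gcongr
    · rw [key _ (hm₃ θ (n + 1))]
      calc _ ≤ ∫⁻ p, (ENNReal.ofReal ((inner ℝ θ.1 p.2 - n * signal F ν act u θ p.1) ^ 2) +
              ENNReal.ofReal (2 * ∫ ω, inner ℝ θ.1 (u ω) ^ 2 ∂ν)) ∂(m₁ θ) :=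
            lintegral_mono fun p => lintegral_sq_step_le ν hF hF1 hact hu hu1 θ p.1 n p.2
        _ ≤ _ := by
            rw [lintegral_add_right _ measurable_const, lintegral_const, measure_univ, mul_one]
            push_cast
            rw [add_mul, one_mul]
            gcongr

end

/-! ### Upper bound: Gaussian directions and the mean signal that they pick up. -/

section

variable {d : ℕ}

/-! ### The standard Gaussian law -/

lemma stdGaussian_map_inner {θ : EuclideanSpace ℝ (Fin d)} (hθ : ‖θ‖ = 1) :
    (stdGaussian (EuclideanSpace ℝ (Fin d))).map (fun x => inner ℝ θ x) = gaussianReal 0 1 := by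
  have h := IsGaussian.map_eq_gaussianReal (μ := stdGaussian (EuclideanSpace ℝ (Fin d)))
    (innerSL ℝ θ)
  rw [variance_dual_stdGaussian, integral_strongDual_stdGaussian, innerSL_apply_norm, hθ] at h
  simpa using h

lemma lintegral_inner_sq_stdGaussian {θ : EuclideanSpace ℝ (Fin d)} (hθ : ‖θ‖ = 1) :
    ∫⁻ x, ENNReal.ofReal (inner ℝ θ x ^ 2) ∂(stdGaussian (EuclideanSpace ℝ (Fin d))) = 1 := by
  have h : Measurable fun y : ℝ => ENNReal.ofReal (y ^ 2) := by fun_prop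
  have h1 := lintegral_quadratic_gaussianReal (a := 0) (b := 0) (c := 1) fun y => by
    nlinarith [sq_nonneg y]
  rw [← lintegral_map h (by fun_prop : Measurable fun x : EuclideanSpace ℝ (Fin d) =>
    inner ℝ θ x), stdGaussian_map_inner hθ]
  simpa using h1

lemma lintegral_norm_sq_stdGaussian :
    ∫⁻ x, ENNReal.ofReal (‖x‖ ^ 2) ∂(stdGaussian (EuclideanSpace ℝ (Fin d))) = d := by
  have h1 : ∀ x : EuclideanSpace ℝ (Fin d), ENNReal.ofReal (‖x‖ ^ 2) =
      ∑ i, ENNReal.ofReal (inner ℝ (EuclideanSpace.single i (1 : ℝ)) x ^ 2) := fun x => by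
    rw [EuclideanSpace.norm_sq_eq, ENNReal.ofReal_sum_of_nonneg fun i _ => sq_nonneg _]
    refine Finset.sum_congr rfl fun i _ => ?_
    rw [EuclideanSpace.inner_single_left]
    simp
  simp_rw [h1]
  rw [lintegral_finsetSum _ fun i _ => by fun_prop]
  simp [lintegral_inner_sq_stdGaussian]

/-- Markov's inequality for `‖x‖²`, whose mean is `d`; no sharper concentration is needed. -/
lemma stdGaussian_norm_sq_gt_le {s : ℝ} (hs : 0 < s) :
    stdGaussian (EuclideanSpace ℝ (Fin d)) {x | s * d < ‖x‖ ^ 2} ≤ ENNReal.ofReal s⁻¹ := by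
  rcases Nat.eq_zero_or_pos d with rfl | hd
  · have : {x : EuclideanSpace ℝ (Fin 0) | s * (0 : ℕ) < ‖x‖ ^ 2} = ∅ := by
      ext x
      simp [Subsingleton.elim x 0]
    rw [this]
    simp
  have hd' : (0 : ℝ) < d := by exact_mod_cast hd
  have h := mul_meas_ge_le_lintegral₀ (μ := stdGaussian (EuclideanSpace ℝ (Fin d)))
    (f := fun x => ENNReal.ofReal (‖x‖ ^ 2)) (by fun_prop) (ENNReal.ofReal (s * d))
  rw [lintegral_norm_sq_stdGaussian] at h
  have h2 : stdGaussian (EuclideanSpace ℝ (Fin d)) {x | s * d < ‖x‖ ^ 2} ≤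
      (d : ℝ≥0∞) / ENNReal.ofReal (s * d) := by
    rw [ENNReal.le_div_iff_mul_le (Or.inl (by simp; positivity)) (Or.inl (by simp)), mul_comm]
    refine le_trans (mul_le_mul_right (measure_mono fun x hx => ?_) _) h
    exact ENNReal.ofReal_le_ofReal (le_of_lt hx)
  refine h2.trans (le_of_eq ?_)
  rw [← ENNReal.ofReal_natCast, ← ENNReal.ofReal_div_of_pos (by positivity)]
  congr 1
  field_simp

lemma stdGaussian_abs_inner_gt_le {θ : EuclideanSpace ℝ (Fin d)} (hθ : ‖θ‖ = 1) :
    stdGaussian (EuclideanSpace ℝ (Fin d)) {x | 2 < |inner ℝ θ x|} ≤ ENNReal.ofReal (1 / 4) := by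
  have h := mul_meas_ge_le_lintegral₀ (μ := stdGaussian (EuclideanSpace ℝ (Fin d)))
    (f := fun x => ENNReal.ofReal (inner ℝ θ x ^ 2)) (by fun_prop) (ENNReal.ofReal 4)
  rw [lintegral_inner_sq_stdGaussian hθ] at h
  have h2 : stdGaussian (EuclideanSpace ℝ (Fin d)) {x | 2 < |inner ℝ θ x|} ≤
      1 / ENNReal.ofReal 4 := by
    rw [ENNReal.le_div_iff_mul_le (Or.inl (by simp)) (Or.inl (by simp)), mul_comm]
    refine le_trans (mul_le_mul_right (measure_mono fun x hx => ?_) _) h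
    refine ENNReal.ofReal_le_ofReal ?_
    have h3 : 2 < |inner ℝ θ x| := hx
    rw [← sq_abs]
    nlinarith
  refine h2.trans (le_of_eq ?_)
  rw [← ENNReal.ofReal_one, ← ENNReal.ofReal_div_of_pos (by norm_num)]

/-- The standard normal density is at most `1/2`, and the interval has length `2t`. -/
lemma stdGaussian_abs_inner_lt_le {θ : EuclideanSpace ℝ (Fin d)} (hθ : ‖θ‖ = 1) {t : ℝ} :
    stdGaussian (EuclideanSpace ℝ (Fin d)) {x | |inner ℝ θ x| < t} ≤ ENNReal.ofReal t := by
  have h1 : stdGaussian (EuclideanSpace ℝ (Fin d)) {x | |inner ℝ θ x| < t} =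
      gaussianReal 0 1 (Ioo (-t) t) := by
    rw [← stdGaussian_map_inner hθ, Measure.map_apply (by fun_prop) measurableSet_Ioo]
    congr 1
    ext x
    simp [abs_lt]
  rw [h1, gaussianReal_apply _ one_ne_zero]
  calc ∫⁻ x in Ioo (-t) t, gaussianPDF 0 1 x ≤ ∫⁻ _ in Ioo (-t) t, ENNReal.ofReal (1 / 2) := by
        refine lintegral_mono fun x => ENNReal.ofReal_le_ofReal ?_
        simp only [gaussianPDFReal, NNReal.coe_one, mul_one]
        have hpi : 2 ≤ Real.sqrt (2 * Real.pi) :=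
          Real.le_sqrt_of_sq_le (by nlinarith [Real.pi_gt_three])
        have h2 : (Real.sqrt (2 * Real.pi))⁻¹ ≤ 1 / 2 := by
          rw [one_div]; exact inv_anti₀ (by norm_num) hpi
        have h3 : Real.exp (-(x - 0) ^ 2 / 2) ≤ 1 := Real.exp_le_one_iff.2 (by
          have := sq_nonneg (x - 0); linarith)
        calc _ ≤ (1 / 2 : ℝ) * 1 := mul_le_mul h2 h3 (Real.exp_nonneg _) (by norm_num)
          _ = 1 / 2 := by ring
    _ = ENNReal.ofReal t := by
        rw [setLIntegral_const, Real.volume_Ioo, ← ENNReal.ofReal_mul (by norm_num)]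
        congr 1
        ring

/-! ### Random directions -/

open Classical in
/-- The rescaling of a Gaussian vector to a direction of norm at most `1 / 8`, where vectors that
are too long are discarded. -/
noncomputable def dirVec (Λ : ℝ) (x : EuclideanSpace ℝ (Fin d)) : EuclideanSpace ℝ (Fin d) :=
  if ‖x‖ ^ 2 ≤ Λ / 64 * d then (Real.sqrt (Λ * d))⁻¹ • x else 0

lemma measurable_dirVec (Λ : ℝ) : Measurable (dirVec (d := d) Λ) :=
  Measurable.ite (measurableSet_le (by fun_prop) measurable_const) (by fun_prop) measurable_const

/-- The truncation looks at the norm alone, so the law of the direction stays invariant under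
isometries; the symmetry arguments below rest on this. -/
lemma dirVec_isometry (Λ : ℝ)
    (R : EuclideanSpace ℝ (Fin d) ≃ₗᵢ[ℝ] EuclideanSpace ℝ (Fin d)) (x : EuclideanSpace ℝ (Fin d)) :
    dirVec Λ (R x) = R (dirVec Λ x) := by
  unfold dirVec
  rw [R.norm_map]
  split_ifs <;> simp

lemma norm_dirVec_le {Λ : ℝ} (hΛ : 0 < Λ) (x : EuclideanSpace ℝ (Fin d)) :
    ‖dirVec Λ x‖ ≤ 1 / 8 := by
  unfold dirVec
  split_ifs with h
  · rcases Nat.eq_zero_or_pos d with rfl | hd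
    · rw [Subsingleton.elim x 0]; simp
    have hd' : (0 : ℝ) < d := by exact_mod_cast hd
    have hs : 0 < Real.sqrt (Λ * d) := Real.sqrt_pos.2 (by positivity)
    rw [norm_smul, norm_inv, Real.norm_eq_abs, abs_of_pos hs, inv_mul_le_iff₀ hs]
    refine le_of_sq_le_sq ?_ (by positivity)
    rw [mul_pow, Real.sq_sqrt (by positivity)]
    linarith
  · simp

lemma inner_dirVec_sq_le {Λ : ℝ} (hΛ : 0 < Λ) (θ x : EuclideanSpace ℝ (Fin d)) :
    inner ℝ θ (dirVec Λ x) ^ 2 ≤ (Λ * d)⁻¹ * inner ℝ θ x ^ 2 := by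
  unfold dirVec
  split_ifs
  · rw [real_inner_smul_right, mul_pow, inv_pow,
      Real.sq_sqrt (by positivity : (0 : ℝ) ≤ Λ * d)]
  · rw [inner_zero_right, zero_pow two_ne_zero]; positivity

lemma norm_dirVec_sq_le {Λ : ℝ} (hΛ : 0 < Λ) (x : EuclideanSpace ℝ (Fin d)) :
    ‖dirVec Λ x‖ ^ 2 ≤ (Λ * d)⁻¹ * ‖x‖ ^ 2 := by
  unfold dirVec
  split_ifs
  · rw [norm_smul, norm_inv, Real.norm_eq_abs, mul_pow, inv_pow, sq_abs,
      Real.sq_sqrt (by positivity : (0 : ℝ) ≤ Λ * d)]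
  · rw [norm_zero, zero_pow two_ne_zero]; positivity

lemma integral_le_of_lintegral_le {α : Type*} [MeasurableSpace α] {μ : Measure α} {g h : α → ℝ}
    (hg : Measurable g) (hg0 : ∀ x, 0 ≤ g x) {c C : ℝ} (hc : 0 ≤ c) (hC : 0 ≤ C)
    (hgh : ∀ x, g x ≤ c * h x) (hh : Measurable h)
    (hint : ∫⁻ x, ENNReal.ofReal (h x) ∂μ ≤ ENNReal.ofReal C) : ∫ x, g x ∂μ ≤ c * C := by
  rw [integral_eq_lintegral_of_nonneg_ae (ae_of_all _ hg0) hg.aestronglyMeasurable]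
  refine ENNReal.toReal_le_of_le_ofReal (by positivity) ?_
  calc ∫⁻ x, ENNReal.ofReal (g x) ∂μ ≤ ∫⁻ x, ENNReal.ofReal c * ENNReal.ofReal (h x) ∂μ := by
        refine lintegral_mono fun x => ?_
        rw [← ENNReal.ofReal_mul hc]
        exact ENNReal.ofReal_le_ofReal (hgh x)
    _ ≤ _ := by
        rw [lintegral_const_mul _ hh.ennreal_ofReal, ENNReal.ofReal_mul hc]
        gcongr

lemma integral_norm_dirVec_sq_le {Λ : ℝ} (hΛ : 0 < Λ) :
    ∫ x, ‖dirVec Λ x‖ ^ 2 ∂(stdGaussian (EuclideanSpace ℝ (Fin d))) ≤ Λ⁻¹ := by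
  have h := integral_le_of_lintegral_le (μ := stdGaussian (EuclideanSpace ℝ (Fin d)))
    (g := fun x => ‖dirVec Λ x‖ ^ 2) (h := fun x => ‖x‖ ^ 2) (c := (Λ * d)⁻¹) (C := d)
    ((measurable_dirVec Λ).norm.pow_const 2) (fun x => sq_nonneg _) (by positivity)
    (by positivity) (norm_dirVec_sq_le hΛ) (by fun_prop)
    (by rw [lintegral_norm_sq_stdGaussian, ENNReal.ofReal_natCast])
  refine h.trans ?_
  rcases Nat.eq_zero_or_pos d with rfl | hd
  · simp [hΛ.le]
  · have hd' : (0 : ℝ) < d := by exact_mod_cast hd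
    refine le_of_eq ?_
    field_simp

lemma integral_inner_dirVec_sq_le {Λ : ℝ} (hΛ : 0 < Λ) {θ : EuclideanSpace ℝ (Fin d)}
    (hθ : ‖θ‖ = 1) :
    ∫ x, inner ℝ θ (dirVec Λ x) ^ 2 ∂(stdGaussian (EuclideanSpace ℝ (Fin d))) ≤ (Λ * d)⁻¹ := by
  have h := integral_le_of_lintegral_le (μ := stdGaussian (EuclideanSpace ℝ (Fin d)))
    (g := fun x => inner ℝ θ (dirVec Λ x) ^ 2) (h := fun x => inner ℝ θ x ^ 2) (c := (Λ * d)⁻¹)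
    (C := 1) ((measurable_const.inner (measurable_dirVec Λ)).pow_const 2) (fun x => sq_nonneg _)
    (by positivity) zero_le_one (inner_dirVec_sq_le hΛ θ) (by fun_prop)
    (by rw [lintegral_inner_sq_stdGaussian hθ, ENNReal.ofReal_one])
  rwa [mul_one] at h

lemma integral_comp_isometry_stdGaussian
    (R : EuclideanSpace ℝ (Fin d) ≃ₗᵢ[ℝ] EuclideanSpace ℝ (Fin d))
    {g : EuclideanSpace ℝ (Fin d) → ℝ} (hg : Measurable g) :
    ∫ x, g (R x) ∂(stdGaussian (EuclideanSpace ℝ (Fin d))) =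
      ∫ x, g x ∂(stdGaussian (EuclideanSpace ℝ (Fin d))) := by
  conv_rhs => rw [← stdGaussian_map R]
  rw [integral_map (by fun_prop) hg.aestronglyMeasurable]

/-- The mean of the reward at a random perturbation of correlation `c`, times the correlation of
the perturbation. -/
noncomputable def tilt (F : ℝ → ℝ) (Λ : ℝ) (θ : EuclideanSpace ℝ (Fin d)) (c : ℝ) : ℝ :=
  ∫ x, F (c + inner ℝ θ (dirVec Λ x)) * inner ℝ θ (dirVec Λ x)
    ∂(stdGaussian (EuclideanSpace ℝ (Fin d)))

section tilt

variable {F : ℝ → ℝ} {Λ : ℝ} {θ : EuclideanSpace ℝ (Fin d)}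

lemma measurable_mul_inner_dirVec (hF : Measurable F) (c : ℝ) (D : EuclideanSpace ℝ (Fin d)) :
    Measurable fun x => F (c + inner ℝ θ (dirVec Λ x)) * inner ℝ D (dirVec Λ x) :=
  (hF.comp (measurable_const.add (measurable_const.inner (measurable_dirVec Λ)))).mul
    (measurable_const.inner (measurable_dirVec Λ))

lemma integrable_mul_inner_dirVec (hF : Measurable F) (hF1 : ∀ x, |F x| ≤ 1) (hΛ : 0 < Λ) (c : ℝ)
    (D : EuclideanSpace ℝ (Fin d)) :
    Integrable (fun x => F (c + inner ℝ θ (dirVec Λ x)) * inner ℝ D (dirVec Λ x))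
      (stdGaussian (EuclideanSpace ℝ (Fin d))) := by
  refine Integrable.of_bound (measurable_mul_inner_dirVec hF c D).aestronglyMeasurable ‖D‖
    (ae_of_all _ fun x => ?_)
  rw [norm_mul]
  calc _ ≤ 1 * (‖D‖ * 1) := by
        refine mul_le_mul (hF1 _) ((norm_inner_le_norm _ _).trans ?_) (norm_nonneg _) zero_le_one
        exact mul_le_mul_of_nonneg_left ((norm_dirVec_le hΛ x).trans (by norm_num)) (norm_nonneg _)
    _ = ‖D‖ := by ring

/-- By symmetry, the mean of the reward times the direction is parallel to the parameter. -/
lemma integral_mul_inner_dirVec (hF : Measurable F) (hF1 : ∀ x, |F x| ≤ 1) (hΛ : 0 < Λ)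
    (hθ : ‖θ‖ = 1) (c : ℝ) (D : EuclideanSpace ℝ (Fin d)) :
    ∫ x, F (c + inner ℝ θ (dirVec Λ x)) * inner ℝ D (dirVec Λ x)
      ∂(stdGaussian (EuclideanSpace ℝ (Fin d))) = tilt F Λ θ c * inner ℝ D θ := by
  -- The reflection in the line of `θ` preserves `⟨θ, ·⟩`, hence the reward, and reverses the
  -- orthogonal component, whose mean contribution must therefore vanish.
  let R := (ℝ ∙ θ).reflection
  have hR : ∀ v, R v = (2 * inner ℝ θ v) • θ - v := fun v => by
    rw [Submodule.reflection_apply, Submodule.starProjection_unit_singleton ℝ hθ, two_smul,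
      ← add_smul, two_mul]
  have h1 := integral_comp_isometry_stdGaussian R (measurable_mul_inner_dirVec (θ := θ) (Λ := Λ)
    hF c D)
  have h2 : ∀ x, F (c + inner ℝ θ (dirVec Λ (R x))) * inner ℝ D (dirVec Λ (R x)) =
      2 * inner ℝ D θ * (F (c + inner ℝ θ (dirVec Λ x)) * inner ℝ θ (dirVec Λ x)) -
        F (c + inner ℝ θ (dirVec Λ x)) * inner ℝ D (dirVec Λ x) := fun x => by
    rw [dirVec_isometry, hR]
    have h3 : inner ℝ θ ((2 * inner ℝ θ (dirVec Λ x)) • θ - dirVec Λ x) =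
        inner ℝ θ (dirVec Λ x) := by
      rw [inner_sub_right, real_inner_smul_right, real_inner_self_eq_norm_sq, hθ]
      ring
    rw [h3, inner_sub_right, real_inner_smul_right]
    ring
  simp_rw [h2] at h1
  rw [integral_sub ((integrable_mul_inner_dirVec hF hF1 hΛ c θ).const_mul _)
    (integrable_mul_inner_dirVec hF hF1 hΛ c D), integral_const_mul] at h1
  rw [tilt]
  linarith

lemma tilt_neg_arg (hF : Measurable F) (c : ℝ) :
    tilt F Λ θ c = -∫ x, F (c - inner ℝ θ (dirVec Λ x)) * inner ℝ θ (dirVec Λ x)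
      ∂(stdGaussian (EuclideanSpace ℝ (Fin d))) := by
  have h1 := integral_comp_isometry_stdGaussian (LinearIsometryEquiv.neg ℝ)
    (measurable_mul_inner_dirVec (θ := θ) (Λ := Λ) hF c θ)
  rw [tilt, ← h1, ← integral_neg]
  refine integral_congr_ae (ae_of_all _ fun x => ?_)
  have hn : dirVec Λ (-x) = -dirVec Λ x := dirVec_isometry Λ (LinearIsometryEquiv.neg ℝ) x
  simp only [LinearIsometryEquiv.coe_neg, hn, inner_neg_right]
  ring_nf

/-- The symmetrized form of the mean. -/
lemma two_mul_tilt (hF : Measurable F) (hF1 : ∀ x, |F x| ≤ 1) (hΛ : 0 < Λ) (c : ℝ) :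
    2 * tilt F Λ θ c = ∫ x, (F (c + inner ℝ θ (dirVec Λ x)) - F (c - inner ℝ θ (dirVec Λ x))) *
      inner ℝ θ (dirVec Λ x) ∂(stdGaussian (EuclideanSpace ℝ (Fin d))) := by
  have h1 := tilt_neg_arg (Λ := Λ) (θ := θ) hF c
  have hi : Integrable (fun x => F (c - inner ℝ θ (dirVec Λ x)) * inner ℝ θ (dirVec Λ x))
      (stdGaussian (EuclideanSpace ℝ (Fin d))) := by
    have h := integrable_mul_inner_dirVec (θ := -θ) hF hF1 hΛ c θ
    simpa only [inner_neg_left, ← sub_eq_add_neg] using h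
  simp_rw [sub_mul]
  rw [integral_sub (integrable_mul_inner_dirVec hF hF1 hΛ c θ) hi, two_mul]
  nth_rewrite 2 [h1]
  rw [tilt, ← sub_eq_add_neg]

/-- For even `F` an action correlated with `-θ` yields a signal along `-θ`, so progress up to sign
is consistent from stage to stage. -/
lemma tilt_neg_of_even (hF : Measurable F) (he : ∀ x, F (-x) = F x) (c : ℝ) :
    tilt F Λ θ (-c) = -tilt F Λ θ c := by
  rw [tilt_neg_arg hF c, neg_neg, tilt]
  refine integral_congr_ae (ae_of_all _ fun x => ?_)
  simp only
  rw [← he (c - _)]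
  ring_nf

/-- A lower bound on the mean from a lower bound on an event. -/
lemma mul_measureReal_le_tilt (hF : Measurable F) (hF1 : ∀ x, |F x| ≤ 1) (hΛ : 0 < Λ) (c : ℝ)
    (h0 : ∀ x, 0 ≤ (F (c + inner ℝ θ (dirVec Λ x)) - F (c - inner ℝ θ (dirVec Λ x))) *
      inner ℝ θ (dirVec Λ x)) {B : Set (EuclideanSpace ℝ (Fin d))} (hB : MeasurableSet B) {b : ℝ}
    (hb : ∀ x ∈ B, b ≤ (F (c + inner ℝ θ (dirVec Λ x)) - F (c - inner ℝ θ (dirVec Λ x))) *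
      inner ℝ θ (dirVec Λ x)) :
    b * (stdGaussian (EuclideanSpace ℝ (Fin d))).real B ≤ 2 * tilt F Λ θ c := by
  have hi : Integrable (fun x => (F (c + inner ℝ θ (dirVec Λ x)) -
      F (c - inner ℝ θ (dirVec Λ x))) * inner ℝ θ (dirVec Λ x))
      (stdGaussian (EuclideanSpace ℝ (Fin d))) := by
    have h := integrable_mul_inner_dirVec (θ := -θ) hF hF1 hΛ c θ
    simp only [inner_neg_left, ← sub_eq_add_neg] at h
    simp_rw [sub_mul]
    exact (integrable_mul_inner_dirVec hF hF1 hΛ c θ).sub h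
  rw [two_mul_tilt hF hF1 hΛ]
  calc b * (stdGaussian (EuclideanSpace ℝ (Fin d))).real B
      = ∫ _ in B, b ∂(stdGaussian (EuclideanSpace ℝ (Fin d))) := by
        rw [setIntegral_const, smul_eq_mul, mul_comm]
    _ ≤ ∫ x in B, (F (c + inner ℝ θ (dirVec Λ x)) - F (c - inner ℝ θ (dirVec Λ x))) *
          inner ℝ θ (dirVec Λ x) ∂(stdGaussian (EuclideanSpace ℝ (Fin d))) :=
        setIntegral_mono_on (integrable_const _).integrableOn hi.integrableOn hB hb
    _ ≤ _ := setIntegral_le_integral hi (ae_of_all _ h0)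

end tilt

end

/-! ### Upper bound: a large slope of the link function produces a large signal. -/

section

variable {d : ℕ}

/-! ### Lower bounds on the signal of a random perturbation -/

section slope

variable {f : ℝ → ℝ}

lemma LinkFunction.monotoneOn_Icc (hf : LinkFunction f) : MonotoneOn f (Icc 0 1) := by
  rcases hf.monotone with h | h
  · exact h.mono (Icc_subset_Icc (by norm_num) le_rfl)
  · exact h.2

lemma LinkFunction.deriv_nonneg (hf : LinkFunction f) {z : ℝ} (hz : 0 < z) (hz1 : z < 1) :
    0 ≤ deriv f z := by
  rw [← derivWithin_of_mem_nhds (Icc_mem_nhds hz hz1)]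
  exact hf.monotoneOn_Icc.derivWithin_nonneg

lemma LinkFunction.mul_sub_le (hf : LinkFunction f) {y m : ℝ} (hy : 0 < y) (hy1 : y ≤ 1 / 2)
    (hm : 0 < m) (hs : ∀ z ∈ Icc (y / 2) y, m ^ 2 ≤ deriv f z ^ 2) {a b : ℝ} (ha : y / 2 ≤ a)
    (hab : a ≤ b) (hb : b ≤ y) : m * (b - a) ≤ f b - f a := by
  have h1 : ∀ z ∈ Icc (y / 2) y, m ≤ deriv f z := fun z hz =>
    le_of_sq_le_sq (hs z hz) (hf.deriv_nonneg (by linarith [hz.1]) (by linarith [hz.2]))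
  -- `deriv` takes the value `0` at points of non-differentiability, so a positive lower bound on it
  -- carries differentiability along.
  have h2 : ∀ z ∈ Icc (y / 2) y, DifferentiableAt ℝ f z := fun z hz =>
    differentiableAt_of_deriv_ne_zero (hm.trans_le (h1 z hz)).ne'
  refine (convex_Icc (y / 2) y).mul_sub_le_image_sub_of_le_deriv
    (fun z hz => (h2 z hz).continuousAt.continuousWithinAt)
    (fun z hz => (h2 z (interior_subset hz)).differentiableWithinAt)
    (fun z hz => h1 z (interior_subset hz)) a ⟨ha, hab.trans hb⟩ b ⟨ha.trans hab, hb⟩ hab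

/-- In the even case it suffices that `|c - v| ≤ c + v` for `c, v ≥ 0`. Nonnegativity of the
symmetrized integrand allows the signal to be bounded below on any convenient event. -/
lemma LinkFunction.clipLink_sub_mul_nonneg (hf : LinkFunction f) {c : ℝ} (hc : 0 ≤ c) (v : ℝ) :
    0 ≤ (clipLink f (c + v) - clipLink f (c - v)) * v := by
  have key : ∀ v : ℝ, 0 ≤ v → clipLink f (c - v) ≤ clipLink f (c + v) := fun v hv => by
    rcases hf.monotone with h | h
    · exact clipLink_mono h (by linarith)
    · rw [← clipLink_abs_of_isEven h.1 (c - v)]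
      refine clipLink_monotoneOn hf (mem_Ici.2 (abs_nonneg _)) (mem_Ici.2 (by linarith)) ?_
      rw [abs_le]
      constructor <;> linarith
  rcases le_total 0 v with hv | hv
  · exact mul_nonneg (sub_nonneg.2 (key v hv)) hv
  · refine mul_nonneg_of_nonpos_of_nonpos ?_ hv
    have := key (-v) (by linarith)
    rw [sub_neg_eq_add, ← sub_eq_add_neg] at this
    linarith

end slope

lemma pos_of_one_le_mul {a x : ℝ} (ha : 0 ≤ a) (h : 1 ≤ a * x) : 0 < x :=
  pos_of_mul_pos_right (zero_lt_one.trans_le h) ha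

lemma one_sub_le_measureReal {α : Type*} [MeasurableSpace α] {μ : Measure α}
    [IsProbabilityMeasure μ] {B : Set α} (hB : MeasurableSet B) {p : ℝ} (hp : 0 ≤ p)
    (h : μ Bᶜ ≤ ENNReal.ofReal p) : 1 - p ≤ μ.real B := by
  have h1 := ENNReal.toReal_le_of_le_ofReal hp h
  have h2 := probReal_compl_eq_one_sub (μ := μ) hB
  rw [measureReal_def] at h2
  linarith

section tilt

variable {f : ℝ → ℝ} {Λ : ℝ} {θ : EuclideanSpace ℝ (Fin d)}

lemma tilt_nonneg (hf : LinkFunction f) (hΛ : 0 < Λ) {c : ℝ} (hc : 0 ≤ c) :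
    0 ≤ tilt (clipLink f) Λ θ c := by
  have h := mul_measureReal_le_tilt (θ := θ) (measurable_clipLink hf) (abs_clipLink_le_one hf) hΛ c
    (fun x => hf.clipLink_sub_mul_nonneg hc _) MeasurableSet.empty (b := 0) (by simp)
  linarith

lemma tilt_nonneg_of_monotoneOn (hf : LinkFunction f) (hm : MonotoneOn f (Icc (-1) 1))
    (hΛ : 0 < Λ) (c : ℝ) : 0 ≤ tilt (clipLink f) Λ θ c := by
  have h := mul_measureReal_le_tilt (θ := θ) (measurable_clipLink hf) (abs_clipLink_le_one hf) hΛ c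
    (fun x => by
      have h1 := clipLink_mono hm
      rcases le_total 0 (inner ℝ θ (dirVec Λ x)) with hv | hv
      · exact mul_nonneg (sub_nonneg.2 (h1 (by linarith))) hv
      · exact mul_nonneg_of_nonpos_of_nonpos (sub_nonpos.2 (h1 (by linarith))) hv)
    MeasurableSet.empty (b := 0) (by simp)
  linarith

/-- With constant probability the perturbation `v` along `θ` has size comparable to `1/√d` and at
most `y/8`. Then `c ± v` both lie in `[y/2, y]`, and the slope gives `(f(c + v) - f(c - v)) v ≥ 2 m
v²`. -/
lemma le_tilt_of_slope (hf : LinkFunction f) (hd : 0 < d) (hθ : ‖θ‖ = 1) {y m c : ℝ}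
    (hy : 1 ≤ 256 * Real.sqrt d * y) (hy1 : y ≤ 1 / 2) (hm : 0 < m)
    (hs : ∀ z ∈ Icc (y / 2) y, m ^ 2 ≤ deriv f z ^ 2) (hc : 5 / 8 * y ≤ c) (hc1 : c ≤ 7 / 8 * y) :
    m / (2 ^ 29 * d) ≤ tilt (clipLink f) (2 ^ 24) θ c := by
  have hd' : (0 : ℝ) < d := by exact_mod_cast hd
  have hsd : 0 < Real.sqrt d := Real.sqrt_pos.2 hd'
  have hy0 : 0 < y := pos_of_one_le_mul (by positivity) hy
  have hsq : Real.sqrt ((2 : ℝ) ^ 24 * d) = 4096 * Real.sqrt d := by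
    rw [Real.sqrt_mul (by positivity), show (2 : ℝ) ^ 24 = 4096 ^ 2 by norm_num,
      Real.sqrt_sq (by norm_num)]
  let B : Set (EuclideanSpace ℝ (Fin d)) :=
    {x | 1 / 2 ≤ |inner ℝ θ x| ∧ |inner ℝ θ x| ≤ 2 ∧ ‖x‖ ^ 2 ≤ 2 ^ 24 / 64 * d}
  have hB : MeasurableSet B := by
    have h1 : MeasurableSet {x : EuclideanSpace ℝ (Fin d) | 1 / 2 ≤ |inner ℝ θ x|} :=
      measurableSet_le (by fun_prop) (by fun_prop)
    have h2 : MeasurableSet {x : EuclideanSpace ℝ (Fin d) | |inner ℝ θ x| ≤ 2} :=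
      measurableSet_le (by fun_prop) (by fun_prop)
    have h3 : MeasurableSet {x : EuclideanSpace ℝ (Fin d) | ‖x‖ ^ 2 ≤ 2 ^ 24 / 64 * d} :=
      measurableSet_le (by fun_prop) (by fun_prop)
    exact h1.inter (h2.inter h3)
  have hBc : stdGaussian (EuclideanSpace ℝ (Fin d)) Bᶜ ≤ ENNReal.ofReal (7 / 8) := by
    calc _ ≤ stdGaussian (EuclideanSpace ℝ (Fin d)) ({x | |inner ℝ θ x| < 1 / 2} ∪
            ({x | 2 < |inner ℝ θ x|} ∪ {x | 2 ^ 24 / 64 * d < ‖x‖ ^ 2})) := by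
          refine measure_mono fun x hx => ?_
          simp only [B, mem_compl_iff, mem_ofPred_eq, not_and_or, not_le] at hx
          exact hx
      _ ≤ ENNReal.ofReal (1 / 2) + (ENNReal.ofReal (1 / 4) +
            ENNReal.ofReal ((2 ^ 24 / 64)⁻¹)) := by
          refine (measure_union_le _ _).trans (add_le_add (stdGaussian_abs_inner_lt_le hθ) ?_)
          exact (measure_union_le _ _).trans (add_le_add (stdGaussian_abs_inner_gt_le hθ)
            (stdGaussian_norm_sq_gt_le (by norm_num)))
      _ ≤ _ := by
          rw [← ENNReal.ofReal_add (by norm_num) (by norm_num),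
            ← ENNReal.ofReal_add (by norm_num) (by norm_num)]
          exact ENNReal.ofReal_le_ofReal (by norm_num)
  have hB8 := one_sub_le_measureReal hB (by norm_num) hBc
  have h := mul_measureReal_le_tilt (θ := θ) (Λ := 2 ^ 24) (measurable_clipLink hf)
    (abs_clipLink_le_one hf) (by norm_num) c
    (fun x => hf.clipLink_sub_mul_nonneg (by linarith) _) hB (b := m / (2 ^ 25 * d))
    (fun x hx => by
      obtain ⟨h1, h2, h3⟩ := hx
      rw [dirVec, if_pos h3, hsq, real_inner_smul_right]
      obtain ⟨g, hg⟩ : ∃ g : ℝ, g = inner ℝ θ x := ⟨_, rfl⟩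
      obtain ⟨v, hv⟩ : ∃ v : ℝ, v = (4096 * Real.sqrt d)⁻¹ * g := ⟨_, rfl⟩
      rw [← hg] at h1 h2 ⊢
      rw [← hv]
      -- From `|g| ≤ 2` and `√Λ = 4096`: `|v| ≤ 1/(2048 √d)`, while `y ≥ 1/(256 √d)`.
      have hv1 : |v| ≤ y / 8 := by
        rw [hv, abs_mul, abs_of_pos (by positivity), inv_mul_le_iff₀ (by positivity)]
        nlinarith
      have hv2 : 1 / (2 ^ 26 * d) ≤ v ^ 2 := by
        have e1 : v ^ 2 = (2 ^ 24 * (d : ℝ))⁻¹ * |g| ^ 2 := by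
          rw [hv, mul_pow, sq_abs, inv_pow, mul_pow, Real.sq_sqrt hd'.le]
          norm_num
        rw [e1, show (1 : ℝ) / (2 ^ 26 * d) = (2 ^ 24 * (d : ℝ))⁻¹ * (1 / 2) ^ 2 by field_simp]
        gcongr
      have key : ∀ w : ℝ, 0 ≤ w → w ≤ y / 8 →
          m * (2 * w) ≤ clipLink f (c + w) - clipLink f (c - w) := fun w hw0 hw => by
        rw [clipLink_eq f ⟨by linarith, by linarith⟩, clipLink_eq f ⟨by linarith, by linarith⟩]
        have := hf.mul_sub_le hy0 hy1 hm hs (a := c - w) (b := c + w) (by linarith) (by linarith)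
          (by linarith)
        linarith
      have h4 : m * (2 * v ^ 2) ≤ (clipLink f (c + v) - clipLink f (c - v)) * v := by
        rcases le_total 0 v with h0 | h0
        · rw [abs_of_nonneg h0] at hv1
          nlinarith [mul_le_mul_of_nonneg_right (key v h0 hv1) h0]
        · rw [abs_of_nonpos h0] at hv1
          have h5 := mul_le_mul_of_nonneg_right (key (-v) (by linarith) hv1)
            (by linarith : 0 ≤ -v)
          rw [sub_neg_eq_add, ← sub_eq_add_neg] at h5
          linarith
      refine le_trans ?_ h4
      calc m / (2 ^ 25 * d) = m * (2 * (1 / (2 ^ 26 * d))) := by field_simp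
        _ ≤ _ := by gcongr)
  have hpos : 0 ≤ m / (2 ^ 25 * d) := by positivity
  -- The factor `2⁻⁴` collects the probability `1/8` of the event and the `2` from symmetrization.
  have e : m / (2 ^ 29 * d) = m / (2 ^ 25 * d) * (1 / 8) / 2 := by field_simp; norm_num
  rw [e]
  nlinarith [mul_le_mul_of_nonneg_left hB8 hpos]

/-- Without any prior correlation, the perturbation itself exceeds `y` with constant probability,
because `y` is at most `1/(128 √d)`. Monotonicity then gives `f(v) - f(-v) ≥ f(y) ≥ m y/2` for `v ≥
y`. For even `f` this difference would be zero. -/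
lemma le_tilt_zero_of_slope (hf : LinkFunction f) (hmono : MonotoneOn f (Icc (-1) 1))
    (hd : 0 < d) (hθ : ‖θ‖ = 1) {y m : ℝ} (hy : 1 ≤ 256 * Real.sqrt d * y)
    (hy2 : 128 * Real.sqrt d * y ≤ 1) (hy1 : y ≤ 1 / 2) (hm : 0 < m)
    (hs : ∀ z ∈ Icc (y / 2) y, m ^ 2 ≤ deriv f z ^ 2) :
    m / (2 ^ 29 * d) ≤ tilt (clipLink f) 256 θ 0 := by
  have hd' : (0 : ℝ) < d := by exact_mod_cast hd
  have hsd : 0 < Real.sqrt d := Real.sqrt_pos.2 hd'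
  have hy0 : 0 < y := pos_of_one_le_mul (by positivity) hy
  have hsq : Real.sqrt ((256 : ℝ) * d) = 16 * Real.sqrt d := by
    rw [Real.sqrt_mul (by positivity), show (256 : ℝ) = 16 ^ 2 by norm_num,
      Real.sqrt_sq (by norm_num)]
  let B : Set (EuclideanSpace ℝ (Fin d)) := {x | 1 / 8 ≤ |inner ℝ θ x| ∧ ‖x‖ ^ 2 ≤ 256 / 64 * d}
  have hB : MeasurableSet B := by
    have h1 : MeasurableSet {x : EuclideanSpace ℝ (Fin d) | 1 / 8 ≤ |inner ℝ θ x|} :=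
      measurableSet_le (by fun_prop) (by fun_prop)
    have h3 : MeasurableSet {x : EuclideanSpace ℝ (Fin d) | ‖x‖ ^ 2 ≤ 256 / 64 * d} :=
      measurableSet_le (by fun_prop) (by fun_prop)
    exact h1.inter h3
  have hBc : stdGaussian (EuclideanSpace ℝ (Fin d)) Bᶜ ≤ ENNReal.ofReal (1 / 2) := by
    calc _ ≤ stdGaussian (EuclideanSpace ℝ (Fin d)) ({x | |inner ℝ θ x| < 1 / 8} ∪
            {x | 256 / 64 * d < ‖x‖ ^ 2}) := by
          refine measure_mono fun x hx => ?_
          simp only [B, mem_compl_iff, mem_ofPred_eq, not_and_or, not_le] at hx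
          exact hx
      _ ≤ ENNReal.ofReal (1 / 8) + ENNReal.ofReal ((256 / 64)⁻¹) := by
          exact (measure_union_le _ _).trans (add_le_add (stdGaussian_abs_inner_lt_le hθ)
            (stdGaussian_norm_sq_gt_le (by norm_num)))
      _ ≤ _ := by
          rw [← ENNReal.ofReal_add (by norm_num) (by norm_num)]
          exact ENNReal.ofReal_le_ofReal (by norm_num)
  have hB8 := one_sub_le_measureReal hB (by norm_num) hBc
  have hF := clipLink_mono hmono
  have hFy : m * y / 2 ≤ clipLink f y := by
    have h1 := hf.mul_sub_le hy0 hy1 hm hs le_rfl (by linarith : y / 2 ≤ y) le_rfl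
    have h2 : 0 ≤ clipLink f (y / 2) := clipLink_nonneg hf (by linarith)
    rw [clipLink_eq f ⟨by linarith, by linarith⟩] at h2
    rw [clipLink_eq f ⟨by linarith, by linarith⟩]
    linarith
  have h := mul_measureReal_le_tilt (θ := θ) (Λ := 256) (measurable_clipLink hf)
    (abs_clipLink_le_one hf) (by norm_num) 0
    (fun x => hf.clipLink_sub_mul_nonneg le_rfl _) hB (b := m * y / 2 * y)
    (fun x hx => by
      obtain ⟨h1, h3⟩ := hx
      rw [dirVec, if_pos h3, hsq, real_inner_smul_right]
      obtain ⟨g, hg⟩ : ∃ g : ℝ, g = inner ℝ θ x := ⟨_, rfl⟩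
      obtain ⟨v, hv⟩ : ∃ v : ℝ, v = (16 * Real.sqrt d)⁻¹ * g := ⟨_, rfl⟩
      rw [← hg] at h1 ⊢
      rw [← hv, zero_add, zero_sub]
      have hv1 : y ≤ |v| := by
        rw [hv, abs_mul, abs_of_pos (by positivity), le_inv_mul_iff₀ (by positivity)]
        linarith
      have hz : clipLink f 0 = 0 := clipLink_zero hf
      have key : ∀ w : ℝ, y ≤ w → m * y / 2 ≤ clipLink f w - clipLink f (-w) := fun w hw => by
        have h4 := hF hw
        have h5 := hF (by linarith : -w ≤ 0)
        linarith
      rcases le_total 0 v with h0 | h0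
      · rw [abs_of_nonneg h0] at hv1
        exact mul_le_mul (key v hv1) hv1 hy0.le (le_trans (by positivity) (key v hv1))
      · rw [abs_of_nonpos h0] at hv1
        have h5 := mul_le_mul (key (-v) hv1) hv1 hy0.le (le_trans (by positivity) (key _ hv1))
        rw [neg_neg] at h5
        linarith)
  have hpos : 0 ≤ m * y / 2 * y := by positivity
  -- Here `y² ≥ 1/(2¹⁶ d)`, so the signal has the same order `m/d` as at positive correlation.
  have h6 : m / (2 ^ 29 * d) ≤ m * y / 2 * y * (1 / 4) := by
    rw [div_le_iff₀ (by positivity)]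
    have h7 : 1 ≤ (256 * Real.sqrt d * y) ^ 2 := one_le_pow₀ hy
    rw [mul_pow, mul_pow, Real.sq_sqrt hd'.le] at h7
    nlinarith
  nlinarith [mul_le_mul_of_nonneg_left hB8 hpos]

end tilt

end

/-! ### Upper bound: the grid of scales, for an action whose correlation is known only from below.
-/

section

variable {d : ℕ}

/-! ### Rescaling at random and perturbing an action -/

/-- The uniform distribution on `Fin (N + 1)`. -/
noncomputable def uniformFin (N : ℕ) : Measure (Fin (N + 1)) :=
  ((N + 1 : ℕ) : ℝ≥0∞)⁻¹ • Measure.count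

instance (N : ℕ) : IsProbabilityMeasure (uniformFin N) := by
  refine ⟨?_⟩
  rw [uniformFin, Measure.smul_apply, smul_eq_mul, Measure.count_univ]
  simp only [ENat.card_eq_coe_fintype_card, Fintype.card_fin, ENat.toENNReal_coe]
  exact ENNReal.inv_mul_cancel (by simp) (by simp)

lemma integral_uniformFin {N : ℕ} (g : Fin (N + 1) → ℝ) :
    ∫ i, g i ∂(uniformFin N) = ((N : ℝ) + 1)⁻¹ * ∑ i, g i := by
  rw [uniformFin, integral_smul_measure, integral_count]
  simp [ENNReal.toReal_inv, ENNReal.toReal_add]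

/-- The law of a random scale and of a Gaussian vector. -/
noncomputable def gridLaw (d N : ℕ) : Measure (Fin (N + 1) × EuclideanSpace ℝ (Fin d)) :=
  (uniformFin N).prod (stdGaussian (EuclideanSpace ℝ (Fin d)))

instance (d N : ℕ) : IsProbabilityMeasure (gridLaw d N) := by
  unfold gridLaw; infer_instance

/-- The factors by which an action is scaled down. -/
noncomputable def scale (i : ℕ) : ℝ := 7 / 8 * (3 / 4) ^ i

lemma scale_pos (i : ℕ) : 0 < scale i := by unfold scale; positivity

lemma scale_le (i : ℕ) : scale i ≤ 7 / 8 := by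
  have h : ((3 : ℝ) / 4) ^ i ≤ 1 := pow_le_one₀ (by norm_num) (by norm_num)
  unfold scale
  linarith

/-- The budget is `7/8` for the scaled action and `1/8` for the perturbation. -/
lemma norm_scale_smul_add_le {Λ : ℝ} (hΛ : 0 < Λ) (i : ℕ) (a : Ball d)
    (x : EuclideanSpace ℝ (Fin d)) : ‖scale i • a.1 + dirVec Λ x‖ ≤ 1 := by
  have h1 : ‖a.1‖ ≤ 1 := mem_closedBall_zero_iff.1 a.2
  refine (norm_add_le _ _).trans ?_
  rw [norm_smul, Real.norm_eq_abs, abs_of_pos (scale_pos i)]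
  have h2 := norm_dirVec_le hΛ x
  nlinarith [scale_le i, scale_pos i, norm_nonneg a.1]

/-- An action is scaled down and perturbed. -/
noncomputable def gridAct (N : ℕ) {Λ : ℝ} (hΛ : 0 < Λ)
    (p : Ball d × (Fin (N + 1) × EuclideanSpace ℝ (Fin d))) : Ball d :=
  ⟨scale p.2.1 • p.1.1 + dirVec Λ p.2.2, by
    rw [mem_closedBall_zero_iff]; exact norm_scale_smul_add_le hΛ _ _ _⟩

lemma measurable_gridAct (N : ℕ) {Λ : ℝ} (hΛ : 0 < Λ) : Measurable (gridAct (d := d) N hΛ) := by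
  have h1 : Measurable fun p : Ball d × (Fin (N + 1) × EuclideanSpace ℝ (Fin d)) =>
      scale p.2.1 := (measurable_of_finite fun i : Fin (N + 1) => scale i).comp
        (measurable_fst.comp measurable_snd)
  exact ((h1.smul measurable_fst.subtype_val).add
    ((measurable_dirVec Λ).comp (measurable_snd.comp measurable_snd))).subtype_mk

/-- The signal at correlation `ρ`. -/
noncomputable def gridSignal (F : ℝ → ℝ) (N : ℕ) (Λ : ℝ) (θ : EuclideanSpace ℝ (Fin d)) (ρ : ℝ) :
    ℝ := ((N : ℝ) + 1)⁻¹ * ∑ i : Fin (N + 1), tilt F Λ θ (scale i * ρ)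

section design

variable {F : ℝ → ℝ} {Λ : ℝ}

lemma integral_gridLaw_mul_inner (hF : Measurable F) (hF1 : ∀ x, |F x| ≤ 1) (N : ℕ) (hΛ : 0 < Λ)
    (θ : Sphere d) (a : Ball d) (D : EuclideanSpace ℝ (Fin d)) :
    ∫ ω, F (inner ℝ θ.1 (gridAct N hΛ (a, ω)).1) * inner ℝ D (dirVec Λ ω.2) ∂(gridLaw d N) =
      gridSignal F N Λ θ.1 (inner ℝ θ.1 a.1) * inner ℝ D θ.1 := by
  have hu : Measurable fun ω : Fin (N + 1) × EuclideanSpace ℝ (Fin d) =>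
      inner ℝ D (dirVec Λ ω.2) :=
    measurable_const.inner ((measurable_dirVec Λ).comp measurable_snd)
  have hm : Measurable fun ω : Fin (N + 1) × EuclideanSpace ℝ (Fin d) =>
      F (inner ℝ θ.1 (gridAct N hΛ (a, ω)).1) * inner ℝ D (dirVec Λ ω.2) :=
    (hF.comp (measurable_const.inner ((measurable_gridAct N hΛ).comp
      measurable_prodMk_left).subtype_val)).mul hu
  have hi : Integrable (fun ω : Fin (N + 1) × EuclideanSpace ℝ (Fin d) =>
      F (inner ℝ θ.1 (gridAct N hΛ (a, ω)).1) * inner ℝ D (dirVec Λ ω.2))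
      ((uniformFin N).prod (stdGaussian (EuclideanSpace ℝ (Fin d)))) := by
    refine Integrable.of_bound hm.aestronglyMeasurable ‖D‖ (ae_of_all _ fun ω => ?_)
    rw [norm_mul]
    calc _ ≤ 1 * (‖D‖ * 1) := by
          refine mul_le_mul (hF1 _) ((norm_inner_le_norm _ _).trans ?_) (norm_nonneg _) zero_le_one
          exact mul_le_mul_of_nonneg_left ((norm_dirVec_le hΛ _).trans (by norm_num))
            (norm_nonneg _)
      _ = ‖D‖ := by ring
  rw [gridLaw, integral_prod _ hi, integral_uniformFin, gridSignal, mul_assoc, Finset.sum_mul]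
  congr 1
  refine Finset.sum_congr rfl fun i _ => ?_
  rw [← integral_mul_inner_dirVec hF hF1 hΛ (norm_eq_of_mem_sphere θ)]
  refine integral_congr_ae (ae_of_all _ fun x => ?_)
  simp only [gridAct, inner_add_right, real_inner_smul_right]

lemma signal_grid (hF : Measurable F) (hF1 : ∀ x, |F x| ≤ 1) (N : ℕ) (hΛ : 0 < Λ) (θ : Sphere d)
    (a : Ball d) :
    signal F (gridLaw d N) (gridAct N hΛ) (fun ω => dirVec Λ ω.2) θ a =
      gridSignal F N Λ θ.1 (inner ℝ θ.1 a.1) := by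
  rw [signal, integral_gridLaw_mul_inner hF hF1, real_inner_self_eq_norm_sq,
    norm_eq_of_mem_sphere θ]
  ring

lemma integral_gridLaw_norm_sq_le (N : ℕ) (hΛ : 0 < Λ) :
    ∫ ω, ‖dirVec Λ ω.2‖ ^ 2 ∂(gridLaw d N) ≤ Λ⁻¹ := by
  have h := integral_fun_snd (μ := uniformFin N) (ν := stdGaussian (EuclideanSpace ℝ (Fin d)))
    (f := fun x => ‖dirVec Λ x‖ ^ 2)
  rw [gridLaw, h, probReal_univ, one_smul]
  exact integral_norm_dirVec_sq_le hΛ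

lemma integral_gridLaw_inner_sq_le (N : ℕ) (hΛ : 0 < Λ) (θ : Sphere d) :
    ∫ ω, inner ℝ θ.1 (dirVec Λ ω.2) ^ 2 ∂(gridLaw d N) ≤ (Λ * d)⁻¹ := by
  have h := integral_fun_snd (μ := uniformFin N) (ν := stdGaussian (EuclideanSpace ℝ (Fin d)))
    (f := fun x => inner ℝ θ.1 (dirVec Λ x) ^ 2)
  rw [gridLaw, h, probReal_univ, one_smul]
  exact integral_inner_dirVec_sq_le hΛ (norm_eq_of_mem_sphere θ)

end design

section correlation

variable {f : ℝ → ℝ}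

lemma correlation_of_monotoneOn (hf : LinkFunction f) (hm : MonotoneOn f (Icc (-1) 1)) (x : ℝ) :
    correlation f x = x := by
  rw [correlation, if_neg (not_isEven_of_monotoneOn hf hm)]

lemma correlation_of_isEven (he : IsEven f) (x : ℝ) : correlation f x = |x| := by
  rw [correlation, if_pos he]

lemma measurable_correlation : Measurable (correlation f) := by
  unfold correlation
  split_ifs
  exacts [measurable_norm, measurable_id]

lemma abs_eq_of_correlation_nonneg {x : ℝ} (h : 0 ≤ correlation f x) : |x| = correlation f x := by
  unfold correlation at *
  split_ifs at *
  · rfl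
  · exact abs_of_nonneg h

lemma correlation_sub_abs_le (x y : ℝ) : correlation f x - |y| ≤ correlation f (x + y) := by
  unfold correlation
  split_ifs
  · have h := abs_sub_abs_le_abs_sub x (-y)
    rw [sub_neg_eq_add, abs_neg] at h
    exact h
  · linarith [neg_abs_le y]

lemma correlation_mul_of_nonneg {k : ℝ} (hk : 0 ≤ k) (x : ℝ) :
    correlation f (k * x) = k * correlation f x := by
  unfold correlation
  split_ifs
  · rw [abs_mul, abs_of_nonneg hk]
  · rfl

lemma correlation_le_one {x : ℝ} (hx : |x| ≤ 1) : correlation f x ≤ 1 :=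
  (correlation_le_abs f x).trans hx

variable {Λ : ℝ} {θ : EuclideanSpace ℝ (Fin d)}

lemma gridSignal_nonneg (hf : LinkFunction f) (N : ℕ) (hΛ : 0 < Λ) {ρ : ℝ} (hρ : 0 ≤ ρ) :
    0 ≤ gridSignal (clipLink f) N Λ θ ρ :=
  mul_nonneg (by positivity) (Finset.sum_nonneg fun i _ =>
    tilt_nonneg hf hΛ (mul_nonneg (scale_pos i).le hρ))

lemma gridSignal_neg (hf : LinkFunction f) (he : IsEven f) (N : ℕ) (ρ : ℝ) :
    gridSignal (clipLink f) N Λ θ (-ρ) = -gridSignal (clipLink f) N Λ θ ρ := by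
  simp only [gridSignal, mul_neg]
  simp_rw [tilt_neg_of_even (measurable_clipLink hf) (clipLink_neg_of_isEven he)]
  rw [Finset.sum_neg_distrib, mul_neg]

lemma correlation_gridSignal_of_isEven (hf : LinkFunction f) (he : IsEven f) (N : ℕ) (hΛ : 0 < Λ)
    (ρ : ℝ) :
    correlation f (gridSignal (clipLink f) N Λ θ ρ) = gridSignal (clipLink f) N Λ θ |ρ| := by
  rw [correlation_of_isEven he]
  rcases abs_choice ρ with h | h
  · rw [← abs_of_nonneg (gridSignal_nonneg (θ := θ) hf N hΛ (abs_nonneg ρ)), h]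
  · rw [← abs_of_nonneg (gridSignal_nonneg (θ := θ) hf N hΛ (abs_nonneg ρ)), h,
      gridSignal_neg hf he, abs_neg]

/-- This holds for every action, also after a failed stage: the signal never points away from the
parameter, so a failure costs only noise. -/
lemma correlation_gridSignal_nonneg (hf : LinkFunction f) (N : ℕ) (hΛ : 0 < Λ) (ρ : ℝ) :
    0 ≤ correlation f (gridSignal (clipLink f) N Λ θ ρ) := by
  rcases hf.monotone with h | h
  · rw [correlation_of_monotoneOn hf h]
    exact mul_nonneg (by positivity) (Finset.sum_nonneg fun i _ =>
      tilt_nonneg_of_monotoneOn hf h hΛ _)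
  · rw [correlation_gridSignal_of_isEven hf h.1 N hΛ]
    exact gridSignal_nonneg hf N hΛ (abs_nonneg _)

/-- Some scaled-down version of the action has a prescribed correlation, up to a constant. -/
lemma exists_scale_mem {ℓ : ℕ} (hℓ : d ≤ 2 ^ ℓ) (hd : 0 < d) {y ρ : ℝ}
    (hy : 1 ≤ 256 * Real.sqrt d * y) (hyρ : y ≤ ρ) (hρ : ρ ≤ 1) :
    ∃ i : Fin (24 + 3 * ℓ + 1), 5 / 8 * y ≤ scale i * ρ ∧ scale i * ρ ≤ 7 / 8 * y := by
  have hd' : (1 : ℝ) ≤ d := by exact_mod_cast hd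
  have hsd : 0 < Real.sqrt d := Real.sqrt_pos.2 (by linarith)
  have hy0 : 0 < y := pos_of_one_le_mul (by positivity) hy
  -- `(3/4)³ ≤ 1/2`, so `24 + 3ℓ` steps shrink `ρ ≤ 1` to at most `2^(-8-ℓ) ≤ 1/(256 √d) ≤ y`.
  have hex : (3 / 4 : ℝ) ^ (24 + 3 * ℓ) * ρ ≤ y := by
    have h1 : (3 / 4 : ℝ) ^ (24 + 3 * ℓ) ≤ (1 / 2) ^ (8 + ℓ) := by
      rw [show 24 + 3 * ℓ = 3 * (8 + ℓ) by ring, pow_mul]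
      exact pow_le_pow_left₀ (by positivity) (by norm_num) _
    have h2 : Real.sqrt d ≤ 2 ^ ℓ := by
      have : (d : ℝ) ≤ 2 ^ ℓ := by exact_mod_cast hℓ
      exact (Real.sqrt_le_left (by linarith)).2 (by nlinarith) |>.trans this
    have h3 : (1 / 2 : ℝ) ^ (8 + ℓ) * (256 * Real.sqrt d) ≤ 1 := by
      rw [pow_add, one_div, inv_pow, inv_pow]
      have : (2 ^ ℓ : ℝ)⁻¹ * Real.sqrt d ≤ 1 := by
        rw [inv_mul_le_iff₀ (by positivity), mul_one]; exact h2
      linarith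
    calc _ ≤ (1 / 2 : ℝ) ^ (8 + ℓ) * 1 := mul_le_mul h1 hρ (hy0.le.trans hyρ) (by positivity)
      _ ≤ (1 / 2 : ℝ) ^ (8 + ℓ) * (256 * Real.sqrt d * y) := by gcongr
      _ = (1 / 2 : ℝ) ^ (8 + ℓ) * (256 * Real.sqrt d) * y := by ring
      _ ≤ 1 * y := by gcongr
      _ = y := one_mul y
  classical
  have hex' : ∃ i : ℕ, (3 / 4 : ℝ) ^ i * ρ ≤ y := ⟨_, hex⟩
  have hfind := Nat.find_spec hex'
  have hle := Nat.find_min' hex' hex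
  have hmin := fun i => Nat.find_min (m := i) hex'
  generalize Nat.find hex' = i at hfind hle hmin
  refine ⟨⟨i, by omega⟩, ?_, ?_⟩
  · rcases Nat.eq_zero_or_pos i with h0 | h0
    · subst h0
      simp only [scale, pow_zero]
      linarith
    -- At the first index that reaches `y` the previous value was above `y`, so the product is above
    -- `7/8 · 3/4 · y`, and `21/32 ≥ 5/8`.
    · have h1 := hmin (i - 1) (by omega)
      rw [not_le] at h1
      obtain ⟨j, rfl⟩ : ∃ j, i = j + 1 := ⟨i - 1, by omega⟩
      simp only [Nat.add_sub_cancel] at h1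
      simp only [scale, pow_succ]
      linarith
  · simp only [scale]
    linarith

/-- One grid point is well placed and all others contribute nonnegatively, so not knowing `ρ` costs
only the number of grid points, of order `log d`. -/
lemma le_gridSignal {ℓ : ℕ} (hℓ : d ≤ 2 ^ ℓ) (hf : LinkFunction f) (hd : 0 < d) (hθ : ‖θ‖ = 1)
    {y m ρ : ℝ} (hy : 1 ≤ 256 * Real.sqrt d * y) (hy1 : y ≤ 1 / 2) (hm : 0 < m)
    (hs : ∀ z ∈ Icc (y / 2) y, m ^ 2 ≤ deriv f z ^ 2) (hyρ : y ≤ ρ) (hρ : ρ ≤ 1) (hρ0 : 0 ≤ ρ) :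
    (((24 + 3 * ℓ : ℕ) : ℝ) + 1)⁻¹ * (m / (2 ^ 29 * d)) ≤
      gridSignal (clipLink f) (24 + 3 * ℓ) (2 ^ 24) θ ρ := by
  obtain ⟨i, h1, h2⟩ := exists_scale_mem hℓ hd hy hyρ hρ
  refine mul_le_mul_of_nonneg_left ?_ (by positivity)
  refine (le_tilt_of_slope hf hd hθ hy hy1 hm hs h1 h2).trans ?_
  exact Finset.single_le_sum (f := fun i : Fin (24 + 3 * ℓ + 1) =>
    tilt (clipLink f) (2 ^ 24) θ (scale i * ρ)) (fun j _ =>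
    tilt_nonneg hf (by norm_num) (mul_nonneg (scale_pos j).le hρ0)) (Finset.mem_univ i)

/-- The signal is large once the correlation of the action reaches the scale of a large slope. -/
lemma le_correlation_gridSignal {ℓ : ℕ} (hℓ : d ≤ 2 ^ ℓ) (hf : LinkFunction f) (hd : 0 < d)
    (hθ : ‖θ‖ = 1) {y m ρ : ℝ} (hy : 1 ≤ 256 * Real.sqrt d * y) (hy1 : y ≤ 1 / 2) (hm : 0 < m)
    (hs : ∀ z ∈ Icc (y / 2) y, m ^ 2 ≤ deriv f z ^ 2) (hyρ : y ≤ correlation f ρ)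
    (hρ : |ρ| ≤ 1) :
    (((24 + 3 * ℓ : ℕ) : ℝ) + 1)⁻¹ * (m / (2 ^ 29 * d)) ≤
      correlation f (gridSignal (clipLink f) (24 + 3 * ℓ) (2 ^ 24) θ ρ) := by
  have hy0 : 0 ≤ y := (pos_of_one_le_mul (by positivity) hy).le
  rcases hf.monotone with h | h
  · rw [correlation_of_monotoneOn hf h] at hyρ ⊢
    exact le_gridSignal hℓ hf hd hθ hy hy1 hm hs hyρ ((le_abs_self ρ).trans hρ) (hy0.trans hyρ)
  · rw [correlation_of_isEven h.1] at hyρ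
    rw [correlation_gridSignal_of_isEven hf h.1 _ (by norm_num)]
    exact le_gridSignal hℓ hf hd hθ hy hy1 hm hs hyρ hρ (abs_nonneg _)

/-- At correlation zero all scales coincide and nothing is lost; the factor for the grid is kept so
that both ways of starting share one signal strength. -/
lemma le_correlation_gridSignal_zero (hf : LinkFunction f) (hmono : MonotoneOn f (Icc (-1) 1))
    (N : ℕ) (hd : 0 < d) (hθ : ‖θ‖ = 1) {y m : ℝ} (hy : 1 ≤ 256 * Real.sqrt d * y)
    (hy2 : 128 * Real.sqrt d * y ≤ 1) (hy1 : y ≤ 1 / 2) (hm : 0 < m)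
    (hs : ∀ z ∈ Icc (y / 2) y, m ^ 2 ≤ deriv f z ^ 2) :
    ((N : ℝ) + 1)⁻¹ * (m / (2 ^ 29 * d)) ≤
      correlation f (gridSignal (clipLink f) N 256 θ 0) := by
  rw [correlation_of_monotoneOn hf hmono, gridSignal]
  refine mul_le_mul_of_nonneg_left ?_ (by positivity)
  simp only [mul_zero, Finset.sum_const, Finset.card_univ, Fintype.card_fin, nsmul_eq_mul]
  have h := le_tilt_zero_of_slope hf hmono hd hθ hy hy2 hy1 hm hs
  have h0 : 0 ≤ m / (2 ^ 29 * d) := by positivity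
  push_cast
  nlinarith [(Nat.cast_nonneg N : (0 : ℝ) ≤ N)]

end correlation

end

/-! ### Upper bound: a single stage. -/

section

variable {d T : ℕ}

/-! ### Improving the correlation -/

lemma Realizable.map {F : ℝ → ℝ} {X Y : Type} [MeasurableSpace X] [MeasurableSpace Y]
    {m : Sphere d → Measure X} (h : Realizable F d T m) (hF : Measurable F) {U : X → Y}
    (hU : Measurable U) : Realizable F d T fun θ => (m θ).map U := by
  obtain ⟨L, out, ho, hm⟩ := h
  refine ⟨L, fun p => U (out p), hU.comp ho, fun θ => ?_⟩
  beta_reduce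
  rw [hm]
  exact Measure.map_map hU (ho.comp (measurable_fst.prodMk (L.measurable_history hF θ T)))

lemma measure_lt_le_of_lintegral_le {α : Type*} [MeasurableSpace α] {μ : Measure α} {g : α → ℝ}
    (hg : Measurable g) {c C : ℝ} (hc : 0 < c)
    (h : ∫⁻ x, ENNReal.ofReal (g x) ∂μ ≤ ENNReal.ofReal C) :
    μ {x | c < g x} ≤ ENNReal.ofReal (C / c) := by
  rw [ENNReal.ofReal_div_of_pos hc, ENNReal.le_div_iff_mul_le (Or.inl (by simpa using hc))
    (Or.inl (by simp)), mul_comm]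
  refine le_trans ?_ ((mul_meas_ge_le_lintegral₀ hg.ennreal_ofReal.aemeasurable
    (ENNReal.ofReal c)).trans h)
  refine mul_le_mul_right (measure_mono fun x hx => ?_) _
  exact ENNReal.ofReal_le_ofReal (le_of_lt hx)

/-- The direction of a vector, damped if the vector is short. -/
noncomputable def damp {b : ℝ} (hb : 0 < b) (W : EuclideanSpace ℝ (Fin d)) : Ball d :=
  ⟨(max ‖W‖ b)⁻¹ • W, by
    rw [mem_closedBall_zero_iff, norm_smul, norm_inv, Real.norm_eq_abs,
      abs_of_pos (lt_max_of_lt_right hb), inv_mul_le_iff₀ (lt_max_of_lt_right hb), mul_one]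
    exact le_max_left _ _⟩

lemma measurable_damp {b : ℝ} (hb : 0 < b) : Measurable (damp (d := d) hb) := by
  unfold damp
  exact Measurable.subtype_mk (by fun_prop)

section pointwise

variable {f : ℝ → ℝ} {θ : Sphere d} {W : EuclideanSpace ℝ (Fin d)} {b s : ℝ} {n : ℕ}

/-- The inner product `⟨θ, W⟩` is the signal `n s` plus noise, and `correlation` is 1-Lipschitz and
positively homogeneous. -/
lemma le_correlation_damp (hb : 0 < b) (s : ℝ) (n : ℕ) (θ : Sphere d)
    (W : EuclideanSpace ℝ (Fin d)) :
    (max ‖W‖ b)⁻¹ * (n * correlation f s - |inner ℝ θ.1 W - n * s|) ≤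
      correlation f (inner ℝ θ.1 (damp hb W).1) := by
  have hpos : 0 < max ‖W‖ b := lt_max_of_lt_right hb
  simp only [damp]
  rw [real_inner_smul_right, correlation_mul_of_nonneg (inv_nonneg.2 hpos.le),
    ← correlation_mul_of_nonneg (Nat.cast_nonneg n)]
  refine mul_le_mul_of_nonneg_left ?_ (inv_nonneg.2 hpos.le)
  have h := correlation_sub_abs_le (f := f) (n * s) (inner ℝ θ.1 W - n * s)
  rwa [add_sub_cancel] at h

/-- This is the purpose of damping: with the nonnegative signal dropped, the noise is divided by at
least `b`, even when `W` is short. -/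
lemma neg_abs_div_le_correlation_damp (hb : 0 < b) (hs : 0 ≤ correlation f s) :
    -(|inner ℝ θ.1 W - n * s| / b) ≤ correlation f (inner ℝ θ.1 (damp hb W).1) := by
  refine le_trans ?_ (le_correlation_damp hb s n θ W)
  have hpos : 0 < max ‖W‖ b := lt_max_of_lt_right hb
  have h1 : (max ‖W‖ b)⁻¹ * |inner ℝ θ.1 W - n * s| ≤ |inner ℝ θ.1 W - n * s| / b := by
    rw [div_eq_inv_mul]
    exact mul_le_mul_of_nonneg_right (inv_anti₀ hb (le_max_right _ _)) (abs_nonneg _)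
  have h2 : 0 ≤ (max ‖W‖ b)⁻¹ * (n * correlation f s) := by positivity
  rw [mul_sub]
  linarith

/-- The norm of `W` is at most `n |s| + b`. As `X ≤ 1/2`, the required value is at most `(3/4) n |s|
+ (3/2) X b`, where `(3/2) X b ≤ (3/20) n q`; the noise takes another `n q / 10`, and `3/4 + 3/20 +
1/10 = 1`. -/
lemma le_correlation_damp_of_le (hb : 0 < b) {q X : ℝ} (hX : 0 ≤ X) (hX1 : X ≤ 1 / 2)
    (hq : 0 ≤ q) (hs : q ≤ correlation f s) (hnq : 10 * X * b ≤ n * q)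
    (h1 : ‖W - (n * s) • θ.1‖ ≤ b) (h2 : |inner ℝ θ.1 W - n * s| ≤ n * q / 10) :
    3 / 2 * X ≤ correlation f (inner ℝ θ.1 (damp hb W).1) := by
  refine le_trans ?_ (le_correlation_damp hb s n θ W)
  have hpos : 0 < max ‖W‖ b := lt_max_of_lt_right hb
  rw [le_inv_mul_iff₀ hpos]
  have hn : (0 : ℝ) ≤ n := Nat.cast_nonneg n
  have h0 : 0 ≤ correlation f s := hq.trans hs
  have h3 : ‖W‖ ≤ n * correlation f s + b := by
    have h4 : ‖W‖ ≤ ‖W - (n * s) • θ.1‖ + ‖(n * s) • θ.1‖ := norm_le_norm_sub_add _ _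
    rw [norm_smul, norm_eq_of_mem_sphere θ, mul_one, Real.norm_eq_abs, abs_mul,
      abs_of_nonneg hn, abs_eq_of_correlation_nonneg h0] at h4
    linarith
  have h5 : max ‖W‖ b ≤ n * correlation f s + b :=
    max_le h3 (by nlinarith [mul_nonneg hn h0])
  have h6 : (n : ℝ) * q ≤ n * correlation f s := mul_le_mul_of_nonneg_left hs hn
  have h7 : max ‖W‖ b * (3 / 2 * X) ≤ (n * correlation f s + b) * (3 / 2 * X) := by gcongr
  nlinarith [mul_nonneg hn h0]

end pointwise

section stage

variable {f : ℝ → ℝ}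

/-- A number of rounds, after which the correlation is larger by the factor `3 / 2` on an event of
large probability, and nearly nonnegative in the mean otherwise. -/
lemma Realizable.stage (hf : LinkFunction f) (hd : 0 < d) {m : Sphere d → Measure (Ball d)}
    (hm : Realizable (clipLink f) d T m) (N : ℕ) {Λ : ℝ} (hΛ : 256 ≤ Λ)
    {A : Sphere d → Set (Ball d)} (hA : ∀ θ, MeasurableSet (A θ)) {p q δ X : ℝ} (hp : 0 ≤ p)
    (hpA : ∀ θ, m θ (A θ)ᶜ ≤ ENNReal.ofReal p)
    (hq : ∀ θ, ∀ a ∈ A θ, q ≤ correlation f (gridSignal (clipLink f) N Λ θ.1 (inner ℝ θ.1 a.1)))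
    (hq0 : 0 < q) (hδ : 0 < δ) (hδ1 : δ ≤ 1 / 2 ^ 20) (hX : 1 ≤ 256 * Real.sqrt d * X)
    (hX1 : X ≤ 1 / 2) {n : ℕ} (hn : 2 * X ^ 2 ≤ n * (δ * q ^ 2)) :
    ∃ m' : Sphere d → Measure (Ball d), Realizable (clipLink f) d (T + n) m' ∧ ∀ θ,
      m' θ {a | correlation f (inner ℝ θ.1 a.1) < 3 / 2 * X} ≤ ENNReal.ofReal (p + 2 ^ 16 * δ) ∧
      (p + 2 ^ 16 * δ ≤ 1 / 6 →
        ∫⁻ a, ENNReal.ofReal (1 - correlation f (inner ℝ θ.1 a.1)) ∂(m' θ) ≤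
          ENNReal.ofReal (1 - X)) := by
  have hd' : (0 : ℝ) < d := by exact_mod_cast hd
  have hX0 : 0 < X := pos_of_one_le_mul (by positivity) hX
  have hdX : 1 ≤ 2 ^ 16 * d * X ^ 2 := by
    have h7 : 1 ≤ (256 * Real.sqrt d * X) ^ 2 := one_le_pow₀ hX
    rw [mul_pow, mul_pow, Real.sq_sqrt hd'.le] at h7
    linarith
  have hn0 : (0 : ℝ) < n := by
    by_contra h
    have := mul_nonpos_of_nonpos_of_nonneg (not_lt.1 h) (by positivity : 0 ≤ δ * q ^ 2)
    nlinarith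
  have hΛ0 : 0 < Λ := by linarith
  have hF := measurable_clipLink hf
  have hF1 := abs_clipLink_le_one hf
  -- The total noise has second moment at most `n/128`, so by Markov's inequality it exceeds `b`
  -- with probability at most `δ`.
  obtain ⟨b, hbdef⟩ : ∃ b : ℝ, b = Real.sqrt (n / (128 * δ)) := ⟨_, rfl⟩
  have hb : 0 < b := by rw [hbdef]; positivity
  have hb2 : b ^ 2 = n / (128 * δ) := by rw [hbdef]; exact Real.sq_sqrt (by positivity)
  have hu : Measurable fun ω : Fin (N + 1) × EuclideanSpace ℝ (Fin d) => dirVec Λ ω.2 :=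
    (measurable_dirVec Λ).comp measurable_snd
  obtain ⟨m₁, hm₁, hprop⟩ := hm.accumulate hF hF1 (gridLaw d N) (measurable_gridAct N hΛ0) hu
    (fun ω => (norm_dirVec_le hΛ0 _).trans (by norm_num)) (fun θ a D => by
      rw [integral_gridLaw_mul_inner hF hF1, signal_grid hF hF1]) n
  have hW : Measurable fun z : Ball d × EuclideanSpace ℝ (Fin d) => damp hb z.2 :=
    (measurable_damp hb).comp measurable_snd
  refine ⟨_, hm₁.map hF hW, fun θ => ?_⟩
  have hprob := hm₁.isProbabilityMeasure hF θ
  obtain ⟨h₁, h₂, h₃⟩ := hprop θ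
  obtain ⟨s, hs⟩ : ∃ s : Ball d → ℝ, s = signal (clipLink f) (gridLaw d N) (gridAct N hΛ0)
    (fun ω => dirVec Λ ω.2) θ := ⟨_, rfl⟩
  have hsm : Measurable s := by
    rw [hs]; exact measurable_signal hF _ (measurable_gridAct N hΛ0) hu θ
  have hsg : ∀ a, s a = gridSignal (clipLink f) N Λ θ.1 (inner ℝ θ.1 a.1) := fun a => by
    rw [hs, signal_grid hF hF1]
  have hs0 : ∀ a, 0 ≤ correlation f (s a) := fun a => by
    rw [hsg]; exact correlation_gridSignal_nonneg hf N hΛ0 _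
  rw [← hs] at h₂ h₃
  have hΛi : Λ⁻¹ ≤ 256⁻¹ := inv_anti₀ (by norm_num) hΛ
  have h₂' : ∫⁻ z, ENNReal.ofReal (‖z.2 - (n * s z.1) • θ.1‖ ^ 2) ∂(m₁ θ) ≤
      ENNReal.ofReal (n / 128) := by
    refine h₂.trans ?_
    rw [← ENNReal.ofReal_natCast, ← ENNReal.ofReal_mul hn0.le]
    refine ENNReal.ofReal_le_ofReal ?_
    have := integral_gridLaw_norm_sq_le (d := d) N hΛ0
    nlinarith
  have h₃' : ∫⁻ z, ENNReal.ofReal ((inner ℝ θ.1 z.2 - n * s z.1) ^ 2) ∂(m₁ θ) ≤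
      ENNReal.ofReal (n / (128 * d)) := by
    refine h₃.trans ?_
    rw [← ENNReal.ofReal_natCast, ← ENNReal.ofReal_mul hn0.le]
    refine ENNReal.ofReal_le_ofReal ?_
    have h4 := integral_gridLaw_inner_sq_le (d := d) N hΛ0 θ
    have h5 : (Λ * d)⁻¹ ≤ (256 * d : ℝ)⁻¹ := inv_anti₀ (by positivity) (by gcongr)
    have h6 : (n : ℝ) / (128 * d) = n * (2 * (256 * d : ℝ)⁻¹) := by field_simp; norm_num
    rw [h6]
    gcongr
    exact h4.trans h5
  have hξm : Measurable fun z : Ball d × EuclideanSpace ℝ (Fin d) =>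
      ‖z.2 - (n * s z.1) • θ.1‖ ^ 2 :=
    ((measurable_snd.sub (((hsm.comp measurable_fst).const_mul _).smul_const
      θ.1)).norm.pow_const 2)
  have hξθm : Measurable fun z : Ball d × EuclideanSpace ℝ (Fin d) =>
      (inner ℝ θ.1 z.2 - n * s z.1) ^ 2 :=
    ((measurable_const.inner measurable_snd).sub
      ((hsm.comp measurable_fst).const_mul _)).pow_const 2
  obtain ⟨c, hc⟩ : ∃ c : Ball d × EuclideanSpace ℝ (Fin d) → ℝ,
    c = fun z => correlation f (inner ℝ θ.1 (damp hb z.2).1) := ⟨_, rfl⟩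
  have hcm : Measurable c := by
    rw [hc]; exact measurable_correlation.comp (measurable_const.inner hW.subtype_val)
  have hnq : 10 * X * b ≤ n * q := by
    refine le_of_sq_le_sq ?_ (by positivity)
    rw [mul_pow, hb2, mul_pow, mul_pow, ← mul_div_assoc, div_le_iff₀ (by positivity)]
    nlinarith [mul_le_mul_of_nonneg_left hn hn0.le]
  have hgood : m₁ θ {z | c z < 3 / 2 * X} ≤ ENNReal.ofReal (p + 2 ^ 16 * δ) := by
    have hmA : m₁ θ {z | z.1 ∈ (A θ)ᶜ} ≤ ENNReal.ofReal p := by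
      have h4 := h₁ ((A θ)ᶜ.indicator 1) (measurable_one.indicator (hA θ).compl)
      rw [lintegral_indicator_one (hA θ).compl] at h4
      refine le_trans (le_of_eq ?_) (h4.le.trans (hpA θ))
      exact (lintegral_indicator_one (μ := m₁ θ) (measurable_fst (hA θ).compl)).symm
    calc m₁ θ {z | c z < 3 / 2 * X}
        ≤ m₁ θ ({z | z.1 ∈ (A θ)ᶜ} ∪ ({z | b ^ 2 < ‖z.2 - (n * s z.1) • θ.1‖ ^ 2} ∪
            {z | (n * q / 10) ^ 2 < (inner ℝ θ.1 z.2 - n * s z.1) ^ 2})) := by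
          refine measure_mono fun z hz => ?_
          by_contra hcon
          simp only [mem_union, mem_ofPred_eq, not_or, mem_compl_iff, not_not, not_lt] at hcon
          obtain ⟨g1, g2, g3⟩ := hcon
          have hz' : c z < 3 / 2 * X := hz
          refine absurd hz' (not_lt.2 ?_)
          rw [hc]
          refine le_correlation_damp_of_le hb hX0.le hX1 hq0.le ?_ hnq
            (le_of_sq_le_sq g2 hb.le) (s := s z.1) ?_
          · rw [hsg]; exact hq θ _ g1
          · refine abs_le_of_sq_le_sq g3 (by positivity)
      _ ≤ ENNReal.ofReal p + (ENNReal.ofReal (n / 128 / b ^ 2) +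
            ENNReal.ofReal (n / (128 * d) / (n * q / 10) ^ 2)) :=
          (measure_union_le _ _).trans (add_le_add hmA ((measure_union_le _ _).trans (add_le_add
            (measure_lt_le_of_lintegral_le hξm (by positivity) h₂')
            (measure_lt_le_of_lintegral_le hξθm (by positivity) h₃'))))
      _ ≤ _ := by
          rw [← ENNReal.ofReal_add (by positivity) (by positivity),
            ← ENNReal.ofReal_add hp (by positivity)]
          refine ENNReal.ofReal_le_ofReal ?_
          have e1 : (n : ℝ) / 128 / b ^ 2 = δ := by rw [hb2]; field_simp
          -- The noise along `θ` has variance smaller by the factor `d`, and `d X² ≥ 2⁻¹⁶` turns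
          -- `1/(d n q²)` into a multiple of `δ`.
          have e2 : (n : ℝ) / (128 * d) / (n * q / 10) ^ 2 ≤ 2 ^ 15 * δ := by
            rw [div_div, div_le_iff₀ (by positivity)]
            have h5 : 2 * X ^ 2 * (2 ^ 16 * d) ≤ n * (δ * q ^ 2) * (2 ^ 16 * d) := by gcongr
            have h6 : 2 ≤ n * (δ * q ^ 2) * (2 ^ 16 * d) := by nlinarith
            have h7 : (n : ℝ) * 2 ≤ n * (n * (δ * q ^ 2) * (2 ^ 16 * d)) := by gcongr
            calc (n : ℝ) ≤ 2 ^ 15 * 128 / 100 / 2 ^ 16 * (n * 2) := by norm_num; linarith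
              _ ≤ 2 ^ 15 * 128 / 100 / 2 ^ 16 * (n * (n * (δ * q ^ 2) * (2 ^ 16 * d))) := by
                gcongr
              _ = _ := by ring
          rw [e1]
          linarith
  constructor
  · have hset : MeasurableSet {a : Ball d | correlation f (inner ℝ θ.1 a.1) < 3 / 2 * X} :=
      measurableSet_lt (measurable_correlation.comp
        (measurable_const.inner measurable_subtype_coe)) measurable_const
    rw [Measure.map_apply hW hset]
    rw [hc] at hgood
    exact hgood
  · intro hp6
    have hΦ : Measurable fun a : Ball d =>
        ENNReal.ofReal (1 - correlation f (inner ℝ θ.1 a.1)) :=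
      (measurable_const.sub (measurable_correlation.comp
        (measurable_const.inner measurable_subtype_coe))).ennreal_ofReal
    rw [lintegral_map hΦ hW]
    have hB : MeasurableSet {z | c z < 3 / 2 * X} := measurableSet_lt hcm measurable_const
    have hk0 : 0 ≤ 2 / (X * b ^ 2) := by positivity
    calc ∫⁻ z, ENNReal.ofReal (1 - correlation f (inner ℝ θ.1 (damp hb z.2).1)) ∂(m₁ θ)
        ≤ ∫⁻ z, (ENNReal.ofReal (1 - 3 / 2 * X + X / 8) + (ENNReal.ofReal (3 / 2 * X) *
            {z | c z < 3 / 2 * X}.indicator 1 z + ENNReal.ofReal (2 / (X * b ^ 2)) *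
              ENNReal.ofReal ((inner ℝ θ.1 z.2 - n * s z.1) ^ 2))) ∂(m₁ θ) := by
          refine lintegral_mono fun z => ?_
          have hcz : c z = correlation f (inner ℝ θ.1 (damp hb z.2).1) := by rw [hc]
          rw [← hcz]
          by_cases hz : c z < 3 / 2 * X
          · rw [indicator_of_mem (by exact hz), Pi.one_apply, mul_one, ← ENNReal.ofReal_mul hk0,
              ← ENNReal.ofReal_add (by positivity) (by positivity),
              ← ENNReal.ofReal_add (by linarith) (by positivity)]
            refine ENNReal.ofReal_le_ofReal ?_
            have h4 := neg_abs_div_le_correlation_damp (f := f) (θ := θ) (W := z.2) (n := n) hb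
              (hs0 z.1)
            rw [← hcz] at h4
            obtain ⟨t, ht⟩ : ∃ t : ℝ, t = |inner ℝ θ.1 z.2 - n * s z.1| / b := ⟨_, rfl⟩
            have h5 : 2 / (X * b ^ 2) * (inner ℝ θ.1 z.2 - n * s z.1) ^ 2 = 2 / X * t ^ 2 := by
              rw [ht, div_pow, sq_abs]; field_simp
            -- AM-GM, so that the mean of the negative part is controlled by the second moment of
            -- the noise along `θ`.
            have h6 : t ≤ X / 8 + 2 / X * t ^ 2 := by
              have : X / 8 + 2 / X * t ^ 2 - t = (X - 4 * t) ^ 2 / (8 * X) := by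
                field_simp; ring
              have h7 : 0 ≤ (X - 4 * t) ^ 2 / (8 * X) := by positivity
              linarith
            rw [h5]
            rw [← ht] at h4
            linarith
          · refine le_trans (ENNReal.ofReal_le_ofReal ?_) le_self_add
            linarith
      _ ≤ ENNReal.ofReal (1 - 3 / 2 * X + X / 8) + (ENNReal.ofReal (3 / 2 * X) *
            ENNReal.ofReal (p + 2 ^ 16 * δ) + ENNReal.ofReal (2 / (X * b ^ 2)) *
              ENNReal.ofReal (n / (128 * d))) := by
          rw [lintegral_add_left measurable_const, lintegral_const, measure_univ, mul_one,
            lintegral_add_left ((measurable_one.indicator hB).const_mul _),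
            lintegral_const_mul _ (measurable_one.indicator hB), lintegral_indicator_one hB,
            lintegral_const_mul _ hξθm.ennreal_ofReal]
          gcongr
      _ ≤ ENNReal.ofReal (1 - X) := by
          rw [← ENNReal.ofReal_mul (by positivity), ← ENNReal.ofReal_mul hk0,
            ← ENNReal.ofReal_add (by positivity) (by positivity),
            ← ENNReal.ofReal_add (by linarith) (by positivity)]
          refine ENNReal.ofReal_le_ofReal ?_
          -- The gain `3X/2` on the good event is reduced by `X/8` twice, from the two terms of
          -- AM-GM, and by `(3/2) X · (1/6) = X/4` from the failure probability; `X` remains.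
          have h8 : 2 / (X * b ^ 2) * (n / (128 * d)) ≤ X / 8 := by
            have e1 : 2 / (X * b ^ 2) * (n / (128 * d)) = 2 * δ / (X * d) := by
              rw [hb2]; field_simp
            rw [e1, div_le_iff₀ (by positivity)]
            nlinarith
          nlinarith

end stage

end

/-! ### Upper bound: choice of the slope, first action and final rounding. -/

section

variable {d T : ℕ} {f : ℝ → ℝ}

/-! ### Large slopes and the integral that bounds the number of rounds -/

lemma bestSlopeSq_mono (f : ℝ → ℝ) (r : ℝ) {x X : ℝ} (h : x ≤ X) :
    bestSlopeSq f r x ≤ bestSlopeSq f r X :=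
  biSup_mono fun _ hy => ⟨hy.1, hy.2.trans h⟩

lemma upperIntegral_mono (f : ℝ → ℝ) (r : ℝ) {x X : ℝ} (h : x ≤ X) :
    upperIntegral f r x ≤ upperIntegral f r X :=
  lintegral_mono_set (Ioc_subset_Ioc_right h)

lemma le_setLIntegral_bestSlopeSq (f : ℝ → ℝ) (r : ℝ) {a X : ℝ} (ha : 0 ≤ a) (haX : a ≤ X) :
    ENNReal.ofReal (X ^ 2 - a ^ 2) / bestSlopeSq f r X ≤
      ∫⁻ x in Ioc a X, ENNReal.ofReal (2 * x) / bestSlopeSq f r x := by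
  calc _ = ∫⁻ x in Ioc a X, ENNReal.ofReal (2 * x) / bestSlopeSq f r X := by
        simp_rw [div_eq_mul_inv]
        rw [lintegral_mul_const _ (by fun_prop), lintegral_two_mul ha haX]
    _ ≤ _ := setLIntegral_mono' measurableSet_Ioc fun x hx =>
        ENNReal.div_le_div_left (bestSlopeSq_mono f r hx.2) _

lemma upperIntegral_add_le (f : ℝ → ℝ) {r a X : ℝ} (hra : r ≤ a) (haX : a ≤ X) :
    upperIntegral f r a + ∫⁻ x in Ioc a X, ENNReal.ofReal (2 * x) / bestSlopeSq f r x ≤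
      upperIntegral f r X := by
  unfold upperIntegral
  rw [← lintegral_union measurableSet_Ioc, Ioc_union_Ioc_eq_Ioc hra haX]
  exact Set.disjoint_left.2 fun x h1 h2 => absurd h1.2 (not_le.2 h2.1)

/-- Slope `m` on an interval of length `y/2` would raise `f` by `m y/2 > 1`, more than `|f| ≤ 1`
allows starting from a nonnegative value. -/
lemma iInf_deriv_sq_le (hf : LinkFunction f) {y m : ℝ} (hy : 0 < y) (hy1 : y ≤ 1 / 2)
    (hm : 0 < m) (h : 2 < m * y) :
    ⨅ z ∈ Icc (y / 2) y, ENNReal.ofReal (deriv f z ^ 2) ≤ ENNReal.ofReal (m ^ 2) := by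
  by_contra hcon
  rw [not_le] at hcon
  have hs : ∀ z ∈ Icc (y / 2) y, m ^ 2 ≤ deriv f z ^ 2 := fun z hz => by
    have h1 : ENNReal.ofReal (m ^ 2) ≤ ENNReal.ofReal (deriv f z ^ 2) :=
      hcon.le.trans (iInf₂_le z hz)
    exact (ENNReal.ofReal_le_ofReal_iff (sq_nonneg _)).1 h1
  have h1 := hf.mul_sub_le hy hy1 hm hs le_rfl (by linarith : y / 2 ≤ y) le_rfl
  have h2 : 0 ≤ clipLink f (y / 2) := clipLink_nonneg hf (by linarith)
  rw [clipLink_eq f ⟨by linarith, by linarith⟩] at h2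
  have h3 := (abs_le.1 (hf.abs_le_one y ⟨by linarith, by linarith⟩)).2
  nlinarith

/-- If the integral is finite, some scale has a slope that is optimal up to a constant. -/
lemma exists_slope (hf : LinkFunction f) {r X : ℝ} (hr : 0 < r) (hrX : r < X) (hX1 : X ≤ 1 / 2)
    (h : upperIntegral f r X ≠ ⊤) : ∃ y ∈ Icc r X, ∃ m : ℝ, 0 < m ∧ m * r ≤ 4 ∧
      (∀ z ∈ Icc (y / 2) y, m ^ 2 ≤ deriv f z ^ 2) ∧
      bestSlopeSq f r X ≤ ENNReal.ofReal (2 * m ^ 2) := by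
  have hub : ∀ y ∈ Icc r X, ⨅ z ∈ Icc (y / 2) y, ENNReal.ofReal (deriv f z ^ 2) ≤
      ENNReal.ofReal ((4 / r) ^ 2) := fun y hy =>
    iInf_deriv_sq_le hf (hr.trans_le hy.1) (hy.2.trans hX1) (by positivity) (by
      rw [div_mul_eq_mul_div, lt_div_iff₀ hr]; linarith [hy.1])
  have hMtop : bestSlopeSq f r X ≠ ⊤ :=
    ((iSup₂_le hub).trans_lt ENNReal.ofReal_lt_top).ne
  -- `bestSlopeSq f r` increases in its last argument; if it vanished at `X`, the integrand would be
  -- infinite on all of `(r, X]`.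
  have hM0 : bestSlopeSq f r X ≠ 0 := fun h0 => h <| by
    have h1 := le_setLIntegral_bestSlopeSq f r hr.le hrX.le
    rw [h0, ENNReal.div_zero (by
      rw [Ne, ENNReal.ofReal_eq_zero, not_le]; nlinarith)] at h1
    exact top_le_iff.1 h1
  -- The supremum need not be attained; half of it is exceeded, which is the factor `2` in the
  -- conclusion.
  have h2 : bestSlopeSq f r X / 2 < bestSlopeSq f r X := ENNReal.half_lt_self hM0 hMtop
  conv at h2 => rhs; unfold bestSlopeSq
  simp only [lt_iSup_iff] at h2
  obtain ⟨y, hy, h3⟩ := h2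
  obtain ⟨v, hv⟩ : ∃ v : ℝ≥0∞, v = ⨅ z ∈ Icc (y / 2) y, ENNReal.ofReal (deriv f z ^ 2) :=
    ⟨_, rfl⟩
  have hvub := hub y hy
  rw [← hv] at h3 hvub
  have hvtop : v ≠ ⊤ := (hvub.trans_lt ENNReal.ofReal_lt_top).ne
  have hv0 : 0 < v.toReal := ENNReal.toReal_pos (ne_bot_of_gt h3) hvtop
  have hsq : Real.sqrt v.toReal ^ 2 = v.toReal := Real.sq_sqrt hv0.le
  refine ⟨y, hy, Real.sqrt v.toReal, Real.sqrt_pos.2 hv0, ?_, fun z hz => ?_, ?_⟩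
  · have h4 := ENNReal.toReal_le_of_le_ofReal (by positivity) hvub
    have h5 : Real.sqrt v.toReal ≤ 4 / r :=
      Real.sqrt_le_left (by positivity) |>.2 h4
    rwa [le_div_iff₀ hr] at h5
  · rw [hsq]
    refine ENNReal.toReal_le_of_le_ofReal (sq_nonneg _) ?_
    rw [hv]
    exact iInf₂_le z hz
  · rw [hsq, ENNReal.ofReal_mul zero_le_two, ENNReal.ofReal_toReal hvtop, ENNReal.ofReal_ofNat,
      mul_comm, ← ENNReal.div_le_iff (by simp) (by simp)]
    exact h3.le

/-! ### The first action -/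

/-- A Gaussian vector `x` with `‖x‖ ≤ 5 √d` and `|⟨θ, x⟩| ≥ 5/128`, divided by `5 √d`, has
correlation at least `1/(128 √d)` up to sign. This costs no round, and it is needed because the
signal of an even function vanishes at the origin. -/
lemma Realizable.exists_init_of_isEven (hd : 0 < d) (he : IsEven f) (F : ℝ → ℝ) :
    ∃ m : Sphere d → Measure (Ball d), Realizable F d 0 m ∧ ∀ θ,
      m θ {a | correlation f (inner ℝ θ.1 a.1) < (128 * Real.sqrt d)⁻¹} ≤
        ENNReal.ofReal (1 / 12) := by
  have hd' : (0 : ℝ) < d := by exact_mod_cast hd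
  have hsd : 0 < Real.sqrt d := Real.sqrt_pos.2 hd'
  have hb : 0 < 5 * Real.sqrt d := by positivity
  have hdm := measurable_damp (d := d) hb
  have : IsProbabilityMeasure ((stdGaussian (EuclideanSpace ℝ (Fin d))).map (damp hb)) :=
    Measure.isProbabilityMeasure_map hdm.aemeasurable
  refine ⟨_, Realizable.const hd ((stdGaussian (EuclideanSpace ℝ (Fin d))).map (damp hb)),
    fun θ => ?_⟩
  have hθ : ‖θ.1‖ = 1 := norm_eq_of_mem_sphere θ
  have hset : MeasurableSet {a : Ball d |
      correlation f (inner ℝ θ.1 a.1) < (128 * Real.sqrt d)⁻¹} :=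
    measurableSet_lt (measurable_correlation.comp
      (measurable_const.inner measurable_subtype_coe)) measurable_const
  rw [Measure.map_apply hdm hset]
  calc _ ≤ stdGaussian (EuclideanSpace ℝ (Fin d)) ({x | |inner ℝ θ.1 x| < 5 / 128} ∪
          {x | 25 * d < ‖x‖ ^ 2}) := by
        refine measure_mono fun x hx => ?_
        by_contra hcon
        simp only [mem_union, mem_ofPred_eq, not_or, not_lt] at hcon
        obtain ⟨h1, h2⟩ := hcon
        have hx' : correlation f (inner ℝ θ.1 (damp hb x).1) < (128 * Real.sqrt d)⁻¹ := hx
        refine absurd hx' (not_lt.2 ?_)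
        have h3 : ‖x‖ ≤ 5 * Real.sqrt d := by
          refine le_of_sq_le_sq ?_ hb.le
          rw [mul_pow, Real.sq_sqrt hd'.le]
          linarith
        rw [correlation_of_isEven he]
        simp only [damp]
        rw [max_eq_right h3, real_inner_smul_right, abs_mul, abs_of_pos (by positivity),
          le_inv_mul_iff₀ hb]
        refine le_trans (le_of_eq ?_) h1
        field_simp
    _ ≤ ENNReal.ofReal (5 / 128) + ENNReal.ofReal 25⁻¹ :=
        (measure_union_le _ _).trans (add_le_add (stdGaussian_abs_inner_lt_le hθ)
          (stdGaussian_norm_sq_gt_le (by norm_num)))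
    _ ≤ _ := by
        rw [← ENNReal.ofReal_add (by norm_num) (by norm_num)]
        exact ENNReal.ofReal_le_ofReal (by norm_num)

/-! ### Rounding to the sphere -/

/-- The direction of a vector, where the origin is assigned the direction `e`. -/
noncomputable def direction (e : Sphere d) (a : Ball d) : EuclideanSpace ℝ (Fin d) :=
  open Classical in if a.1 = 0 then e.1 else ‖a.1‖⁻¹ • a.1

lemma norm_direction (e : Sphere d) (a : Ball d) : ‖direction e a‖ = 1 := by
  unfold direction
  split_ifs with h
  · exact norm_eq_of_mem_sphere e
  · rw [norm_smul, norm_inv, norm_norm, inv_mul_cancel₀ (norm_ne_zero_iff.2 h)]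

lemma norm_smul_direction (e : Sphere d) (a : Ball d) : ‖a.1‖ • direction e a = a.1 := by
  unfold direction
  split_ifs with h
  · rw [h, norm_zero, zero_smul]
  · rw [smul_smul, mul_inv_cancel₀ (norm_ne_zero_iff.2 h), one_smul]

lemma measurable_direction (e : Sphere d) : Measurable (direction e) :=
  Measurable.ite (measurableSet_eq_fun measurable_subtype_coe measurable_const)
    measurable_const (by fun_prop)

/-- A vector is the mean of its direction with a random sign. -/
noncomputable def roundSphere (e : Sphere d) (q : Ball d × ℝ) : Sphere d :=
  ⟨(if q.2 ≤ (1 + ‖q.1.1‖) / 2 then (1 : ℝ) else -1) • direction e q.1, by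
    rw [mem_sphere_zero_iff_norm, norm_smul, norm_direction]
    split_ifs <;> simp⟩

lemma measurable_roundSphere (e : Sphere d) : Measurable (roundSphere e) := by
  have h1 : Measurable fun q : Ball d × ℝ => (if q.2 ≤ (1 + ‖q.1.1‖) / 2 then (1 : ℝ) else -1) :=
    Measurable.ite (measurableSet_le measurable_snd
      (by fun_prop)) measurable_const measurable_const
  exact (h1.smul ((measurable_direction e).comp measurable_fst)).subtype_mk

lemma lintegral_ite_le {α x y : ℝ} (h0 : 0 ≤ α) (h1 : α ≤ 1) :
    ∫⁻ t, (if t ≤ α then ENNReal.ofReal x else ENNReal.ofReal y)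
      ∂(volume.restrict (Icc (0 : ℝ) 1)) =
      ENNReal.ofReal α * ENNReal.ofReal x + ENNReal.ofReal (1 - α) * ENNReal.ofReal y := by
  have e : (fun t : ℝ => if t ≤ α then ENNReal.ofReal x else ENNReal.ofReal y) =
      fun t => (Iic α).indicator (fun _ => ENNReal.ofReal x) t +
        (Ioi α).indicator (fun _ => ENNReal.ofReal y) t := by
    ext t
    by_cases h : t ≤ α
    · simp [h]
    · simp [h, not_le.1 h]
  rw [e, lintegral_add_left (measurable_const.indicator measurableSet_Iic),
    lintegral_indicator_const measurableSet_Iic, lintegral_indicator_const measurableSet_Ioi,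
    Measure.restrict_apply measurableSet_Iic, Measure.restrict_apply measurableSet_Ioi]
  have e1 : Iic α ∩ Icc (0 : ℝ) 1 = Icc 0 α := by
    ext t; simp only [mem_inter_iff, mem_Iic, mem_Icc]; constructor
    · rintro ⟨h, h', _⟩; exact ⟨h', h⟩
    · rintro ⟨h, h'⟩; exact ⟨h', h, h'.trans h1⟩
  have e2 : Ioi α ∩ Icc (0 : ℝ) 1 = Ioc α 1 := by
    ext t; simp only [mem_inter_iff, mem_Ioi, mem_Icc, mem_Ioc]; constructor
    · rintro ⟨h, _, h'⟩; exact ⟨h, h'⟩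
    · rintro ⟨h, h'⟩; exact ⟨h, h0.trans h.le, h'⟩
  rw [e1, e2, Real.volume_Icc, Real.volume_Ioc, sub_zero, mul_comm, mul_comm (ENNReal.ofReal y)]

/-- The random sign has mean `‖a‖`, so the signed correlation is preserved in the mean. The absolute
correlation does not depend on the sign and can only grow, as `‖a‖ ≤ 1`. -/
lemma lintegral_correlation_roundSphere_le (f : ℝ → ℝ) (e θ : Sphere d) (a : Ball d) :
    ∫⁻ t, ENNReal.ofReal (1 - correlation f (inner ℝ (roundSphere e (a, t)).1 θ.1))
      ∂(volume.restrict (Icc (0 : ℝ) 1)) ≤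
      ENNReal.ofReal (1 - correlation f (inner ℝ θ.1 a.1)) := by
  have ha1 : ‖a.1‖ ≤ 1 := mem_closedBall_zero_iff.1 a.2
  have ha0 : 0 ≤ ‖a.1‖ := norm_nonneg _
  obtain ⟨v, hv⟩ : ∃ v : ℝ, v = inner ℝ (direction e a) θ.1 := ⟨_, rfl⟩
  have hv1 : |v| ≤ 1 := by
    rw [hv]
    refine (abs_real_inner_le_norm _ _).trans ?_
    rw [norm_direction, norm_eq_of_mem_sphere θ, one_mul]
  have hav : inner ℝ θ.1 a.1 = ‖a.1‖ * v := by
    rw [hv, ← real_inner_smul_left, norm_smul_direction, real_inner_comm]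
  have h1 : ∀ t : ℝ, ENNReal.ofReal (1 - correlation f (inner ℝ (roundSphere e (a, t)).1 θ.1)) =
      if t ≤ (1 + ‖a.1‖) / 2 then ENNReal.ofReal (1 - correlation f v) else
        ENNReal.ofReal (1 - correlation f (-v)) := fun t => by
    simp only [roundSphere, real_inner_smul_left, ← hv]
    split_ifs <;> simp
  simp_rw [h1]
  rw [lintegral_ite_le (by positivity) (by linarith), hav, correlation_mul_of_nonneg ha0]
  have h2 : correlation f v ≤ 1 := correlation_le_one hv1
  have h3 : correlation f (-v) ≤ 1 := correlation_le_one (by rwa [abs_neg])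
  rw [← ENNReal.ofReal_mul (by positivity), ← ENNReal.ofReal_mul (by linarith),
    ← ENNReal.ofReal_add (mul_nonneg (by positivity) (by linarith))
      (mul_nonneg (by linarith) (by linarith))]
  refine ENNReal.ofReal_le_ofReal ?_
  unfold correlation at *
  split_ifs at *
  · rw [abs_neg]
    nlinarith [abs_nonneg v]
  · nlinarith

lemma Realizable.round_sphere {F : ℝ → ℝ} (hF : Measurable F) {m : Sphere d → Measure (Ball d)}
    (h : Realizable F d T m) (e : Sphere d) (f : ℝ → ℝ) :
    ∃ m' : Sphere d → Measure (Sphere d), Realizable F d T m' ∧ ∀ θ,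
      ∫⁻ x, ENNReal.ofReal (1 - correlation f (inner ℝ x.1 θ.1)) ∂(m' θ) ≤
        ∫⁻ a, ENNReal.ofReal (1 - correlation f (inner ℝ θ.1 a.1)) ∂(m θ) := by
  have : IsProbabilityMeasure (volume.restrict (Icc (0 : ℝ) 1)) :=
    ⟨by rw [Measure.restrict_apply_univ, Real.volume_Icc]; simp⟩
  have hU := measurable_roundSphere e
  refine ⟨_, h.randomize hF (volume.restrict (Icc (0 : ℝ) 1)) hU, fun θ => ?_⟩
  have hp := h.isProbabilityMeasure hF θ
  have hΦ : Measurable fun x : Sphere d =>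
      ENNReal.ofReal (1 - correlation f (inner ℝ x.1 θ.1)) :=
    (measurable_const.sub (measurable_correlation.comp
      (measurable_subtype_coe.inner measurable_const))).ennreal_ofReal
  have hΦU : Measurable fun q : Ball d × ℝ =>
      ENNReal.ofReal (1 - correlation f (inner ℝ (roundSphere e q).1 θ.1)) := hΦ.comp hU
  rw [lintegral_map hΦ hU, lintegral_prod _ hΦU.aemeasurable]
  exact lintegral_mono fun a => lintegral_correlation_roundSphere_le f e θ a

end

/-! ### Upper bound: iteration of the stages and the total number of rounds. -/

section

variable {d T : ℕ} {f : ℝ → ℝ}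

/-! ### The upper bound -/

/-- The law of an action whose correlation is at least `3 / 2 * X`, up to failure
probability `p`. -/
structure Attains (f : ℝ → ℝ) (d T : ℕ) (p X : ℝ) (m : Sphere d → Measure (Ball d)) : Prop where
  realizable : Realizable (clipLink f) d T m
  measure_lt_le : ∀ θ,
    m θ {a | correlation f (inner ℝ θ.1 a.1) < 3 / 2 * X} ≤ ENNReal.ofReal p
  lintegral_le : ∀ θ, ∫⁻ a, ENNReal.ofReal (1 - correlation f (inner ℝ θ.1 a.1)) ∂(m θ) ≤
    ENNReal.ofReal (1 - X)

/-- The number of rounds of a stage is at most the corresponding part of the integral. -/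
lemma exists_rounds (hd : 0 < d) {r a X m δ : ℝ} (hr : 256 * Real.sqrt d * r = 1)
    (hrX : r ≤ X) (ha : 0 ≤ a) (haX : X ^ 2 = 2 * a ^ 2) (hm : 0 < m) (hmr : m * r ≤ 4)
    (hM : bestSlopeSq f r X ≤ ENNReal.ofReal (2 * m ^ 2)) (hδ : 0 < δ) (hδ1 : δ ≤ 1) (N : ℕ) :
    ∃ n : ℕ, 2 * X ^ 2 ≤ n * (δ * (((N : ℝ) + 1)⁻¹ * (m / (2 ^ 29 * d))) ^ 2) ∧
      (n : ℝ≥0∞) ≤ ENNReal.ofReal (2 ^ 62 * ((N : ℝ) + 1) ^ 2 / δ) *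
        ((d : ℝ≥0∞) ^ 2 * ∫⁻ x in Ioc a X, ENNReal.ofReal (2 * x) / bestSlopeSq f r x) := by
  have hd' : (0 : ℝ) < d := by exact_mod_cast hd
  have hsd : 0 < Real.sqrt d := Real.sqrt_pos.2 hd'
  have hr0 : 0 < r := pos_of_one_le_mul (by positivity) hr.ge
  have hX0 : 0 < X := hr0.trans_le hrX
  have haX' : a ≤ X := le_of_sq_le_sq (by nlinarith) hX0.le
  obtain ⟨q, hq⟩ : ∃ q : ℝ, q = ((N : ℝ) + 1)⁻¹ * (m / (2 ^ 29 * d)) := ⟨_, rfl⟩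
  obtain ⟨Z, hZ⟩ : ∃ Z : ℝ, Z = 2 * X ^ 2 / (δ * q ^ 2) := ⟨_, rfl⟩
  have hq0 : 0 < q := by rw [hq]; positivity
  have hZ0 : 0 < Z := by rw [hZ]; positivity
  have hZe : Z = 2 ^ 59 * ((N : ℝ) + 1) ^ 2 / δ * (d ^ 2 * (X ^ 2 / m ^ 2)) := by
    rw [hZ, hq]; field_simp
  have hdr : (d : ℝ) * r ^ 2 = 1 / 2 ^ 16 := by
    have h1 : (256 * Real.sqrt d * r) ^ 2 = 1 := by rw [hr]; norm_num
    rw [mul_pow, mul_pow, Real.sq_sqrt hd'.le] at h1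
    linarith
  -- Needed for `⌈Z⌉ ≤ 2Z`, so that rounding up does not spoil the comparison with the integral. It
  -- follows from `m r ≤ 4`, `r ≤ X` and `d r² = 2⁻¹⁶`.
  have hZ1 : 1 ≤ Z := by
    have h1 : (1 : ℝ) ≤ 2 ^ 59 * (d ^ 2 * (X ^ 2 / m ^ 2)) := by
      have h2 : (m * r) ^ 2 ≤ 16 := by nlinarith [mul_pos hm hr0]
      have h3 : r ^ 2 / 16 ≤ 1 / m ^ 2 := by
        rw [div_le_div_iff₀ (by norm_num) (by positivity)]; nlinarith
      have h4 : r ^ 2 * (r ^ 2 / 16) ≤ X ^ 2 * (1 / m ^ 2) := by gcongr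
      have h5 : (d : ℝ) ^ 2 * (r ^ 2 * (r ^ 2 / 16)) = 1 / 2 ^ 36 := by
        have : (d : ℝ) ^ 2 * (r ^ 2 * (r ^ 2 / 16)) = (d * r ^ 2) ^ 2 / 16 := by ring
        rw [this, hdr]; norm_num
      have h6 : (d : ℝ) ^ 2 * (r ^ 2 * (r ^ 2 / 16)) ≤ d ^ 2 * (X ^ 2 * (1 / m ^ 2)) := by gcongr
      rw [mul_one_div] at h6
      rw [h5] at h6
      linarith
    have h7 : 1 ≤ ((N : ℝ) + 1) ^ 2 / δ := by
      rw [le_div_iff₀ hδ]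
      nlinarith [(Nat.cast_nonneg N : (0 : ℝ) ≤ N)]
    rw [hZe]
    calc (1 : ℝ) ≤ (((N : ℝ) + 1) ^ 2 / δ) * (2 ^ 59 * (d ^ 2 * (X ^ 2 / m ^ 2))) :=
          one_le_mul_of_one_le_of_one_le h7 h1
      _ = _ := by ring
  refine ⟨⌈Z⌉₊, ?_, ?_⟩
  · rw [← hq, ← div_le_iff₀ (by positivity), ← hZ]
    exact Nat.le_ceil Z
  · have h1 : (⌈Z⌉₊ : ℝ) ≤ 2 * Z := by linarith [Nat.ceil_lt_add_one hZ0.le]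
    -- Since `a² = X²/2`, the interval `(a, X]` carries the mass `X²/2` of `d(x²)`, and
    -- `bestSlopeSq` is at most `2m²` there.
    have h2 : ENNReal.ofReal (X ^ 2 / (4 * m ^ 2)) ≤
        ∫⁻ x in Ioc a X, ENNReal.ofReal (2 * x) / bestSlopeSq f r x := by
      refine le_trans ?_ (le_setLIntegral_bestSlopeSq f r ha haX')
      refine le_trans (le_of_eq ?_) (ENNReal.div_le_div_left hM _)
      rw [← ENNReal.ofReal_div_of_pos (by positivity)]
      congr 1
      have : X ^ 2 - a ^ 2 = X ^ 2 / 2 := by linarith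
      rw [this]
      field_simp
      norm_num
    calc ((⌈Z⌉₊ : ℕ) : ℝ≥0∞) = ENNReal.ofReal (⌈Z⌉₊ : ℝ) := (ENNReal.ofReal_natCast _).symm
      _ ≤ ENNReal.ofReal (2 ^ 62 * ((N : ℝ) + 1) ^ 2 / δ * (d ^ 2 * (X ^ 2 / (4 * m ^ 2)))) := by
          refine ENNReal.ofReal_le_ofReal (h1.trans (le_of_eq ?_))
          rw [hZe]
          field_simp
          norm_num
      _ = ENNReal.ofReal (2 ^ 62 * ((N : ℝ) + 1) ^ 2 / δ) *
            ((d : ℝ≥0∞) ^ 2 * ENNReal.ofReal (X ^ 2 / (4 * m ^ 2))) := by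
          rw [ENNReal.ofReal_mul (by positivity), ENNReal.ofReal_mul (by positivity),
            ENNReal.ofReal_pow hd'.le, ENNReal.ofReal_natCast]
      _ ≤ _ := by gcongr

section recursion

variable {ℓ : ℕ} {r δ : ℝ}

/-- The first stage. -/
lemma Attains.exists_first (hf : LinkFunction f) (hd : 0 < d) (hℓ : d ≤ 2 ^ ℓ)
    (hr : 256 * Real.sqrt d * r = 1) (hδ : 0 < δ) (hδ1 : δ ≤ 1 / 2 ^ 20) {X : ℝ}
    (hX : 2 * r ^ 2 ≤ X ^ 2) (hX0 : 0 < X) (hX1 : X ≤ 1 / 2) (hXr : X ^ 2 < 4 * r ^ 2)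
    (h : upperIntegral f r X ≠ ⊤) :
    ∃ (T : ℕ) (m : Sphere d → Measure (Ball d)), Attains f d T (1 / 12 + 2 ^ 16 * δ) X m ∧
      (T : ℝ≥0∞) ≤ ENNReal.ofReal (2 ^ 62 * (((24 + 3 * ℓ : ℕ) : ℝ) + 1) ^ 2 / δ) *
        ((d : ℝ≥0∞) ^ 2 * upperIntegral f r X) := by
  have hd' : (0 : ℝ) < d := by exact_mod_cast hd
  have hsd : 0 < Real.sqrt d := Real.sqrt_pos.2 hd'
  have hr0 : 0 < r := pos_of_one_le_mul (by positivity) hr.ge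
  have hrX : r < X := lt_of_pow_lt_pow_left₀ 2 hX0.le (by nlinarith)
  have hX2 : X < 2 * r := lt_of_pow_lt_pow_left₀ 2 (by positivity) (by nlinarith)
  have hp6 : 1 / 12 + 2 ^ 16 * δ ≤ 1 / 6 := by linarith
  have hX256 : 1 ≤ 256 * Real.sqrt d * X := by
    rw [← hr]; gcongr
  obtain ⟨y, hy, m, hm, hmr, hs, hM⟩ := exists_slope hf hr0 hrX hX1 h
  have hy256 : 1 ≤ 256 * Real.sqrt d * y := by
    rw [← hr]; exact mul_le_mul_of_nonneg_left hy.1 (by positivity)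
  -- In the first stage `y ≤ X < 2r`, so `y` lies within a factor two of `1/(256 √d)`; both ways of
  -- starting need this.
  have hy2 : 128 * Real.sqrt d * y ≤ 1 := by
    have h1 : 128 * Real.sqrt d * y ≤ 128 * Real.sqrt d * (2 * r) :=
      mul_le_mul_of_nonneg_left (hy.2.trans hX2.le) (by positivity)
    linarith
  have ha2 : X ^ 2 = 2 * (X / Real.sqrt 2) ^ 2 := by
    rw [div_pow, Real.sq_sqrt zero_le_two]; ring
  have hra : r ≤ X / Real.sqrt 2 := le_of_sq_le_sq (by nlinarith) (by positivity)
  have haX : X / Real.sqrt 2 ≤ X := le_of_sq_le_sq (by nlinarith) hX0.le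
  obtain ⟨n, hn, hnK⟩ := exists_rounds hd hr hrX.le (by positivity) ha2 hm hmr hM hδ
    (by linarith) (24 + 3 * ℓ)
  have hq0 : 0 < (((24 + 3 * ℓ : ℕ) : ℝ) + 1)⁻¹ * (m / (2 ^ 29 * d)) := by positivity
  have hnK' : ((0 + n : ℕ) : ℝ≥0∞) ≤
      ENNReal.ofReal (2 ^ 62 * (((24 + 3 * ℓ : ℕ) : ℝ) + 1) ^ 2 / δ) *
        ((d : ℝ≥0∞) ^ 2 * upperIntegral f r X) := by
    rw [zero_add]
    refine hnK.trans ?_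
    gcongr
    exact le_add_self.trans (upperIntegral_add_le f hra haX)
  rcases hf.monotone with hmono | heven
  -- Monotone case: the base action is the origin, and the larger perturbation `Λ = 256` can
  -- overshoot `y`.
  · have hA : ∀ θ : Sphere d, MeasurableSet {a : Ball d | inner ℝ θ.1 a.1 = 0} := fun θ =>
      measurableSet_eq_fun (measurable_const.inner measurable_subtype_coe) measurable_const
    obtain ⟨m', hm', hprop⟩ := (Realizable.const (F := clipLink f) hd
      (Measure.dirac (⟨0, by simp⟩ : Ball d))).stage hf hd (24 + 3 * ℓ) (le_refl (256 : ℝ)) hA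
      (p := 1 / 12) (by norm_num) (fun θ => by
        rw [Measure.dirac_apply' _ (hA θ).compl]; simp)
      (fun θ a ha => by
        have ha' : inner ℝ θ.1 a.1 = 0 := ha
        rw [ha']
        exact le_correlation_gridSignal_zero hf hmono _ hd (norm_eq_of_mem_sphere θ) hy256 hy2
          (hy.2.trans hX1) hm hs) hq0 hδ hδ1 hX256 hX1 hn
    exact ⟨_, m', ⟨hm', fun θ => (hprop θ).1, fun θ => (hprop θ).2 hp6⟩, hnK'⟩
  -- Even case: the random first action already has correlation at least `1/(128 √d) ≥ y` off an
  -- event of probability `1/12`.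
  · obtain ⟨m₀, hm₀, hfail⟩ := Realizable.exists_init_of_isEven hd heven.1 (clipLink f)
    have hA : ∀ θ : Sphere d, MeasurableSet {a : Ball d |
        correlation f (inner ℝ θ.1 a.1) < (128 * Real.sqrt d)⁻¹}ᶜ := fun θ =>
      (measurableSet_lt (measurable_correlation.comp
        (measurable_const.inner measurable_subtype_coe)) measurable_const).compl
    obtain ⟨m', hm', hprop⟩ := hm₀.stage hf hd (24 + 3 * ℓ) (Λ := 2 ^ 24) (by norm_num) hA
      (p := 1 / 12) (by norm_num) (fun θ => by rw [compl_compl]; exact hfail θ)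
      (fun θ a ha => by
        have ha' : (128 * Real.sqrt d)⁻¹ ≤ correlation f (inner ℝ θ.1 a.1) := not_lt.1 ha
        refine le_correlation_gridSignal hℓ hf hd (norm_eq_of_mem_sphere θ) hy256
          (hy.2.trans hX1) hm hs (le_trans ?_ ha') (abs_inner_le_one θ a)
        rw [le_inv_comm₀ (by linarith [hy.1]) (by positivity), ← one_div, le_div_iff₀
          (by linarith [hy.1])]
        exact hy2) hq0 hδ hδ1 hX256 hX1 hn
    exact ⟨_, m', ⟨hm', fun θ => (hprop θ).1, fun θ => (hprop θ).2 hp6⟩, hnK'⟩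

/-- A further stage. -/
lemma Attains.exists_next (hf : LinkFunction f) (hd : 0 < d) (hℓ : d ≤ 2 ^ ℓ)
    (hr : 256 * Real.sqrt d * r = 1) (hδ : 0 < δ) (hδ1 : δ ≤ 1 / 2 ^ 20) {X X' p : ℝ}
    (hp : 0 ≤ p) (hp6 : p + 2 ^ 16 * δ ≤ 1 / 6) (hX'0 : 0 < X') (hrX' : r ≤ X')
    (hXX' : X ^ 2 = 2 * X' ^ 2) (hX0 : 0 < X) (hX1 : X ≤ 1 / 2)
    (h : upperIntegral f r X ≠ ⊤) {m₀ : Sphere d → Measure (Ball d)}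
    (hm₀ : Attains f d T p X' m₀) :
    ∃ (n : ℕ) (m : Sphere d → Measure (Ball d)), Attains f d (T + n) (p + 2 ^ 16 * δ) X m ∧
      (n : ℝ≥0∞) ≤ ENNReal.ofReal (2 ^ 62 * (((24 + 3 * ℓ : ℕ) : ℝ) + 1) ^ 2 / δ) *
        ((d : ℝ≥0∞) ^ 2 * ∫⁻ x in Ioc X' X, ENNReal.ofReal (2 * x) / bestSlopeSq f r x) := by
  have hd' : (0 : ℝ) < d := by exact_mod_cast hd
  have hsd : 0 < Real.sqrt d := Real.sqrt_pos.2 hd'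
  have hr0 : 0 < r := pos_of_one_le_mul (by positivity) hr.ge
  have hX'X : X' < X := lt_of_pow_lt_pow_left₀ 2 hX0.le (by nlinarith)
  -- The stage returns `3/2` times its target, and `√2 ≤ 3/2`: the slack lets each target grow by
  -- `√2`.
  have hX32 : X ≤ 3 / 2 * X' := le_of_sq_le_sq (by nlinarith) (by positivity)
  have hrX : r < X := hrX'.trans_lt hX'X
  obtain ⟨y, hy, m, hm, hmr, hs, hM⟩ := exists_slope hf hr0 hrX hX1 h
  have hy256 : 1 ≤ 256 * Real.sqrt d * y := by
    rw [← hr]; exact mul_le_mul_of_nonneg_left hy.1 (by positivity)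
  have hX256 : 1 ≤ 256 * Real.sqrt d * X := by
    rw [← hr]; gcongr
  obtain ⟨n, hn, hnK⟩ := exists_rounds hd hr hrX.le hX'0.le hXX' hm hmr hM hδ
    (by linarith) (24 + 3 * ℓ)
  have hq0 : 0 < (((24 + 3 * ℓ : ℕ) : ℝ) + 1)⁻¹ * (m / (2 ^ 29 * d)) := by positivity
  have hA : ∀ θ : Sphere d, MeasurableSet {a : Ball d |
      correlation f (inner ℝ θ.1 a.1) < 3 / 2 * X'}ᶜ := fun θ =>
    (measurableSet_lt (measurable_correlation.comp
      (measurable_const.inner measurable_subtype_coe)) measurable_const).compl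
  obtain ⟨m', hm', hprop⟩ := hm₀.realizable.stage hf hd (24 + 3 * ℓ) (Λ := 2 ^ 24)
    (by norm_num) hA hp (fun θ => by rw [compl_compl]; exact hm₀.measure_lt_le θ)
    (fun θ a ha => by
      have ha' : 3 / 2 * X' ≤ correlation f (inner ℝ θ.1 a.1) := not_lt.1 ha
      exact le_correlation_gridSignal hℓ hf hd (norm_eq_of_mem_sphere θ) hy256
        (hy.2.trans hX1) hm hs (hy.2.trans (hX32.trans ha')) (abs_inner_le_one θ a))
    hq0 hδ hδ1 hX256 hX1 hn
  exact ⟨n, m', ⟨hm', fun θ => (hprop θ).1, fun θ => (hprop θ).2 hp6⟩, hnK⟩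

/-- Induction on the number of halvings of `X²` that bring it into `[2r², 4r²)`. Each stage adds
`2¹⁶ δ` to the failure probability, and the integrals over successive intervals join up to
`upperIntegral f r X`. -/
lemma Attains.exists_of_level (hf : LinkFunction f) (hd : 0 < d) (hℓ : d ≤ 2 ^ ℓ)
    (hr : 256 * Real.sqrt d * r = 1) (hr0 : 0 < r) (hδ : 0 < δ) (hδ1 : δ ≤ 1 / 2 ^ 20) (j : ℕ)
    (hj : 1 / 12 + ((j : ℝ) + 1) * (2 ^ 16 * δ) ≤ 1 / 6) {X : ℝ} (hX : 2 * r ^ 2 ≤ X ^ 2)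
    (hX0 : 0 < X) (hX1 : X ≤ 1 / 2) (hXr : X ^ 2 < 4 * r ^ 2 * 2 ^ j)
    (h : upperIntegral f r X ≠ ⊤) :
    ∃ (T : ℕ) (m : Sphere d → Measure (Ball d)),
      Attains f d T (1 / 12 + ((j : ℝ) + 1) * (2 ^ 16 * δ)) X m ∧
      (T : ℝ≥0∞) ≤ ENNReal.ofReal (2 ^ 62 * (((24 + 3 * ℓ : ℕ) : ℝ) + 1) ^ 2 / δ) *
        ((d : ℝ≥0∞) ^ 2 * upperIntegral f r X) := by
  induction j generalizing X with
  | zero =>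
    simp only [Nat.cast_zero, zero_add, one_mul, pow_zero, mul_one] at hXr ⊢
    exact Attains.exists_first hf hd hℓ hr hδ hδ1 hX hX0 hX1 hXr h
  | succ j ih =>
    rw [Nat.cast_succ] at hj ⊢
    have hj' : 1 / 12 + ((j : ℝ) + 1) * (2 ^ 16 * δ) ≤ 1 / 6 := by linarith
    by_cases hlt : X ^ 2 < 4 * r ^ 2 * 2 ^ j
    -- The level is only an upper bound on the number of stages; here fewer suffice and just the
    -- failure probability is relaxed.
    · obtain ⟨T, m, hm, hT⟩ := ih hj' hX hX0 hX1 hlt h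
      refine ⟨T, m, ⟨hm.realizable, fun θ => (hm.measure_lt_le θ).trans ?_, hm.lintegral_le⟩, hT⟩
      exact ENNReal.ofReal_le_ofReal (by linarith)
    · rw [not_lt] at hlt
      have h2j : (1 : ℝ) ≤ 2 ^ j := one_le_pow₀ (by norm_num)
      have hX4 : 4 * r ^ 2 ≤ X ^ 2 := le_trans (le_mul_of_one_le_right (by positivity) h2j) hlt
      obtain ⟨X', hX'⟩ : ∃ X' : ℝ, X' = X / Real.sqrt 2 := ⟨_, rfl⟩
      have hX'0 : 0 < X' := by rw [hX']; positivity
      have hXX' : X ^ 2 = 2 * X' ^ 2 := by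
        rw [hX', div_pow, Real.sq_sqrt zero_le_two]; ring
      have hX'X : X' ≤ X := le_of_sq_le_sq (by nlinarith) hX0.le
      have hrX' : r ≤ X' := le_of_sq_le_sq (by nlinarith) hX'0.le
      rw [pow_succ (2 : ℝ) j] at hXr
      obtain ⟨T, m₀, hm₀, hT⟩ := ih hj' (X := X') (by linarith) hX'0 (hX'X.trans hX1)
        (by linarith) (ne_top_of_le_ne_top h (upperIntegral_mono f r hX'X))
      obtain ⟨n, m, hm, hn⟩ := Attains.exists_next hf hd hℓ hr hδ hδ1 (by positivity)
        (by linarith) hX'0 hrX' hXX' hX0 hX1 h hm₀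
      refine ⟨T + n, m, ?_, ?_⟩
      · have e : 1 / 12 + ((j : ℝ) + 1 + 1) * (2 ^ 16 * δ) =
          1 / 12 + ((j : ℝ) + 1) * (2 ^ 16 * δ) + 2 ^ 16 * δ := by ring
        rw [e]
        exact hm
      · rw [Nat.cast_add]
        refine (add_le_add hT hn).trans ?_
        rw [← mul_add, ← mul_add]
        gcongr
        exact upperIntegral_add_le f hrX' hX'X

end recursion

lemma burnInCost_le_of_minimaxRisk_le {ε : ℝ} (h : minimaxRisk f d T ≤ ENNReal.ofReal (1 - ε)) :
    (burnInCost f d ε : ℝ≥0∞) ≤ T := by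
  have h1 : burnInCost f d ε ≤ (T : ℕ∞) := iInf₂_le T h
  have h2 := ENat.toENNReal_le.2 h1
  rwa [ENat.toENNReal_coe] at h2

lemma burnInCost_le_mul_upperIntegral (hf : LinkFunction f) (hd : 0 < d) {ε : ℝ}
    (hε : Real.sqrt (2 * (1 / 2 ^ 16) / d) ≤ ε) (hε1 : ε ≤ 1 / 2) :
    (burnInCost f d ε : ℝ≥0∞) ≤
      ENNReal.ofReal (2 ^ 82 * 28 ^ 2 * 14 * (1 + Real.log d) ^ 3) *
        ((d : ℝ≥0∞) ^ 2 * upperIntegral f (Real.sqrt (1 / 2 ^ 16 / d)) ε) := by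
  have hd' : (0 : ℝ) < d := by exact_mod_cast hd
  have hsd : 0 < Real.sqrt d := Real.sqrt_pos.2 hd'
  have hlog : 0 ≤ Real.log d := Real.log_natCast_nonneg d
  obtain ⟨r, hrdef⟩ : ∃ r : ℝ, r = Real.sqrt (1 / 2 ^ 16 / d) := ⟨_, rfl⟩
  have hr0 : 0 < r := by rw [hrdef]; positivity
  have hr2 : r ^ 2 = 1 / 2 ^ 16 / d := by rw [hrdef]; exact Real.sq_sqrt (by positivity)
  have hr : 256 * Real.sqrt d * r = 1 := by
    refine (pow_left_inj₀ (by positivity) zero_le_one two_ne_zero).1 ?_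
    rw [mul_pow, mul_pow, hr2, Real.sq_sqrt hd'.le]
    field_simp
    norm_num
  have hε0 : 0 < ε := lt_of_lt_of_le (Real.sqrt_pos.2 (by positivity)) hε
  have hrε : 2 * r ^ 2 ≤ ε ^ 2 := by
    rw [hr2, ← mul_div_assoc]
    exact (Real.sqrt_le_left hε0.le).1 hε
  rw [← hrdef]
  -- An infinite integral makes the claim trivial because `d > 0`; only finiteness guarantees a
  -- positive slope.
  by_cases h : upperIntegral f r ε = ⊤
  · rw [h, ENNReal.mul_top (by simp; omega), ENNReal.mul_top]
    · exact le_top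
    · rw [Ne, ENNReal.ofReal_eq_zero, not_le]
      positivity
  obtain ⟨ℓ, hℓdef⟩ : ∃ ℓ : ℕ, ℓ = Nat.log 2 d + 1 := ⟨_, rfl⟩
  have hℓ : d < 2 ^ ℓ := by rw [hℓdef]; exact Nat.lt_pow_succ_log_self (by norm_num) d
  have hℓ' : (d : ℝ) < 2 ^ ℓ := by exact_mod_cast hℓ
  have hℓlog : (ℓ : ℝ) ≤ 1 + 2 * Real.log d := by
    have h1 : ((2 : ℝ)) ^ Nat.log 2 d ≤ d := by
      exact_mod_cast Nat.pow_log_le_self 2 hd.ne'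
    have h2 := Real.log_le_log (by positivity) h1
    rw [Real.log_pow] at h2
    have h3 : (0 : ℝ) ≤ Nat.log 2 d := Nat.cast_nonneg _
    rw [hℓdef]
    push_cast
    nlinarith [Real.log_two_gt_d9]
  -- `J` bounds the number of stages: `4 r² · 2^(12 + ℓ) > 1/4 ≥ ε²`. With `δ = 2⁻²⁰/J` they add
  -- `1/16 ≤ 1/12` to the initial failure probability `1/12`.
  obtain ⟨J, hJ⟩ : ∃ J : ℝ, J = 13 + ℓ := ⟨_, rfl⟩
  have hJ0 : 0 < J := by rw [hJ]; positivity
  have hJ1 : 1 ≤ J := by rw [hJ]; linarith [(Nat.cast_nonneg ℓ : (0 : ℝ) ≤ ℓ)]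
  have hJδ : J * (2 ^ 16 * (1 / 2 ^ 20 / J)) = 1 / 16 := by field_simp; norm_num
  have hjJ : ((12 + ℓ : ℕ) : ℝ) + 1 = J := by rw [hJ]; push_cast; ring
  obtain ⟨T, m, hm, hT⟩ := Attains.exists_of_level hf hd hℓ.le hr hr0
    (δ := 1 / 2 ^ 20 / J) (by positivity) (div_le_self (by positivity) hJ1) (12 + ℓ)
    (by rw [hjJ, hJδ]; norm_num) hrε hε0 hε1 (by
      rw [hr2, pow_add]
      have h1 : (1 : ℝ) < 2 ^ ℓ / d := by rwa [lt_div_iff₀ hd', one_mul]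
      have h2 : 4 * (1 / 2 ^ 16 / (d : ℝ)) * (2 ^ 12 * 2 ^ ℓ) = 1 / 4 * (2 ^ ℓ / d) := by
        field_simp; norm_num
      rw [h2]
      nlinarith) h
  have e : Sphere d := signVec hd fun _ => true
  obtain ⟨m', hm', hR⟩ := hm.realizable.round_sphere (measurable_clipLink hf) e f
  have hrisk := hm'.minimaxRisk_le hf (R := ENNReal.ofReal (1 - ε)) fun θ =>
    (hR θ).trans (hm.lintegral_le θ)
  refine (burnInCost_le_of_minimaxRisk_le hrisk).trans (hT.trans ?_)
  gcongr
  -- Two logarithms come from the grid of scales, which enters squared, and one from `1/δ`.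
  have h1 : (((24 + 3 * ℓ : ℕ) : ℝ) + 1) ≤ 28 * (1 + Real.log d) := by push_cast; linarith
  have h2 : J ≤ 14 * (1 + Real.log d) := by rw [hJ]; linarith
  calc 2 ^ 62 * (((24 + 3 * ℓ : ℕ) : ℝ) + 1) ^ 2 / (1 / 2 ^ 20 / J)
      = 2 ^ 82 * (((24 + 3 * ℓ : ℕ) : ℝ) + 1) ^ 2 * J := by field_simp
    _ ≤ 2 ^ 82 * (28 * (1 + Real.log d)) ^ 2 * (14 * (1 + Real.log d)) := by gcongr
    _ = _ := by ring

end

end RidgeBandit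

theorem theorem1p3 :
    (∃ c₁ : ℝ, 0 < c₁ ∧ ∃ C : ℝ, 0 < C ∧ ∃ k : ℕ,
      ∀ (d : ℕ) (f : ℝ → ℝ) (ε : ℝ), 0 < d → RidgeBandit.LinkFunction f →
        Real.sqrt (2 * c₁ / d) ≤ ε → ε ≤ 1 / 2 →
          (RidgeBandit.burnInCost f d ε : ℝ≥0∞) ≤
            ENNReal.ofReal (C * (1 + Real.log d) ^ k) *
              ((d : ℝ≥0∞) ^ 2 * RidgeBandit.upperIntegral f (Real.sqrt (c₁ / d)) ε)) ∧
    (∃ c₂ : ℝ, 0 < c₂ ∧ ∃ C : ℝ, 0 < C ∧ ∃ k : ℕ,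
      ∀ (d : ℕ) (f : ℝ → ℝ) (ε : ℝ) (T : ℕ), 0 < d → RidgeBandit.LinkFunction f →
        (RidgeBandit.IsEven f ∨ RidgeBandit.IsOdd f) → 2 ≤ T →
        Real.sqrt (c₂ * Real.log T / d) ≤ ε → ε ≤ 1 / 2 →
        RidgeBandit.burnInCost f d ε ≤ (T : ℕ∞) →
          (d : ℝ≥0∞) * RidgeBandit.lowerIntegral f (Real.sqrt (c₂ * Real.log T / d)) ε ≤
            ENNReal.ofReal (C * (1 + Real.log d + Real.log T) ^ k) *
              (RidgeBandit.burnInCost f d ε : ℝ≥0∞)) := by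
  refine ⟨⟨1 / 2 ^ 16, by positivity, 2 ^ 82 * 28 ^ 2 * 14, by positivity, 3,
    fun d f ε hd hf h1 h2 => RidgeBandit.burnInCost_le_mul_upperIntegral hf hd h1 h2⟩,
    ⟨256, by norm_num, 8, by norm_num, 0, fun d f ε T hd hf hs hT _ hε h => ?_⟩⟩
  rw [pow_zero, mul_one, ENNReal.ofReal_ofNat]
  exact RidgeBandit.mul_lowerIntegral_le hd hf hs hT hε h
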